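/- **Notation.** For an interval $E\in\{[a,b],\ \mathbb R_+=[0,\infty),\ \mathbb R\}$ ($a<b$) let $\mathcal P(E)$ be the set of probability measures on $E$ with finite moments of all orders, $m_j(\mu)=\int x^j\,d\mu$, and $\mathcal M_n(E)=\{(m_1(\mu),\dots,m_n(\mu)):\mu\in\mathcal P(E)\}\subset\mathbb R^n$. Given $(m_1,\dots,m_n)$, let $m_j^-$ and $m_j^+$ be the infimum and supremum of $m_j(\mu)$ over all $\mu\in\mathcal P(E)$ with $m_i(\mu)=m_i$ for $i<j$. On $\operatorname{Int}\mathcal M_n(E)$ use the coordinates $y=(y_1,\dots,y_n)$ given by * $E=[a,b]$: $y_j=\dfrac{m_j-m_j^-}{m_j^+-m_j^-}\in(0,1)$; * $E=\mathbb R_+$: $y_j=\dfrac{m_j-m_j^-}{m_{j-1}-m_{j-1}^-}\in(0,\infty)$, with $m_0=1$, $m_0^-=0$; * $E=\mathbb R$: $y_{2j-1}=\alpha_j\in\mathbb R$ and $y_{2j}=\beta_j\in(0,\infty)$, the coefficients of the recurrence $P_{j+1}(x)=(x-\alpha_{j+1})P_j(x)-\beta_jP_{j-1}(x)$, $P_0=1$,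 $P_1=x-\alpha_1$, of the monic polynomials orthogonal with respect to the moments. Let $\varphi_n^E: y\mapsto(m_1,\dots,m_n)$ be the inverse map onto $\operatorname{Int}\mathcal M_n(E)$. For functions $V_1,V_2$ let $\mathbb P_{n,E,V_{1,2}}$ be the probability measure carried by $\operatorname{Int}\mathcal M_n(E)$ with Lebesgue density $$\frac1{Z_n}\exp\Big[-n\sum_{j=1}^{\lfloor (n+1)/2\rfloor}V_1(y_{2j-1})-n\sum_{j=1}^{\lfloor n/2\rfloor}V_2(y_{2j})\Big].$$ **Assumptions.** Let $D_1=D_2=(0,1)$ if $E=[a,b]$; $D_1=D_2=(0,\infty)$ if $E=\mathbb R_+$; $D_1=\mathbb R$, $D_2=(0,\infty)$ if $E=\mathbb R$. For $i=1,2$, $V_i$ is a real function, continuous on $\overline{D_i}$ and $C^2$ on $D_i$. If $E=\mathbb R_+$, there is $\varepsilon>0$ with $V_i(z)/\log z\ge 2+\varepsilon$ for all large $z$, $i=1,2$. If $E=\mathbb R$, there is $\varepsilon>0$ with $V_1(\alpha)/\log|\alpha|\ge1+\varepsilon$ and $V_2(\beta)/\log\beta\ge3+\varepsilon$ for $|\alpha|,\beta$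 large. Put * $W_i(p)=V_i(p)-\log(p(1-p))$, $i=1,2$, if $E=[a,b]$; * $W_i(z)=V_i(z)-\log z$, $i=1,2$, if $E=\mathbb R_+$; * $W_1(\alpha)=V_1(\alpha)$ and $W_2(\beta)=V_2(\beta)-\log\beta$ if $E=\mathbb R$. Each $W_i$ has a unique minimizer $y_i^*$ on $D_i$, and $W_i''(y_i^*)\neq0$. Let $m_j^*$ be the $j$-th moment of the measure $\mu^*$ on $\mathbb R$ which is * for $E=[a,b]$, with $q_i^*=1-y_i^*$ and $l_\pm=a+(b-a)\big(\sqrt{y_1^*q_2^*}\pm\sqrt{y_2^*q_1^*}\big)^2$: $\ \dfrac{\sqrt{(x-l_-)(l_+-x)}}{2\pi y_2^*(x-a)(b-x)}1_{[l_-,l_+]}(x)\,dx+\Big(1-\dfrac{y_1^*}{y_2^*}\Big)_+\delta_a+\Big(\dfrac{y_1^*+y_2^*-1}{y_2^*}\Big)_+\delta_b$; * for $E=\mathbb R_+$, with $l_\pm=(\sqrt{y_1^*}\pm\sqrt{y_2^*})^2$: $\ \Big(1-\dfrac{y_1^*}{y_2^*}\Big)_+\delta_0+\dfrac{\sqrt{(x-l_-)(l_+-x)}}{2\pi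 y_2^*x}1_{[l_-,l_+]}(x)\,dx$; * for $E=\mathbb R$, with $l_\pm=y_1^*\pm2\sqrt{y_2^*}$: $\ \dfrac{1}{2\pi y_2^*}\sqrt{(x-l_-)(l_+-x)}\,1_{[l_-,l_+]}(x)\,dx$. **Theorem 3.2.** In each of the three cases, let $m^{(n)}=(m_1^{(n)},\dots,m_n^{(n)})$, $n\ge1$, be random vectors on a common probability space such that $m^{(n)}$ has law $\mathbb P_{n,E,V_{1,2}}$, let $k\ge1$, and let $(a_n)$ be a real sequence with $a_n\to\infty$ and $a_n=o(\sqrt n)$. Then the sequence $$a_n\big((m_1^{(n)},\dots,m_k^{(n)})-(m_1^*,\dots,m_k^*)\big)$$ satisfies a large deviations principle on $\mathbb R^k$ with speed $b_n=n/a_n^2$ and good rate function $$I(x)=\tfrac12\big\|\operatorname{diag}(W_1''(y_1^*),W_2''(y_2^*),W_1''(y_1^*),\dots)^{1/2}\,D\varphi_k^E(\vec y^*)^{-1}x\big\|_2^2,\qquad \vec y^*=(y_1^*,y_2^*,y_1^*,\dots)\in\mathbb R^k .$$ That is: $b_n\to\infty$; $I$ is lower semicontinuous with compact level sets $\{I\le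 K\}$, $K\ge0$; and, writing $X_n$ for the above random vectors, $\liminf_n\frac1{b_n}\log P(X_n\in O)\ge-\inf_OI$ for every open $O\subset\mathbb R^k$ and $\limsup_n\frac1{b_n}\log P(X_n\in U)\le-\inf_UI$ for every closed $U\subset\mathbb R^k$. -/

import Mathlib

open MeasureTheory ProbabilityTheory Filter Topology Set Polynomial
open scoped ENNReal

noncomputable section

namespace RandomMoments

/-! ### Large deviations principle -/

/-- The random vectors `X n` satisfy, under `P`, a large deviations principle with speed `b`
and good rate function `I`. Logarithms, and infima over sets, take values in `EReal`, so that
`log 0 = -∞` and the infimum over the empty set is `+∞`. -/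
structure SatisfiesLDP {Ω 𝒳 : Type*} [MeasurableSpace Ω] [TopologicalSpace 𝒳]
    (P : Measure Ω) (X : ℕ → Ω → 𝒳) (b : ℕ → ℝ) (I : 𝒳 → ℝ≥0∞) : Prop where
  speed : Tendsto b atTop atTop
  lowerSemicontinuous : LowerSemicontinuous I
  isCompact_level : ∀ K : ℝ, 0 ≤ K → IsCompact {x | I x ≤ ENNReal.ofReal K}
  lower_bound : ∀ O : Set 𝒳, IsOpen O →
    -(⨅ x ∈ O, ((I x : ℝ≥0∞) : EReal)) ≤
      liminf (fun n => ((1 / b n : ℝ) : EReal) * ENNReal.log (P {ω | X n ω ∈ O})) atTop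
  upper_bound : ∀ U : Set 𝒳, IsClosed U →
    limsup (fun n => ((1 / b n : ℝ) : EReal) * ENNReal.log (P {ω | X n ω ∈ U})) atTop ≤
      -(⨅ x ∈ U, ((I x : ℝ≥0∞) : EReal))

/-! ### Moment spaces

A vector `m : Fin n → ℝ` stands for `(m_1, …, m_n)`: the entry `m i` is the moment of order
`i + 1`. The same shift applies to vectors of canonical coordinates. -/

/-- The three kinds of intervals `E`: `[a, b]`, `[0, ∞)` and `ℝ`. -/
inductive SupportInterval where
  | compact (a b : ℝ)
  | halfLine
  | line

/-- The interval as a set of reals. -/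
def SupportInterval.carrier : SupportInterval → Set ℝ
  | .compact a b => Icc a b
  | .halfLine => Ici 0
  | .line => univ

/-- The probability measures on `S` with finite moments of all orders. -/
def momentMeasures (S : Set ℝ) : Set (Measure ℝ) :=
  {μ | IsProbabilityMeasure μ ∧ μ Sᶜ = 0 ∧ ∀ j : ℕ, Integrable (fun x : ℝ => x ^ j) μ}

/-- The `n`-th moment space of `S`. -/
def momentSpace (S : Set ℝ) (n : ℕ) : Set (Fin n → ℝ) :=
  {m | ∃ μ ∈ momentMeasures S, ∀ i : Fin n, m i = ∫ x, x ^ ((i : ℕ) + 1) ∂μ}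

/-- The possible values of the moment number `i` (of order `i + 1`), given the moments of lower
order in `m`. -/
def momentSection (S : Set ℝ) {n : ℕ} (m : Fin n → ℝ) (i : Fin n) : Set ℝ :=
  {x | ∃ μ ∈ momentMeasures S,
    (∀ l : Fin n, l < i → ∫ t, t ^ ((l : ℕ) + 1) ∂μ = m l) ∧ ∫ t, t ^ ((i : ℕ) + 1) ∂μ = x}

/-- The lower end `m_j^-` of the section, for `j = i + 1`. -/
def lowerMoment (S : Set ℝ) {n : ℕ} (m : Fin n → ℝ) (i : Fin n) : ℝ :=
  sInf (momentSection S m i)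

/-- The upper end `m_j^+` of the section, for `j = i + 1`. -/
def upperMoment (S : Set ℝ) {n : ℕ} (m : Fin n → ℝ) (i : Fin n) : ℝ :=
  sSup (momentSection S m i)

/-! ### Canonical coordinates -/

/-- Canonical moments on `[a, b]`: `p_j = (m_j - m_j^-) / (m_j^+ - m_j^-)`. -/
def compactCoord (a b : ℝ) {n : ℕ} (m : Fin n → ℝ) (i : Fin n) : ℝ :=
  (m i - lowerMoment (Icc a b) m i) / (upperMoment (Icc a b) m i - lowerMoment (Icc a b) m i)

/-- Canonical moments on `[0, ∞)`: `z_j = (m_j - m_j^-) / (m_{j-1} - m_{j-1}^-)`, where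
`m_0 = 1` and `m_0^- = 0`. -/
def halfLineCoord {n : ℕ} (m : Fin n → ℝ) : Fin n → ℝ
  | ⟨0, h⟩ => m ⟨0, h⟩ - lowerMoment (Ici 0) m ⟨0, h⟩
  | ⟨j + 1, h⟩ =>
    (m ⟨j + 1, h⟩ - lowerMoment (Ici 0) m ⟨j + 1, h⟩) /
      (m ⟨j, Nat.lt_of_succ_lt h⟩ - lowerMoment (Ici 0) m ⟨j, Nat.lt_of_succ_lt h⟩)

/-- The moment of order `j` recorded in `m`, with `m_0 = 1` (and `0` beyond the order `n`). -/
def momentOfOrder {n : ℕ} (m : Fin n → ℝ) : ℕ → ℝ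
  | 0 => 1
  | j + 1 => if h : j < n then m ⟨j, h⟩ else 0

/-- The moment functional `p ↦ ∑ p_j m_j`: on polynomials of degree at most `n` it is integration
against any measure whose first `n` moments are `m`. -/
def momentFunctional {n : ℕ} (m : Fin n → ℝ) (p : ℝ[X]) : ℝ :=
  p.sum fun j c => c * momentOfOrder m j

/-- The monic orthogonal polynomials of a moment functional `L`, by the three-term recurrence
`P_{j+1} = (x - α_{j+1}) P_j - β_j P_{j-1}` with the recurrence coefficients that orthogonality
forces, `α_{j+1} = L(x P_j²) / L(P_j²)` and `β_j = L(P_j²) / L(P_{j-1}²)`. -/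
def monicOrthogonal (L : ℝ[X] → ℝ) : ℕ → ℝ[X]
  | 0 => 1
  | 1 => X - C (L X / L 1)
  | j + 2 =>
    (X - C (L (X * monicOrthogonal L (j + 1) ^ 2) / L (monicOrthogonal L (j + 1) ^ 2))) *
        monicOrthogonal L (j + 1) -
      C (L (monicOrthogonal L (j + 1) ^ 2) / L (monicOrthogonal L j ^ 2)) * monicOrthogonal L j

/-- The recurrence coefficient `α_{j+1}`. -/
def recurrenceAlpha (L : ℝ[X] → ℝ) (j : ℕ) : ℝ :=
  L (X * monicOrthogonal L j ^ 2) / L (monicOrthogonal L j ^ 2)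

/-- The recurrence coefficient `β_{j+1}`. -/
def recurrenceBeta (L : ℝ[X] → ℝ) (j : ℕ) : ℝ :=
  L (monicOrthogonal L (j + 1) ^ 2) / L (monicOrthogonal L j ^ 2)

/-- Recurrence coefficients `(α_1, β_1, α_2, β_2, …)` as coordinates on the moment spaces
of `ℝ`. -/
def lineCoord {n : ℕ} (m : Fin n → ℝ) (i : Fin n) : ℝ :=
  if Even (i : ℕ) then recurrenceAlpha (momentFunctional m) ((i : ℕ) / 2)
  else recurrenceBeta (momentFunctional m) ((i : ℕ) / 2)

/-- The coordinates `y = (y_1, …, y_n)` of a moment vector: canonical moments on `[a, b]` and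
`[0, ∞)`, recurrence coefficients on `ℝ`. -/
def SupportInterval.coord (E : SupportInterval) {n : ℕ} (m : Fin n → ℝ) : Fin n → ℝ :=
  match E with
  | .compact a b => compactCoord a b m
  | .halfLine => halfLineCoord m
  | .line => lineCoord m

/-- The map `φ_n^E` from coordinates to ordinary moments: the inverse of the coordinate map on
the interior of the moment space. -/
def SupportInterval.phi (E : SupportInterval) (n : ℕ) : (Fin n → ℝ) → (Fin n → ℝ) :=
  Function.invFunOn E.coord (interior (momentSpace E.carrier n))

/-- The Jacobian matrix `Dφ_n^E(y)`, with entries `∂m_i / ∂y_j`. -/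
def SupportInterval.phiJacobian (E : SupportInterval) (n : ℕ) (y : Fin n → ℝ) :
    Matrix (Fin n) (Fin n) ℝ :=
  LinearMap.toMatrix' (fderiv ℝ (E.phi n) y).toLinearMap

/-! ### Random moment vectors -/

/-- The alternating sequence `x₁, x₂, x₁, x₂, …`, indexed from `0`. -/
def alternating {β : Type*} (x₁ x₂ : β) (i : ℕ) : β := if Even i then x₁ else x₂

/-- The unnormalized density `exp(-n ∑ V₁(y_{2j-1}) - n ∑ V₂(y_{2j}))` of a moment vector with
coordinates `y`. -/
def SupportInterval.weight (E : SupportInterval) (V₁ V₂ : ℝ → ℝ) (n : ℕ) (m : Fin n → ℝ) : ℝ≥0∞ :=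
  ENNReal.ofReal (Real.exp (-(n : ℝ) * ∑ i : Fin n, alternating V₁ V₂ i (E.coord m i)))

/-- The unnormalized law: this density with respect to Lebesgue measure on the interior of the
moment space, and no mass elsewhere. -/
def SupportInterval.weightMeasure (E : SupportInterval) (V₁ V₂ : ℝ → ℝ) (n : ℕ) :
    Measure (Fin n → ℝ) :=
  (volume.restrict (interior (momentSpace E.carrier n))).withDensity (E.weight V₁ V₂ n)

/-- The law `ℙ_{n,E,V}` on the moment space: the measure above divided by its total mass. -/
def SupportInterval.momentLaw (E : SupportInterval) (V₁ V₂ : ℝ → ℝ) (n : ℕ) :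
    Measure (Fin n → ℝ) :=
  (E.weightMeasure V₁ V₂ n univ)⁻¹ • E.weightMeasure V₁ V₂ n

/-! ### Assumptions on the potentials -/

/-- The open range of the odd-numbered coordinates `y_1, y_3, …`. -/
def SupportInterval.oddRange : SupportInterval → Set ℝ
  | .compact _ _ => Ioo 0 1
  | .halfLine => Ioi 0
  | .line => univ

/-- The open range of the even-numbered coordinates `y_2, y_4, …`. -/
def SupportInterval.evenRange : SupportInterval → Set ℝ
  | .compact _ _ => Ioo 0 1
  | .halfLine => Ioi 0
  | .line => Ioi 0

/-- The effective potential `W₁` of the odd-numbered coordinates. -/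
def SupportInterval.W₁ (E : SupportInterval) (V₁ : ℝ → ℝ) (y : ℝ) : ℝ :=
  match E with
  | .compact _ _ => V₁ y - Real.log (y * (1 - y))
  | .halfLine => V₁ y - Real.log y
  | .line => V₁ y

/-- The effective potential `W₂` of the even-numbered coordinates. -/
def SupportInterval.W₂ (E : SupportInterval) (V₂ : ℝ → ℝ) (y : ℝ) : ℝ :=
  match E with
  | .compact _ _ => V₂ y - Real.log (y * (1 - y))
  | .halfLine => V₂ y - Real.log y
  | .line => V₂ y - Real.log y

/-- The growth condition on the potentials that makes the density integrable. -/
def SupportInterval.Growth (E : SupportInterval) (V₁ V₂ : ℝ → ℝ) : Prop :=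
  match E with
  | .compact _ _ => True
  | .halfLine => ∃ ε > 0, ∃ R : ℝ, ∀ z, R ≤ z →
      2 + ε ≤ V₁ z / Real.log z ∧ 2 + ε ≤ V₂ z / Real.log z
  | .line => ∃ ε > 0, ∃ R : ℝ,
      (∀ α, R ≤ |α| → 1 + ε ≤ V₁ α / Real.log |α|) ∧ (∀ β, R ≤ β → 3 + ε ≤ V₂ β / Real.log β)

/-- `y` lies in `D` and is the only minimizer of `W` over `D`. -/
def IsUniqueMinimizer (W : ℝ → ℝ) (D : Set ℝ) (y : ℝ) : Prop :=
  y ∈ D ∧ ∀ x ∈ D, x ≠ y → W y < W x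

/-- The standing assumptions: regularity and growth of the potentials, unique minimizers `y₁`,
`y₂` of the effective potentials, and non-vanishing second derivatives there. -/
structure SupportInterval.Admissible (E : SupportInterval) (V₁ V₂ : ℝ → ℝ) (y₁ y₂ : ℝ) :
    Prop where
  nondegenerate : ∀ a b : ℝ, E = .compact a b → a < b
  continuousOn₁ : ContinuousOn V₁ (closure E.oddRange)
  continuousOn₂ : ContinuousOn V₂ (closure E.evenRange)
  contDiffOn₁ : ContDiffOn ℝ 2 V₁ E.oddRange
  contDiffOn₂ : ContDiffOn ℝ 2 V₂ E.evenRange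
  growth : E.Growth V₁ V₂
  minimizer₁ : IsUniqueMinimizer (E.W₁ V₁) E.oddRange y₁
  minimizer₂ : IsUniqueMinimizer (E.W₂ V₂) E.evenRange y₂
  deriv_ne₁ : iteratedDeriv 2 (E.W₁ V₁) y₁ ≠ 0
  deriv_ne₂ : iteratedDeriv 2 (E.W₂ V₂) y₂ ≠ 0

/-! ### Limiting measures and limiting moments -/

/-- The density `c(x) √((x - l₋)(l₊ - x))` on `[l₋, l₊]`, extended by zero. -/
def arcDensity (lm lp : ℝ) (c : ℝ → ℝ) (x : ℝ) : ℝ≥0∞ :=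
  (Icc lm lp).indicator (fun t => ENNReal.ofReal (c t * √((t - lm) * (lp - t)))) x

/-- The free binomial (Kesten-McKay) distribution on `[a, b]`. -/
def freeBinomial (a b p₁ p₂ : ℝ) : Measure ℝ :=
  volume.withDensity
      (arcDensity (a + (b - a) * (√(p₁ * (1 - p₂)) - √(p₂ * (1 - p₁))) ^ 2)
        (a + (b - a) * (√(p₁ * (1 - p₂)) + √(p₂ * (1 - p₁))) ^ 2)
        fun x => 1 / (2 * Real.pi * p₂ * (x - a) * (b - x))) +
    ENNReal.ofReal (1 - p₁ / p₂) • Measure.dirac a +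
    ENNReal.ofReal ((p₁ + p₂ - 1) / p₂) • Measure.dirac b

/-- The Marchenko-Pastur distribution with parameters `z₁`, `z₂`. -/
def marchenkoPastur (z₁ z₂ : ℝ) : Measure ℝ :=
  ENNReal.ofReal (1 - z₁ / z₂) • Measure.dirac 0 +
    volume.withDensity
      (arcDensity ((√z₁ - √z₂) ^ 2) ((√z₁ + √z₂) ^ 2) fun x => 1 / (2 * Real.pi * z₂ * x))

/-- The semicircle distribution with mean `α` and variance `β`. -/
def semicircle (α β : ℝ) : Measure ℝ :=
  volume.withDensity
    (arcDensity (α - 2 * √β) (α + 2 * √β) fun _ => 1 / (2 * Real.pi * β))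

/-- The measure whose moments are the limits of the random moments. -/
def SupportInterval.limitMeasure (E : SupportInterval) (y₁ y₂ : ℝ) : Measure ℝ :=
  match E with
  | .compact a b => freeBinomial a b y₁ y₂
  | .halfLine => marchenkoPastur y₁ y₂
  | .line => semicircle y₁ y₂

/-- The limiting moments `(m_1^*, …, m_k^*)`. -/
def SupportInterval.limitMoments (E : SupportInterval) (y₁ y₂ : ℝ) (k : ℕ) : Fin k → ℝ :=
  fun i => ∫ x, x ^ ((i : ℕ) + 1) ∂(E.limitMeasure y₁ y₂)

/-- The first `k` entries of a vector of length `n`; entries beyond the length are `0`, which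
only concerns `n < k`. -/
def firstEntries {n : ℕ} (k : ℕ) (m : Fin n → ℝ) : Fin k → ℝ :=
  fun i => if h : (i : ℕ) < n then m ⟨i, h⟩ else 0

/-- The rate function `½ ‖diag(W₁''(y₁), W₂''(y₂), W₁''(y₁), …)^{1/2} Dφ_k^E(y)⁻¹ x‖₂²`, where
`y = (y₁, y₂, y₁, …)`. -/
def SupportInterval.gaussianRate (E : SupportInterval) (V₁ V₂ : ℝ → ℝ) (y₁ y₂ : ℝ) (k : ℕ)
    (x : Fin k → ℝ) : ℝ≥0∞ :=
  ENNReal.ofReal (1 / 2 *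
    ‖WithLp.toLp 2
      ((Matrix.diagonal fun i : Fin k =>
          √(alternating (iteratedDeriv 2 (E.W₁ V₁) y₁) (iteratedDeriv 2 (E.W₂ V₂) y₂) i)).mulVec
        ((E.phiJacobian k fun i => alternating y₁ y₂ i)⁻¹.mulVec x))‖ ^ 2)

end RandomMoments

end

open RandomMoments

open MeasureTheory ProbabilityTheory Filter Topology Set Polynomial
open scoped ENNReal

noncomputable section

namespace RandomMoments

section

/-! ### Jacobi parameters, moments and orthogonal polynomials -/

/-- The linear functional on polynomials with moment sequence `m`. -/
def seqFunctional (m : ℕ → ℝ) : ℝ[X] →ₗ[ℝ] ℝ :=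
  Polynomial.lsum fun n => m n • LinearMap.id

lemma seqFunctional_apply (m : ℕ → ℝ) (p : ℝ[X]) :
    seqFunctional m p = p.sum fun n c => c * m n := by
  simp [seqFunctional, Polynomial.lsum_apply, mul_comm]

@[simp] lemma seqFunctional_monomial (m : ℕ → ℝ) (n : ℕ) (c : ℝ) :
    seqFunctional m (monomial n c) = c * m n := by
  rw [seqFunctional_apply, Polynomial.sum_monomial_index] ; simp

lemma seqFunctional_X_pow (m : ℕ → ℝ) (n : ℕ) : seqFunctional m (X ^ n) = m n := by
  rw [← monomial_one_right_eq_X_pow, seqFunctional_monomial, one_mul]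

lemma seqFunctional_one (m : ℕ → ℝ) : seqFunctional m 1 = m 0 := by
  simpa using seqFunctional_X_pow m 0

lemma seqFunctional_eq_sum_range (m : ℕ → ℝ) (p : ℝ[X]) {N : ℕ} (h : p.natDegree < N) :
    seqFunctional m p = ∑ n ∈ Finset.range N, p.coeff n * m n := by
  rw [seqFunctional_apply, Polynomial.sum_over_range' p _ N h]
  simp

lemma seqFunctional_congr {m m' : ℕ → ℝ} {N : ℕ} (h : ∀ n ≤ N, m n = m' n) {p : ℝ[X]}
    (hp : p.natDegree ≤ N) : seqFunctional m p = seqFunctional m' p := by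
  rw [seqFunctional_eq_sum_range m p (Nat.lt_succ_of_le hp),
    seqFunctional_eq_sum_range m' p (Nat.lt_succ_of_le hp)]
  refine Finset.sum_congr rfl fun n hn => ?_
  rw [h n (by simpa [Nat.lt_succ_iff] using hn)]

/-- Two functionals that agree up to degree `N` differ on a monic polynomial of degree `N + 1`
by the difference of their moments of that order. -/
lemma seqFunctional_sub_of_monic {m m' : ℕ → ℝ} {N : ℕ} (h : ∀ n ≤ N, m n = m' n) {p : ℝ[X]}
    (hp : p.Monic) (hd : p.natDegree = N + 1) :
    seqFunctional m p - seqFunctional m' p = m (N + 1) - m' (N + 1) := by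
  rw [seqFunctional_eq_sum_range m p (N := N + 2) (by omega),
    seqFunctional_eq_sum_range m' p (N := N + 2) (by omega),
    Finset.sum_range_succ _ (N + 1), Finset.sum_range_succ _ (N + 1)]
  have h1 : p.coeff (N + 1) = 1 := by rw [← hd]; exact hp
  have h2 : ∑ n ∈ Finset.range (N + 1), p.coeff n * m n =
      ∑ n ∈ Finset.range (N + 1), p.coeff n * m' n :=
    Finset.sum_congr rfl fun n hn => by rw [h n (by simpa [Nat.lt_succ_iff] using hn)]
  rw [h1, h2]; ring

lemma seqFunctional_integral {μ : Measure ℝ} (hμ : ∀ j : ℕ, Integrable (fun x : ℝ => x ^ j) μ)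
    (p : ℝ[X]) : seqFunctional (fun n => ∫ x, x ^ n ∂μ) p = ∫ x, p.eval x ∂μ := by
  rw [seqFunctional_eq_sum_range _ p (Nat.lt_succ_self _)]
  simp_rw [Polynomial.eval_eq_sum_range]
  rw [integral_finsetSum _ fun i _ => (hμ i).const_mul _]
  simp_rw [integral_const_mul]

/-- The weighted number of Motzkin paths with `n` steps from height `0` to height `i`: up steps
have weight `1`, level steps at height `l` weight `α l`, and down steps from height `l + 1`
weight `β l`. -/
def motzkin (α β : ℕ → ℝ) : ℕ → ℕ → ℝ
  | 0, 0 => 1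
  | 0, _ + 1 => 0
  | n + 1, 0 => α 0 * motzkin α β n 0 + β 0 * motzkin α β n 1
  | n + 1, i + 1 =>
    motzkin α β n i + α (i + 1) * motzkin α β n (i + 1) + β (i + 1) * motzkin α β n (i + 2)

lemma motzkin_of_lt (α β : ℕ → ℝ) : ∀ {n i : ℕ}, n < i → motzkin α β n i = 0
  | 0, i + 1, _ => by simp [motzkin]
  | n + 1, i + 1, h => by
    rw [motzkin, motzkin_of_lt α β (by omega : n < i), motzkin_of_lt α β (by omega : n < i + 1),
      motzkin_of_lt α β (by omega : n < i + 2)]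
    simp

lemma motzkin_self (α β : ℕ → ℝ) : ∀ n : ℕ, motzkin α β n n = 1
  | 0 => by simp [motzkin]
  | n + 1 => by
    rw [motzkin, motzkin_self α β n, motzkin_of_lt α β (by omega : n < n + 1),
      motzkin_of_lt α β (by omega : n < n + 2)]
    simp

/-- The coefficient of a polynomial in front of the `i`-th monic orthogonal polynomial. -/
def jacobiCoeff (α β : ℕ → ℝ) (i : ℕ) : ℝ[X] →ₗ[ℝ] ℝ := seqFunctional fun n => motzkin α β n i

lemma jacobiCoeff_X_mul_zero (α β : ℕ → ℝ) (p : ℝ[X]) :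
    jacobiCoeff α β 0 (X * p) = α 0 * jacobiCoeff α β 0 p + β 0 * jacobiCoeff α β 1 p := by
  induction p using Polynomial.induction_on' with
  | add p q hp hq => rw [mul_add, map_add, hp, hq, map_add, map_add]; ring
  | monomial n c =>
    simp only [jacobiCoeff, X_mul_monomial, seqFunctional_monomial, motzkin]; ring

lemma jacobiCoeff_X_mul_succ (α β : ℕ → ℝ) (i : ℕ) (p : ℝ[X]) :
    jacobiCoeff α β (i + 1) (X * p) = jacobiCoeff α β i p + α (i + 1) * jacobiCoeff α β (i + 1) p +
      β (i + 1) * jacobiCoeff α β (i + 2) p := by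
  induction p using Polynomial.induction_on' with
  | add p q hp hq => rw [mul_add, map_add, hp, hq, map_add, map_add, map_add]; ring
  | monomial n c =>
    simp only [jacobiCoeff, X_mul_monomial, seqFunctional_monomial, motzkin]; ring

lemma jacobiCoeff_of_natDegree_lt (α β : ℕ → ℝ) {i : ℕ} {p : ℝ[X]} (h : p.natDegree < i) :
    jacobiCoeff α β i p = 0 := by
  rw [jacobiCoeff, seqFunctional_eq_sum_range _ p h]
  exact Finset.sum_eq_zero fun n hn => by
    rw [motzkin_of_lt α β (Finset.mem_range.1 hn), mul_zero]

lemma jacobiCoeff_of_monic (α β : ℕ → ℝ) {p : ℝ[X]} (h : p.Monic) :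
    jacobiCoeff α β p.natDegree p = 1 := by
  rw [jacobiCoeff, seqFunctional_eq_sum_range _ p (Nat.lt_succ_self _), Finset.sum_range_succ,
    Finset.sum_eq_zero fun n hn => by rw [motzkin_of_lt α β (Finset.mem_range.1 hn), mul_zero],
    motzkin_self, h.coeff_natDegree]
  simp

/-- The monic orthogonal polynomials with Jacobi parameters `α`, `β`. -/
def jacobiPoly (α β : ℕ → ℝ) : ℕ → ℝ[X]
  | 0 => 1
  | 1 => X - C (α 0)
  | j + 2 => (X - C (α (j + 1))) * jacobiPoly α β (j + 1) - C (β j) * jacobiPoly α β j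

lemma jacobiPoly_monic_natDegree (α β : ℕ → ℝ) :
    ∀ j, (jacobiPoly α β j).Monic ∧ (jacobiPoly α β j).natDegree = j
  | 0 => by simp [jacobiPoly]
  | 1 => ⟨monic_X_sub_C _, natDegree_X_sub_C _⟩
  | j + 2 => by
    obtain ⟨m1, d1⟩ := jacobiPoly_monic_natDegree α β (j + 1)
    obtain ⟨m0, d0⟩ := jacobiPoly_monic_natDegree α β j
    have hm : ((X - C (α (j + 1))) * jacobiPoly α β (j + 1)).Monic := (monic_X_sub_C _).mul m1
    have hn : ((X - C (α (j + 1))) * jacobiPoly α β (j + 1)).natDegree = j + 2 := by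
      rw [(monic_X_sub_C _).natDegree_mul m1, d1, natDegree_X_sub_C]; ring
    have hlt : (C (β j) * jacobiPoly α β j).degree <
        ((X - C (α (j + 1))) * jacobiPoly α β (j + 1)).degree := by
      refine degree_lt_degree ?_
      rw [hn]
      exact lt_of_le_of_lt (natDegree_C_mul_le _ _) (by omega)
    rw [jacobiPoly]
    refine ⟨hm.sub_of_left hlt, ?_⟩
    rw [natDegree_sub_eq_left_of_natDegree_lt, hn]
    rw [hn]
    exact lt_of_le_of_lt (natDegree_C_mul_le _ _) (by omega)

lemma jacobiPoly_monic (α β : ℕ → ℝ) (j : ℕ) : (jacobiPoly α β j).Monic :=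
  (jacobiPoly_monic_natDegree α β j).1

lemma jacobiPoly_natDegree (α β : ℕ → ℝ) (j : ℕ) : (jacobiPoly α β j).natDegree = j :=
  (jacobiPoly_monic_natDegree α β j).2

lemma jacobiPoly_congr {α α' β β' : ℕ → ℝ} {N : ℕ} (hα : ∀ l < N, α l = α' l)
    (hβ : ∀ l, l + 1 < N → β l = β' l) : ∀ j ≤ N, jacobiPoly α β j = jacobiPoly α' β' j
  | 0, _ => rfl
  | 1, h => by rw [jacobiPoly, jacobiPoly, hα 0 (by omega)]
  | j + 2, h => by
    rw [jacobiPoly, jacobiPoly, jacobiPoly_congr hα hβ (j + 1) (by omega),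
      jacobiPoly_congr hα hβ j (by omega), hα (j + 1) (by omega), hβ j (by omega)]

/-- The functional with Jacobi parameters `α`, `β`. -/
abbrev jacobiFunctional (α β : ℕ → ℝ) : ℝ[X] →ₗ[ℝ] ℝ := jacobiCoeff α β 0

/-- Orthogonality and the squared norms in one identity. The induction follows the three-term
recurrence for the polynomial and moves the factor `X` onto `p`, where `jacobiCoeff` obeys the dual
recurrence. No sign of `β` is needed. -/
lemma jacobiFunctional_poly_mul (α β : ℕ → ℝ) : ∀ (i : ℕ) (p : ℝ[X]),
    jacobiFunctional α β (jacobiPoly α β i * p) =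
      (∏ l ∈ Finset.range i, β l) * jacobiCoeff α β i p
  | 0, p => by simp [jacobiPoly]
  | 1, p => by
    rw [jacobiPoly, sub_mul, map_sub, jacobiCoeff_X_mul_zero, ← smul_eq_C_mul, map_smul]
    simp
  | i + 2, p => by
    have h : jacobiPoly α β (i + 2) * p = jacobiPoly α β (i + 1) * (X * p) -
        α (i + 1) • (jacobiPoly α β (i + 1) * p) - β i • (jacobiPoly α β i * p) := by
      rw [jacobiPoly, smul_eq_C_mul, smul_eq_C_mul]; ring
    rw [h, map_sub, map_sub, map_smul, map_smul, jacobiFunctional_poly_mul α β (i + 1),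
      jacobiFunctional_poly_mul α β (i + 1), jacobiFunctional_poly_mul α β i,
      jacobiCoeff_X_mul_succ, Finset.prod_range_succ _ (i + 1), Finset.prod_range_succ _ i]
    simp only [smul_eq_mul]
    ring

lemma jacobiFunctional_poly_mul_of_lt (α β : ℕ → ℝ) {i : ℕ} {p : ℝ[X]} (h : p.natDegree < i) :
    jacobiFunctional α β (jacobiPoly α β i * p) = 0 := by
  rw [jacobiFunctional_poly_mul, jacobiCoeff_of_natDegree_lt α β h, mul_zero]

lemma jacobiFunctional_poly_sq (α β : ℕ → ℝ) (i : ℕ) :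
    jacobiFunctional α β (jacobiPoly α β i ^ 2) = ∏ l ∈ Finset.range i, β l := by
  have h := jacobiCoeff_of_monic α β (jacobiPoly_monic α β i)
  rw [jacobiPoly_natDegree] at h
  rw [sq, jacobiFunctional_poly_mul, h, mul_one]

lemma jacobiCoeff_jacobiPoly (α β : ℕ → ℝ) : ∀ i j : ℕ,
    jacobiCoeff α β j (jacobiPoly α β i) = if j = i then 1 else 0
  | 0, 0 => by simp [jacobiPoly, jacobiCoeff, seqFunctional_one, motzkin]
  | 0, j + 1 => by simp [jacobiPoly, jacobiCoeff, seqFunctional_one, motzkin]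
  | 1, 0 => by
    have h0 := jacobiCoeff_jacobiPoly α β 0 0
    have h1 := jacobiCoeff_jacobiPoly α β 0 1
    have : jacobiPoly α β 1 = X * jacobiPoly α β 0 - α 0 • jacobiPoly α β 0 := by
      simp [jacobiPoly, smul_eq_C_mul]
    rw [this, map_sub, map_smul, jacobiCoeff_X_mul_zero, h0, h1]
    simp
  | 1, j + 1 => by
    have h0 := jacobiCoeff_jacobiPoly α β 0 j
    have h1 := jacobiCoeff_jacobiPoly α β 0 (j + 1)
    have h2 := jacobiCoeff_jacobiPoly α β 0 (j + 2)
    have : jacobiPoly α β 1 = X * jacobiPoly α β 0 - α 0 • jacobiPoly α β 0 := by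
      simp [jacobiPoly, smul_eq_C_mul]
    rw [this, map_sub, map_smul, jacobiCoeff_X_mul_succ, h0, h1, h2]
    simp
  | i + 2, 0 => by
    have : jacobiPoly α β (i + 2) = X * jacobiPoly α β (i + 1) -
        α (i + 1) • jacobiPoly α β (i + 1) - β i • jacobiPoly α β i := by
      rw [jacobiPoly, smul_eq_C_mul, smul_eq_C_mul]; ring
    rw [this, map_sub, map_sub, map_smul, map_smul, jacobiCoeff_X_mul_zero,
      jacobiCoeff_jacobiPoly α β (i + 1) 0, jacobiCoeff_jacobiPoly α β (i + 1) 1,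
      jacobiCoeff_jacobiPoly α β i 0]
    rcases i with _ | i <;> simp
  | i + 2, j + 1 => by
    have : jacobiPoly α β (i + 2) = X * jacobiPoly α β (i + 1) -
        α (i + 1) • jacobiPoly α β (i + 1) - β i • jacobiPoly α β i := by
      rw [jacobiPoly, smul_eq_C_mul, smul_eq_C_mul]; ring
    rw [this, map_sub, map_sub, map_smul, map_smul, jacobiCoeff_X_mul_succ,
      jacobiCoeff_jacobiPoly α β (i + 1) j, jacobiCoeff_jacobiPoly α β (i + 1) (j + 1),
      jacobiCoeff_jacobiPoly α β (i + 1) (j + 2), jacobiCoeff_jacobiPoly α β i (j + 1)]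
    by_cases h1 : j = i + 1
    · subst h1; simp; omega
    · by_cases h2 : j = i
      · subst h2; simp
      · by_cases h3 : j + 1 = i
        · subst h3; simp; omega
        · simp [h1, h2, h3]

lemma jacobiFunctional_X_mul_poly_sq (α β : ℕ → ℝ) (i : ℕ) :
    jacobiFunctional α β (X * jacobiPoly α β i ^ 2) = α i * ∏ l ∈ Finset.range i, β l := by
  rw [show X * jacobiPoly α β i ^ 2 = jacobiPoly α β i * (X * jacobiPoly α β i) by ring,
    jacobiFunctional_poly_mul]
  rcases i with _ | i
  · simp [jacobiCoeff_X_mul_zero, jacobiCoeff_jacobiPoly]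
  · simp [jacobiCoeff_X_mul_succ, jacobiCoeff_jacobiPoly, mul_comm]

/-! ### Interlaced Jacobi parameters -/

/-- The moments of the functional with recurrence coefficients
`α_0 = y 0`, `β_0 = y 1`, `α_1 = y 2`, … -/
def lineMoment (y : ℕ → ℝ) (n : ℕ) : ℝ :=
  motzkin (fun h => y (2 * h)) (fun h => y (2 * h + 1)) n 0

/-- The orthogonal polynomials for interlaced parameters. -/
def linePoly (y : ℕ → ℝ) (j : ℕ) : ℝ[X] :=
  jacobiPoly (fun h => y (2 * h)) (fun h => y (2 * h + 1)) j

/-- The polynomial of degree `N + 1` on which the functional depends on the parameters in the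
simplest way. -/
def linePivot (y : ℕ → ℝ) (N : ℕ) : ℝ[X] :=
  if Even N then X * linePoly y (N / 2) ^ 2 else linePoly y (N / 2 + 1) ^ 2

/-- The derivative of the moment of order `N + 1` in direction of the parameter `N`. -/
def lineSlope (y : ℕ → ℝ) (N : ℕ) : ℝ := ∏ l ∈ Finset.range (N / 2), y (2 * l + 1)

lemma linePivot_monic (y : ℕ → ℝ) (N : ℕ) : (linePivot y N).Monic := by
  unfold linePivot
  split_ifs
  · exact monic_X.mul ((jacobiPoly_monic _ _ _).pow 2)
  · exact (jacobiPoly_monic _ _ _).pow 2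

lemma linePivot_natDegree (y : ℕ → ℝ) (N : ℕ) : (linePivot y N).natDegree = N + 1 := by
  unfold linePivot linePoly
  split_ifs with h
  · rw [monic_X.natDegree_mul ((jacobiPoly_monic _ _ _).pow 2), (jacobiPoly_monic _ _ _).natDegree_pow,
      jacobiPoly_natDegree, natDegree_X]
    have := Nat.two_mul_div_two_of_even h
    omega
  · rw [(jacobiPoly_monic _ _ _).natDegree_pow, jacobiPoly_natDegree]
    have := Nat.two_mul_div_two_add_one_of_odd (Nat.not_even_iff_odd.1 h)
    omega

lemma linePoly_congr {y y' : ℕ → ℝ} {N : ℕ} (h : ∀ l < N, y l = y' l) {j : ℕ}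
    (hj : 2 * j ≤ N + 1) : linePoly y j = linePoly y' j :=
  jacobiPoly_congr (N := j) (fun l hl => h _ (by omega)) (fun l hl => h _ (by omega)) j le_rfl

lemma linePivot_congr {y y' : ℕ → ℝ} {N : ℕ} (h : ∀ l < N, y l = y' l) :
    linePivot y N = linePivot y' N := by
  unfold linePivot
  split_ifs with hN
  · rw [linePoly_congr h (by omega)]
  · rw [linePoly_congr h (by rw [Nat.not_even_iff] at hN; omega)]

lemma lineSlope_congr {y y' : ℕ → ℝ} {N : ℕ} (h : ∀ l < N, y l = y' l) :
    lineSlope y N = lineSlope y' N :=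
  Finset.prod_congr rfl fun l hl => h _ (by have := Finset.mem_range.1 hl; omega)

lemma seqFunctional_lineMoment_pivot (y : ℕ → ℝ) (N : ℕ) :
    seqFunctional (lineMoment y) (linePivot y N) = lineSlope y N * y N := by
  unfold linePivot lineSlope
  split_ifs with h
  · refine (jacobiFunctional_X_mul_poly_sq _ _ _).trans ?_
    rw [Nat.two_mul_div_two_of_even h, mul_comm]
  · refine (jacobiFunctional_poly_sq _ _ _).trans ?_
    rw [Finset.prod_range_succ, Nat.two_mul_div_two_add_one_of_odd (Nat.not_even_iff_odd.1 h)]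

/-- The value on the pivot polynomial of a functional whose first moments are prescribed. -/
lemma seqFunctional_pivot {y m : ℕ → ℝ} {N : ℕ} (h : ∀ n ≤ N, m n = lineMoment y n) :
    seqFunctional m (linePivot y N) = m (N + 1) - lineMoment y (N + 1) + lineSlope y N * y N := by
  have := seqFunctional_sub_of_monic h (linePivot_monic y N) (linePivot_natDegree y N)
  rw [seqFunctional_lineMoment_pivot] at this
  linarith

lemma lineMoment_zero (y : ℕ → ℝ) : lineMoment y 0 = 1 := by simp [lineMoment, motzkin]

/-- The pivot of order `N + 1` involves only parameters below `N`, and its value only parameters up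
to `N`. Being monic, it determines the top moment from the lower ones. -/
lemma lineMoment_congr {y y' : ℕ → ℝ} {N : ℕ} (h : ∀ l < N, y l = y' l) :
    ∀ n ≤ N, lineMoment y n = lineMoment y' n := by
  induction N with
  | zero =>
    intro n hn
    obtain rfl : n = 0 := by omega
    rw [lineMoment_zero, lineMoment_zero]
  | succ N ih =>
    have ih' := ih fun l hl => h l (by omega)
    intro n hn
    rcases Nat.lt_or_ge n (N + 1) with hn' | hn'
    · exact ih' n (by omega)
    · obtain rfl : n = N + 1 := by omega
      have h1 := seqFunctional_pivot (y := y') ih'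
      have h2 := seqFunctional_lineMoment_pivot y N
      have hlt : ∀ l < N, y l = y' l := fun l hl => h l (by omega)
      rw [linePivot_congr hlt, lineSlope_congr hlt, h N (by omega)] at h2
      linarith

lemma lineMoment_step {y y' : ℕ → ℝ} {N : ℕ} (h : ∀ l < N, y l = y' l) :
    lineMoment y (N + 1) - lineMoment y' (N + 1) = lineSlope y N * (y N - y' N) := by
  have h1 := seqFunctional_pivot (y := y') (lineMoment_congr h)
  have h2 := seqFunctional_lineMoment_pivot y N
  rw [linePivot_congr h] at h2
  rw [← lineSlope_congr h] at h1
  linarith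

end

section

lemma seqFunctional_sub_of_natDegree_le {m m' : ℕ → ℝ} {N : ℕ} (h : ∀ n ≤ N, m n = m' n)
    {p : ℝ[X]} (hd : p.natDegree ≤ N + 1) :
    seqFunctional m p - seqFunctional m' p = p.coeff (N + 1) * (m (N + 1) - m' (N + 1)) := by
  rw [seqFunctional_eq_sum_range m p (N := N + 2) (by omega),
    seqFunctional_eq_sum_range m' p (N := N + 2) (by omega),
    Finset.sum_range_succ _ (N + 1), Finset.sum_range_succ _ (N + 1)]
  have h2 : ∑ n ∈ Finset.range (N + 1), p.coeff n * m n =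
      ∑ n ∈ Finset.range (N + 1), p.coeff n * m' n :=
    Finset.sum_congr rfl fun n hn => by rw [h n (by simpa [Nat.lt_succ_iff] using hn)]
  rw [h2]; ring

/-! ### Symmetric functionals: the half line -/

/-- The interlaced parameters of the symmetric functional with `β = z`. -/
def halfParam (z : ℕ → ℝ) (l : ℕ) : ℝ := if Even l then 0 else z (l / 2)

@[simp] lemma halfParam_even (z : ℕ → ℝ) (h : ℕ) : halfParam z (2 * h) = 0 := by simp [halfParam]

@[simp] lemma halfParam_odd (z : ℕ → ℝ) (h : ℕ) : halfParam z (2 * h + 1) = z h := by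
  have : (2 * h + 1) / 2 = h := by omega
  simp [halfParam, this]

lemma halfParam_congr {z z' : ℕ → ℝ} {i : ℕ} (h : ∀ l < i, z l = z' l) :
    ∀ l < 2 * i + 1, halfParam z l = halfParam z' l := by
  intro l hl
  unfold halfParam
  split_ifs with he
  · rfl
  · rw [Nat.not_even_iff] at he
    exact h _ (by omega)

lemma motzkin_zero_of_odd (β : ℕ → ℝ) : ∀ n i : ℕ, Odd (n + i) → motzkin (fun _ => 0) β n i = 0
  | 0, 0, h => by simp at h
  | 0, i + 1, _ => by simp [motzkin]
  | n + 1, 0, h => by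
    rw [motzkin, motzkin_zero_of_odd β n 1 h]; simp
  | n + 1, i + 1, h => by
    rw [motzkin, motzkin_zero_of_odd β n i (by rw [Nat.odd_iff] at h ⊢; omega),
      motzkin_zero_of_odd β n (i + 2) (by rw [Nat.odd_iff] at h ⊢; omega)]
    simp

lemma lineMoment_halfParam (z : ℕ → ℝ) (n : ℕ) :
    lineMoment (halfParam z) n = motzkin (fun _ => 0) z n 0 := by
  simp [lineMoment]

/-- The moment of order `n` on the half line with coordinates `z`. -/
def halfMoment (z : ℕ → ℝ) (n : ℕ) : ℝ := lineMoment (halfParam z) (2 * n)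

lemma halfMoment_congr {z z' : ℕ → ℝ} {i : ℕ} (h : ∀ l < i, z l = z' l) :
    ∀ n ≤ i, halfMoment z n = halfMoment z' n := fun n hn =>
  lineMoment_congr (halfParam_congr h) _ (by omega)

lemma lineSlope_halfParam (z : ℕ → ℝ) (i : ℕ) :
    lineSlope (halfParam z) (2 * i + 1) = ∏ l ∈ Finset.range i, z l := by
  have : (2 * i + 1) / 2 = i := by omega
  simp [lineSlope, this]

lemma halfMoment_step {z z' : ℕ → ℝ} {i : ℕ} (h : ∀ l < i, z l = z' l) :
    halfMoment z (i + 1) - halfMoment z' (i + 1) =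
      (∏ l ∈ Finset.range i, z l) * (z i - z' i) := by
  have := lineMoment_step (halfParam_congr h)
  rwa [lineSlope_halfParam, halfParam_odd, halfParam_odd] at this

/-- The moments of the symmetric square root of a measure on the half line with moments `m`. -/
def symmetrize (m : ℕ → ℝ) (n : ℕ) : ℝ := if Even n then m (n / 2) else 0

lemma symmetrize_two_mul (m : ℕ → ℝ) (n : ℕ) : symmetrize m (2 * n) = m n := by simp [symmetrize]

/-- One order is gained beyond `2 * i`, since odd moments vanish on both sides. This is what the
pivot of degree `2 * i + 2` requires. -/
lemma symmetrize_eq_lineMoment {m z : ℕ → ℝ} {i : ℕ} (h : ∀ n ≤ i, m n = halfMoment z n) :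
    ∀ n ≤ 2 * i + 1, symmetrize m n = lineMoment (halfParam z) n := by
  intro n hn
  unfold symmetrize
  split_ifs with he
  · rw [h _ (by omega), halfMoment, Nat.two_mul_div_two_of_even he]
  · rw [lineMoment_halfParam, motzkin_zero_of_odd]
    simpa using he

/-- The symmetrized functional is integration against the law of `±√x` with a fair random sign, so
it is nonnegative on squares. -/
lemma seqFunctional_symmetrize {μ : Measure ℝ} (hμ : μ ∈ momentMeasures (Ici 0)) (p : ℝ[X]) :
    seqFunctional (symmetrize fun n => ∫ x, x ^ n ∂μ) p =
      ∫ x, (p.eval (√x) + p.eval (-√x)) / 2 ∂μ := by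
  obtain ⟨_, h0, hint⟩ := hμ
  have hae : ∀ᵐ x ∂μ, 0 ≤ x := by
    rw [ae_iff]; simpa [compl_def] using h0
  rw [seqFunctional_eq_sum_range _ p (Nat.lt_succ_self _)]
  have h1 : ∫ x, (p.eval (√x) + p.eval (-√x)) / 2 ∂μ =
      ∫ x, ∑ n ∈ Finset.range (p.natDegree + 1),
        p.coeff n * (if Even n then x ^ (n / 2) else 0) ∂μ := by
    refine integral_congr_ae ?_
    filter_upwards [hae] with x hx
    rw [Polynomial.eval_eq_sum_range, Polynomial.eval_eq_sum_range, ← Finset.sum_add_distrib,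
      Finset.sum_div]
    refine Finset.sum_congr rfl fun n _ => ?_
    split_ifs with he
    · have hpow : √x ^ n = x ^ (n / 2) := by
        conv_lhs => rw [← Nat.two_mul_div_two_of_even he, pow_mul, Real.sq_sqrt hx]
      rw [he.neg_pow, hpow]; ring
    · rw [(Nat.not_even_iff_odd.1 he).neg_pow]; ring
  rw [h1, integral_finsetSum]
  · refine Finset.sum_congr rfl fun n _ => ?_
    rw [integral_const_mul, symmetrize]
    split_ifs <;> simp
  · intro n _
    split_ifs
    · exact (hint _).const_mul _
    · simp

/-- The pivot of odd index `2 * i + 1` is a square, so its integral against the symmetrized measure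
is nonnegative. By `halfMoment_step` the right-hand side is the slope times the coordinate number
`i` of `μ`; the bound says that this coordinate is nonnegative. -/
lemma halfMoment_lower_bound {μ : Measure ℝ} (hμ : μ ∈ momentMeasures (Ici 0)) {z : ℕ → ℝ} {i : ℕ}
    (h : ∀ n ≤ i, ∫ x, x ^ n ∂μ = halfMoment z n) :
    0 ≤ ∫ x, x ^ (i + 1) ∂μ - halfMoment z (i + 1) + (∏ l ∈ Finset.range i, z l) * z i := by
  have h1 := seqFunctional_pivot (symmetrize_eq_lineMoment h)
  rw [seqFunctional_symmetrize hμ, lineSlope_halfParam, halfParam_odd,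
    show 2 * i + 1 + 1 = 2 * (i + 1) by ring, symmetrize_two_mul] at h1
  rw [halfMoment, ← h1]
  refine integral_nonneg fun x => ?_
  have : ¬ Even (2 * i + 1) := by simp
  simp only [linePivot, this, if_false, eval_pow, Pi.zero_apply]
  positivity

/-! ### Canonical moments on the unit interval -/

/-- The parameters `ζ_i = q_{i-1} p_i` of canonical moments `p`. -/
def zetaParam (p : ℕ → ℝ) (i : ℕ) : ℝ := (if i = 0 then 1 else 1 - p (i - 1)) * p i

lemma zetaParam_congr {p p' : ℕ → ℝ} {i : ℕ} (h : ∀ l < i, p l = p' l) :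
    ∀ l < i, zetaParam p l = zetaParam p' l := by
  intro l hl
  unfold zetaParam
  rw [h l hl]
  split_ifs
  · rfl
  · rw [h (l - 1) (by omega)]

/-- Each `q` enters one index later than its `p`; the additional factor completes the last pair. The
left-hand side is the derivative of the next moment in the canonical moment `p i`. -/
lemma prod_zetaParam (p : ℕ → ℝ) (i : ℕ) : (∏ l ∈ Finset.range i, zetaParam p l) *
    (if i = 0 then 1 else 1 - p (i - 1)) = ∏ l ∈ Finset.range i, p l * (1 - p l) := by
  induction i with
  | zero => simp
  | succ i ih =>
    rw [Finset.prod_range_succ, Finset.prod_range_succ, ← ih]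
    simp only [zetaParam, Nat.add_eq_zero_iff, one_ne_zero, and_false, if_false,
      Nat.add_sub_cancel]
    ring

lemma unitMoment_step {p p' : ℕ → ℝ} {i : ℕ} (h : ∀ l < i, p l = p' l) :
    halfMoment (zetaParam p) (i + 1) - halfMoment (zetaParam p') (i + 1) =
      (∏ l ∈ Finset.range i, p l * (1 - p l)) * (p i - p' i) := by
  rw [halfMoment_step (zetaParam_congr h), ← prod_zetaParam]
  have : zetaParam p' i = (if i = 0 then 1 else 1 - p (i - 1)) * p' i := by
    unfold zetaParam
    split_ifs
    · rfl
    · rw [h (i - 1) (by omega)]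
  rw [this, zetaParam]; ring

/-- With `ζ_j = q_{j-1} p_j` the recurrence at `±1` collapses: up to sign the step is `∏ q - q_{j-1}
p_j ∏ q`, which only attaches one more `q`. A canonical moment equal to `1` therefore produces zeros
at both points. -/
lemma jacobiPoly_zetaParam_eval (p : ℕ → ℝ) {ε : ℝ} (hε : ε ^ 2 = 1) : ∀ j : ℕ,
    (jacobiPoly (fun _ => 0) (zetaParam p) (j + 1)).eval ε =
      ε ^ (j + 1) * ∏ l ∈ Finset.range j, (1 - p l)
  | 0 => by simp [jacobiPoly]
  | 1 => by simp [jacobiPoly, zetaParam, ← sq, hε]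
  | j + 2 => by
    rw [jacobiPoly, eval_sub, eval_mul, eval_mul, jacobiPoly_zetaParam_eval p hε (j + 1),
      jacobiPoly_zetaParam_eval p hε j, Finset.prod_range_succ _ (j + 1),
      Finset.prod_range_succ _ j]
    simp only [eval_sub, eval_X, eval_C, zetaParam, Nat.add_eq_zero_iff, one_ne_zero, and_false,
      if_false, Nat.add_sub_cancel, sub_zero]
    have h3 : ε ^ (j + 2 + 1) = ε ^ (j + 1) := by
      rw [show j + 2 + 1 = (j + 1) + 2 by ring, pow_add, hε, mul_one]
    have h4 : ε * ε ^ (j + 1 + 1) = ε ^ (j + 1) := by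
      rw [← h3]; ring
    rw [← mul_assoc, h4, h3]; ring

lemma exists_endpoint_factor {p : ℕ → ℝ} {i : ℕ} (h : p i = 1) :
    ∃ R : ℝ[X], R.Monic ∧ R.natDegree = i ∧
      jacobiPoly (fun _ => 0) (zetaParam p) (i + 2) = (X ^ 2 - 1) * R := by
  set P := jacobiPoly (fun _ => 0) (zetaParam p) (i + 2) with hP
  have hz : ∀ ε : ℝ, ε ^ 2 = 1 → P.IsRoot ε := fun ε hε => by
    rw [IsRoot, hP, jacobiPoly_zetaParam_eval p hε, Finset.prod_range_succ, h]; simp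
  have h1 := dvd_iff_isRoot.2 (hz 1 (by norm_num))
  have h2 := dvd_iff_isRoot.2 (hz (-1) (by norm_num))
  have hc : IsCoprime (X - C (1 : ℝ)) (X - C (-1)) :=
    isCoprime_X_sub_C_of_isUnit_sub (by norm_num)
  obtain ⟨R, hR⟩ := hc.mul_dvd h1 h2
  have hX : (X - C (1 : ℝ)) * (X - C (-1)) = X ^ 2 - 1 := by
    simp only [map_neg, map_one]; ring
  have hXm : (X ^ 2 - 1 : ℝ[X]).Monic := by
    rw [← hX]; exact (monic_X_sub_C _).mul (monic_X_sub_C _)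
  have hXd : (X ^ 2 - 1 : ℝ[X]).natDegree = 2 := by
    rw [← hX, (monic_X_sub_C _).natDegree_mul (monic_X_sub_C _), natDegree_X_sub_C,
      natDegree_X_sub_C]
  rw [hX] at hR
  have hPm : P.Monic := jacobiPoly_monic _ _ _
  have hRm : R.Monic := hXm.of_mul_monic_left (hR ▸ hPm)
  refine ⟨R, hRm, ?_, hR⟩
  have hd : P.natDegree = i + 2 := jacobiPoly_natDegree _ _ _
  rw [hR, hXm.natDegree_mul hRm, hXd] at hd
  omega

/-- The test polynomial is `(X² - 1) R²`, monic of degree `2 * i + 2`. The functional with `p i = 1`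
kills it, because `(X² - 1) R` is the orthogonal polynomial of degree `i + 2` and `R` has degree
`i`. Against the symmetrization of a measure on `[0, 1]` it integrates to something nonpositive.
Only the top moments differ, so their difference has this sign. -/
lemma unitMoment_upper_bound {μ : Measure ℝ} (hμ : μ ∈ momentMeasures (Icc 0 1)) {p : ℕ → ℝ}
    {i : ℕ} (hi : p i = 1) (h : ∀ n ≤ i, ∫ x, x ^ n ∂μ = halfMoment (zetaParam p) n) :
    ∫ x, x ^ (i + 1) ∂μ ≤ halfMoment (zetaParam p) (i + 1) := by
  have hμ' : μ ∈ momentMeasures (Ici 0) :=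
    ⟨hμ.1, measure_mono_null (compl_subset_compl.2 Icc_subset_Ici_self) hμ.2.1, hμ.2.2⟩
  have hae : ∀ᵐ x ∂μ, x ∈ Icc (0 : ℝ) 1 := by
    rw [ae_iff]; exact hμ.2.1
  obtain ⟨R, hRm, hRd, hR⟩ := exists_endpoint_factor hi
  have hXm : (X ^ 2 - 1 : ℝ[X]).Monic := by
    simpa using monic_X_pow_sub_C (1 : ℝ) (two_ne_zero)
  have hXd : (X ^ 2 - 1 : ℝ[X]).natDegree = 2 := by
    simpa using natDegree_X_pow_sub_C (n := 2) (r := (1 : ℝ))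
  have hQd : ((X ^ 2 - 1) * R ^ 2 : ℝ[X]).natDegree = 2 * i + 1 + 1 := by
    rw [hXm.natDegree_mul (hRm.pow 2), hRm.natDegree_pow, hRd, hXd]; ring
  have h1 := seqFunctional_sub_of_monic (symmetrize_eq_lineMoment h) (hXm.mul (hRm.pow 2)) hQd
  have h2 : seqFunctional (lineMoment (halfParam (zetaParam p))) ((X ^ 2 - 1) * R ^ 2) = 0 := by
    have := jacobiFunctional_poly_mul_of_lt (fun _ => 0) (zetaParam p) (i := i + 2) (p := R)
      (by omega)
    rw [hR] at this
    rw [show (X ^ 2 - 1) * R ^ 2 = (X ^ 2 - 1) * R * R by ring, ← this]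
    simp only [jacobiFunctional, jacobiCoeff]
    congr 2
    ext n
    exact lineMoment_halfParam _ n
  rw [h2, seqFunctional_symmetrize hμ', sub_zero, show 2 * i + 1 + 1 = 2 * (i + 1) by ring,
    symmetrize_two_mul] at h1
  have h3 : ∫ x, (((X ^ 2 - 1) * R ^ 2 : ℝ[X]).eval (√x) +
      ((X ^ 2 - 1) * R ^ 2 : ℝ[X]).eval (-√x)) / 2 ∂μ ≤ 0 := by
    refine integral_nonpos_of_ae ?_
    filter_upwards [hae] with x hx
    simp only [eval_mul, eval_sub, eval_pow, eval_X, eval_one, neg_sq, Real.sq_sqrt hx.1,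
      Pi.zero_apply]
    nlinarith [mul_nonneg (sub_nonneg.2 hx.2) (sq_nonneg (R.eval √x)),
      mul_nonneg (sub_nonneg.2 hx.2) (sq_nonneg (R.eval (-√x)))]
  rw [halfMoment]
  linarith

/-! ### Spectral measures of Jacobi matrices -/

/-- The symmetric tridiagonal matrix with diagonal `α` and squared off-diagonal `β`. -/
def jacobiMatrix (α β : ℕ → ℝ) (N : ℕ) : Matrix (Fin (N + 1)) (Fin (N + 1)) ℝ :=
  Matrix.of fun i j => (if (i : ℕ) = j then α i else 0) +
    (if (i : ℕ) + 1 = j then √(β i) else 0) + if (j : ℕ) + 1 = i then √(β j) else 0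

lemma jacobiMatrix_isHermitian (α β : ℕ → ℝ) (N : ℕ) : (jacobiMatrix α β N).IsHermitian := by
  ext i j
  simp only [jacobiMatrix, Matrix.conjTranspose_apply, Matrix.of_apply, star_trivial]
  by_cases h : (i : ℕ) = j
  · simp [h]
  · simp only [h, Ne.symm h, if_false]; ring

lemma jacobiMatrix_mulVec (α β : ℕ → ℝ) (N : ℕ) (f : ℕ → ℝ) (i : Fin (N + 1)) :
    (jacobiMatrix α β N).mulVec (fun j => f j) i = α i * f i +
      (if (i : ℕ) < N then √(β i) * f (i + 1) else 0) +
      if (i : ℕ) = 0 then 0 else √(β (i - 1)) * f (i - 1) := by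
  simp only [jacobiMatrix, Matrix.mulVec, dotProduct, Matrix.of_apply]
  rw [Fin.sum_univ_eq_sum_range (fun j => ((if (i : ℕ) = j then α i else 0) +
    (if (i : ℕ) + 1 = j then √(β i) else 0) + if j + 1 = (i : ℕ) then √(β j) else 0) * f j)]
  simp only [add_mul, Finset.sum_add_distrib, ite_mul, zero_mul, Finset.sum_ite_eq,
    Finset.mem_range, i.2, if_true, Nat.add_lt_add_iff_right]
  congr 1
  rcases h : (i : ℕ) with _ | l
  · simp
  · have : l < N + 1 := by have := i.2; omega
    simp [this]

/-- Conjugating by the norms `√(∏ β)` turns the Motzkin transition weights into a symmetric matrix.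
The bound `n ≤ N` keeps the paths away from the truncation. -/
lemma jacobiMatrix_pow_mulVec {α β : ℕ → ℝ} (hβ : ∀ i, 0 ≤ β i) (N : ℕ) : ∀ n ≤ N,
    ((jacobiMatrix α β N) ^ n).mulVec (Pi.single 0 1) =
      fun i : Fin (N + 1) => motzkin α β n i * √(∏ l ∈ Finset.range i, β l)
  | 0, _ => by
    ext i
    rw [pow_zero, Matrix.one_mulVec]
    refine Fin.cases ?_ (fun j => ?_) i
    · simp [motzkin]
    · simp [motzkin]
  | n + 1, h => by
    have hs : ∀ l, √(∏ l ∈ Finset.range (l + 1), β l) =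
        √(∏ l ∈ Finset.range l, β l) * √(β l) := fun l => by
      rw [Finset.prod_range_succ, Real.sqrt_mul (Finset.prod_nonneg fun i _ => hβ i)]
    rw [pow_succ', ← Matrix.mulVec_mulVec, jacobiMatrix_pow_mulVec hβ N n (by omega)]
    ext i
    rw [jacobiMatrix_mulVec α β N
      (fun i => motzkin α β n i * √(∏ l ∈ Finset.range i, β l)) i]
    -- At the last index the matrix has no entry for height `N + 1`, but a path of `n ≤ N` steps
    -- cannot be there.
    have hup : (if (i : ℕ) < N then
        √(β i) * (motzkin α β n (i + 1) * √(∏ l ∈ Finset.range ((i : ℕ) + 1), β l)) else 0) =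
        β i * motzkin α β n (i + 1) * √(∏ l ∈ Finset.range (i : ℕ), β l) := by
      split_ifs with hi
      · rw [hs]
        linear_combination (motzkin α β n (i + 1) * √(∏ l ∈ Finset.range (i : ℕ), β l)) *
          Real.mul_self_sqrt (hβ i)
      · rw [motzkin_of_lt α β (by omega)]; simp
    rw [hup]
    rcases hi : (i : ℕ) with _ | l
    · simp [motzkin]
    · simp only [motzkin, Nat.add_eq_zero_iff, one_ne_zero, and_false, if_false,
        Nat.add_sub_cancel]
      rw [hs l]; ring

/-- Moments of nonnegative Jacobi parameters are moments of a finitely supported measure on the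
eigenvalues of a Jacobi matrix. -/
lemma exists_spectral_weights {α β : ℕ → ℝ} (hβ : ∀ i, 0 ≤ β i) (N : ℕ) :
    ∃ w : Fin (N + 1) → ℝ, (∀ i, 0 ≤ w i) ∧ ∀ n ≤ N,
      ∑ i, w i * (jacobiMatrix_isHermitian α β N).eigenvalues i ^ n = motzkin α β n 0 := by
  set hA := jacobiMatrix_isHermitian α β N
  set U : Matrix (Fin (N + 1)) (Fin (N + 1)) ℝ := hA.eigenvectorUnitary.1
  -- The spectral measure of the first basis vector: its moments are the entries `(A ^ n) 0 0`.
  refine ⟨fun i => U 0 i ^ 2, fun i => sq_nonneg _, fun n hn => ?_⟩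
  have h1 : (jacobiMatrix α β N) ^ n = U * Matrix.diagonal (fun i => hA.eigenvalues i ^ n) *
      star U := by
    conv_lhs => rw [hA.spectral_theorem]
    rw [← map_pow, Matrix.diagonal_pow, Unitary.conjStarAlgAut_apply]
    rfl
  have h2 := congrFun (jacobiMatrix_pow_mulVec (α := α) hβ N n hn) 0
  rw [Matrix.mulVec_single_one, h1] at h2
  rw [Matrix.col_apply, Matrix.mul_apply] at h2
  simp only [Matrix.mul_diagonal, Matrix.star_apply, star_trivial, Fin.val_zero, Finset.range_zero, Finset.prod_empty, Real.sqrt_one,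
    mul_one] at h2
  rw [← h2]
  exact Finset.sum_congr rfl fun i _ => by ring

/-- Finitely supported probability measures. -/
lemma exists_momentMeasure_of_weights {ι : Type*} [Fintype ι] {S : Set ℝ} {w x : ι → ℝ}
    (hw : ∀ i, 0 ≤ w i) (h1 : ∑ i, w i = 1) (hx : ∀ i, x i ∈ S) :
    ∃ μ ∈ momentMeasures S, ∀ n : ℕ, ∫ t, t ^ n ∂μ = ∑ i, w i * x i ^ n := by
  classical
  set μ : Measure ℝ := ∑ i, ENNReal.ofReal (w i) • Measure.dirac (x i) with hμ
  have hint : ∀ n : ℕ, ∀ i, Integrable (fun t : ℝ => t ^ n)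
      (ENNReal.ofReal (w i) • Measure.dirac (x i)) := fun n i =>
    (integrable_dirac (by simp)).smul_measure ENNReal.ofReal_ne_top
  have hint' : ∀ n : ℕ, Integrable (fun t : ℝ => t ^ n) μ := fun n =>
    integrable_finsetSum_measure.2 fun i _ => hint n i
  refine ⟨μ, ⟨⟨?_⟩, ?_, hint'⟩, fun n => ?_⟩
  · rw [hμ, Measure.finsetSum_apply]
    simp only [Measure.smul_apply, measure_univ, smul_eq_mul, mul_one]
    rw [← ENNReal.ofReal_sum_of_nonneg fun i _ => hw i, h1, ENNReal.ofReal_one]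
  · rw [hμ, Measure.finsetSum_apply]
    refine Finset.sum_eq_zero fun i _ => ?_
    simp [hx i]
  · rw [hμ, integral_finsetSum_measure fun i _ => hint n i]
    refine Finset.sum_congr rfl fun i _ => ?_
    rw [integral_smul_measure, integral_dirac, ENNReal.toReal_ofReal (hw i), smul_eq_mul]

/-- For a chain sequence `β_i = Q_i (1 - Q_{i+1})`, the inequality `2 |xy| ≤ x² + y²` splits each
off-diagonal term into `Q_i f_i² + (1 - Q_{i+1}) f_{i+1}²`. The two shares falling on the same
`f_i²` add up to `f_i²`. -/
lemma jacobiMatrix_form_bound {Q f : ℕ → ℝ} {β : ℕ → ℝ} (hQ : ∀ i, 0 ≤ Q i) (hQ' : ∀ i, Q i ≤ 1)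
    (hβ : ∀ i, β i = Q i * (1 - Q (i + 1))) (N : ℕ) :
    |2 * ∑ i ∈ Finset.range N, √(β i) * f i * f (i + 1)| ≤
      (∑ i ∈ Finset.range N, f i ^ 2) + (1 - Q N) * f N ^ 2 := by
  induction N with
  | zero => simpa using mul_nonneg (sub_nonneg.2 (hQ' 0)) (sq_nonneg _)
  | succ N ih =>
    rw [Finset.sum_range_succ, Finset.sum_range_succ, mul_add]
    have h1 : |2 * (√(β N) * f N * f (N + 1))| ≤
        Q N * f N ^ 2 + (1 - Q (N + 1)) * f (N + 1) ^ 2 := by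
      have e1 := Real.sq_sqrt (hQ N)
      have e2 := Real.sq_sqrt (sub_nonneg.2 (hQ' (N + 1)))
      rw [hβ, Real.sqrt_mul (hQ N), abs_le]
      constructor
      · nlinarith [sq_nonneg (√(Q N) * f N + √(1 - Q (N + 1)) * f (N + 1))]
      · nlinarith [sq_nonneg (√(Q N) * f N - √(1 - Q (N + 1)) * f (N + 1))]
    refine (abs_add_le _ _).trans ?_
    linarith

/-- An eigenvalue is the quadratic form at its unit eigenvector, and the chain sequence bounds this
form by the squared norm. -/
lemma abs_eigenvalues_le_one {Q β : ℕ → ℝ} (hQ : ∀ i, 0 ≤ Q i) (hQ' : ∀ i, Q i ≤ 1)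
    (hβ : ∀ i, β i = Q i * (1 - Q (i + 1))) (N : ℕ) (i : Fin (N + 1)) :
    |(jacobiMatrix_isHermitian (fun _ => 0) β N).eigenvalues i| ≤ 1 := by
  set hA := jacobiMatrix_isHermitian (fun _ => 0) β N
  set v : Fin (N + 1) → ℝ := (hA.eigenvectorBasis i).ofLp with hv
  have h1 : (jacobiMatrix (fun _ => 0) β N).mulVec v = hA.eigenvalues i • v :=
    hA.mulVec_eigenvectorBasis i
  have hn : ∑ j, v j ^ 2 = 1 := by
    have := hA.eigenvectorBasis.orthonormal.1 i
    rw [EuclideanSpace.norm_eq, Real.sqrt_eq_one] at this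
    simpa using this
  set f : ℕ → ℝ := fun l => if h : l < N + 1 then v ⟨l, h⟩ else 0 with hf
  have hfv : ∀ j : Fin (N + 1), f j = v j := fun j => by simp only [hf, j.2, dif_pos]
  have hfv' : (fun j : Fin (N + 1) => f j) = v := funext hfv
  have hnf : ∑ l ∈ Finset.range (N + 1), f l ^ 2 = 1 := by
    rw [← hn, ← Fin.sum_univ_eq_sum_range (fun l => f l ^ 2)]
    simp [hfv]
  have h2 : hA.eigenvalues i = 2 * ∑ l ∈ Finset.range N, √(β l) * f l * f (l + 1) := by
    have h3 : ∑ j, v j * (jacobiMatrix (fun _ => 0) β N).mulVec v j = hA.eigenvalues i := by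
      rw [h1]
      simp only [Pi.smul_apply, smul_eq_mul]
      calc ∑ j, v j * (hA.eigenvalues i * v j) = hA.eigenvalues i * ∑ j, v j ^ 2 := by
            rw [Finset.mul_sum]
            exact Finset.sum_congr rfl fun j _ => by ring
        _ = hA.eigenvalues i := by rw [hn, mul_one]
    rw [← h3, ← hfv']
    simp_rw [jacobiMatrix_mulVec]
    rw [Fin.sum_univ_eq_sum_range (fun l => f l * (0 * f l +
      (if l < N then √(β l) * f (l + 1) else 0) + if l = 0 then 0 else √(β (l - 1)) * f (l - 1)))]
    simp only [zero_mul, zero_add, mul_add, Finset.sum_add_distrib]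
    rw [Finset.sum_range_succ, Finset.sum_range_succ' (fun l => f l * if l = 0 then 0 else
      √(β (l - 1)) * f (l - 1)), two_mul]
    simp only [lt_irrefl, if_false, mul_zero, add_zero, if_true, Nat.add_eq_zero_iff, one_ne_zero,
      and_false, Nat.add_sub_cancel]
    congr 1
    · exact Finset.sum_congr rfl fun l hl => by rw [if_pos (Finset.mem_range.1 hl)]; ring
    · exact Finset.sum_congr rfl fun l hl => by ring
  rw [h2]
  refine (jacobiMatrix_form_bound hQ hQ' hβ N).trans ?_
  rw [Finset.sum_range_succ] at hnf
  nlinarith [mul_nonneg (hQ N) (sq_nonneg (f N))]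

lemma exists_momentMeasure_line {y : ℕ → ℝ} (hy : ∀ h, 0 ≤ y (2 * h + 1)) (N : ℕ) :
    ∃ μ ∈ momentMeasures univ, ∀ n ≤ N, ∫ x, x ^ n ∂μ = lineMoment y n := by
  obtain ⟨w, hw, hm⟩ := exists_spectral_weights (α := fun h => y (2 * h)) hy N
  have h1 : ∑ i, w i = 1 := by simpa [motzkin] using hm 0 (Nat.zero_le _)
  obtain ⟨μ, hμ, h⟩ := exists_momentMeasure_of_weights hw h1 (fun i => mem_univ _)
  exact ⟨μ, hμ, fun n hn => (h n).trans (hm n hn)⟩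

/-- Squaring the eigenvalues of the symmetric Jacobi matrix pushes its spectral measure to the half
line. Order `2 * N` is needed because the moment of order `n` is a symmetric moment of order `2 *
n`. -/
lemma exists_momentMeasure_halfLine {z : ℕ → ℝ} (hz : ∀ h, 0 ≤ z h) (N : ℕ) :
    ∃ μ ∈ momentMeasures (Ici 0), ∀ n ≤ N, ∫ x, x ^ n ∂μ = halfMoment z n := by
  obtain ⟨w, hw, hm⟩ := exists_spectral_weights (α := fun _ => 0) hz (2 * N)
  have h1 : ∑ i, w i = 1 := by simpa [motzkin] using hm 0 (Nat.zero_le _)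
  obtain ⟨μ, hμ, h⟩ := exists_momentMeasure_of_weights (S := Ici 0) hw h1
    (x := fun i => (jacobiMatrix_isHermitian (fun _ => 0) z (2 * N)).eigenvalues i ^ 2)
    (fun i => mem_Ici.2 (sq_nonneg _))
  refine ⟨μ, hμ, fun n hn => ?_⟩
  rw [h, halfMoment, lineMoment_halfParam, ← hm (2 * n) (by omega)]
  exact Finset.sum_congr rfl fun i _ => by rw [← pow_mul]

lemma exists_momentMeasure_unit {p : ℕ → ℝ} (hp : ∀ h, p h ∈ Icc (0 : ℝ) 1) (N : ℕ) :
    ∃ μ ∈ momentMeasures (Icc 0 1), ∀ n ≤ N, ∫ x, x ^ n ∂μ = halfMoment (zetaParam p) n := by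
  -- The value `Q 0 = 1` accounts for `ζ_0 = p_0` without a factor `q`. The chain sequence confines
  -- the eigenvalues to `[-1, 1]` and their squares to `[0, 1]`.
  set Q : ℕ → ℝ := fun i => if i = 0 then 1 else 1 - p (i - 1) with hQ
  have hQ0 : ∀ i, 0 ≤ Q i := fun i => by
    simp only [hQ]; split_ifs
    · exact zero_le_one
    · linarith [(hp (i - 1)).2]
  have hQ1 : ∀ i, Q i ≤ 1 := fun i => by
    simp only [hQ]; split_ifs
    · exact le_rfl
    · linarith [(hp (i - 1)).1]
  have hβ : ∀ i, zetaParam p i = Q i * (1 - Q (i + 1)) := fun i => by simp [hQ, zetaParam]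
  have hz : ∀ i, 0 ≤ zetaParam p i := fun i => mul_nonneg (hQ0 i) (hp i).1
  obtain ⟨w, hw, hm⟩ := exists_spectral_weights (α := fun _ => 0) hz (2 * N)
  have h1 : ∑ i, w i = 1 := by simpa [motzkin] using hm 0 (Nat.zero_le _)
  obtain ⟨μ, hμ, h⟩ := exists_momentMeasure_of_weights (S := Icc 0 1) hw h1
    (x := fun i => (jacobiMatrix_isHermitian (fun _ => 0) (zetaParam p) (2 * N)).eigenvalues i ^ 2)
    (fun i => ⟨sq_nonneg _, (sq_le_one_iff_abs_le_one _).2 (abs_eigenvalues_le_one hQ0 hQ1 hβ _ i)⟩)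
  refine ⟨μ, hμ, fun n hn => ?_⟩
  rw [h, halfMoment, lineMoment_halfParam, ← hm (2 * n) (by omega)]
  exact Finset.sum_congr rfl fun i _ => by rw [← pow_mul]

end

section

/-! ### The moments as functions of the coordinates -/

/-- The range of the coordinate number `i`. -/
def SupportInterval.range (E : SupportInterval) (i : ℕ) : Set ℝ :=
  alternating E.oddRange E.evenRange i

/-- The affine map from the unit interval onto `[a, b]`, as a polynomial. -/
def affinePoly (a b : ℝ) : ℝ[X] := C a + C (b - a) * X

/-- The moment of order `n` with coordinates `y`. -/
def SupportInterval.mom (E : SupportInterval) (y : ℕ → ℝ) (n : ℕ) : ℝ :=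
  match E with
  | .compact a b => seqFunctional (halfMoment (zetaParam y)) (affinePoly a b ^ n)
  | .halfLine => halfMoment y n
  | .line => lineMoment y n

/-- The length scale of the interval. -/
def SupportInterval.scale (E : SupportInterval) : ℝ :=
  match E with
  | .compact a b => b - a
  | .halfLine => 1
  | .line => 1

/-- The factor that the coordinate number `i` contributes to the derivatives of the moments of
higher order. -/
def SupportInterval.factor (E : SupportInterval) (i : ℕ) (t : ℝ) : ℝ :=
  match E with
  | .compact _ _ => t * (1 - t)
  | .halfLine => t
  | .line => if Even i then 1 else t

/-- The derivative of the moment of order `i + 1` in direction of the coordinate number `i`. -/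
def SupportInterval.slope (E : SupportInterval) (y : ℕ → ℝ) (i : ℕ) : ℝ :=
  E.scale ^ (i + 1) * ∏ l ∈ Finset.range i, E.factor l (y l)

/-- The interval is not degenerate. -/
def SupportInterval.Proper (E : SupportInterval) : Prop := ∀ a b : ℝ, E = .compact a b → a < b

variable {E : SupportInterval}

lemma SupportInterval.Proper.scale_pos (hE : E.Proper) : 0 < E.scale := by
  cases E with
  | compact a b => exact sub_pos.2 (hE a b rfl)
  | halfLine => exact one_pos
  | line => exact one_pos

lemma SupportInterval.isOpen_range (E : SupportInterval) (i : ℕ) : IsOpen (E.range i) := by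
  unfold SupportInterval.range alternating
  cases E <;> split_ifs <;>
    simp [SupportInterval.oddRange, SupportInterval.evenRange, isOpen_Ioo, isOpen_Ioi]

lemma SupportInterval.half_mem_range (E : SupportInterval) (i : ℕ) : (1 / 2 : ℝ) ∈ E.range i := by
  unfold SupportInterval.range alternating
  cases E <;> split_ifs <;>
    simp [SupportInterval.oddRange, SupportInterval.evenRange] <;> norm_num

/-- The closed range is an interval, so room on both sides excludes its endpoints. Interior points
of the moment space get coordinates in the open range this way. -/
lemma SupportInterval.mem_range_of_perturb (E : SupportInterval) {i : ℕ} {t δ : ℝ} (hδ : 0 < δ)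
    (h1 : t - δ ∈ closure (E.range i)) (h2 : t + δ ∈ closure (E.range i)) : t ∈ E.range i := by
  revert h1 h2
  unfold SupportInterval.range alternating
  cases E <;> split_ifs <;>
    simp [SupportInterval.oddRange, SupportInterval.evenRange,
      closure_Ioo (zero_ne_one' ℝ), closure_Ioi] <;> intros <;>
    first | (constructor <;> linarith) | linarith

lemma SupportInterval.factor_pos (E : SupportInterval) {i : ℕ} {t : ℝ} (ht : t ∈ E.range i) :
    0 < E.factor i t := by
  revert ht
  unfold SupportInterval.range alternating SupportInterval.factor
  cases E with
  | compact a b =>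
    have key : t ∈ Ioo (0 : ℝ) 1 → 0 < t * (1 - t) := fun h => mul_pos h.1 (sub_pos.2 h.2)
    split_ifs <;> exact key
  | halfLine => split_ifs <;> exact id
  | line =>
    split_ifs
    · exact fun _ => one_pos
    · exact id

lemma SupportInterval.Proper.slope_pos (hE : E.Proper) {y : ℕ → ℝ} {i : ℕ}
    (hy : ∀ l < i, y l ∈ E.range l) : 0 < E.slope y i :=
  mul_pos (pow_pos hE.scale_pos _)
    (Finset.prod_pos fun l hl => E.factor_pos (hy l (Finset.mem_range.1 hl)))

lemma SupportInterval.slope_congr (E : SupportInterval) {y y' : ℕ → ℝ} {i : ℕ}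
    (h : ∀ l < i, y l = y' l) : E.slope y i = E.slope y' i := by
  unfold SupportInterval.slope
  rw [Finset.prod_congr rfl fun l hl => by rw [h l (Finset.mem_range.1 hl)]]

lemma halfMoment_zero (z : ℕ → ℝ) : halfMoment z 0 = 1 := lineMoment_zero _

lemma SupportInterval.mom_zero (E : SupportInterval) (y : ℕ → ℝ) : E.mom y 0 = 1 := by
  cases E with
  | compact a b =>
    simp only [SupportInterval.mom, pow_zero, seqFunctional_one, halfMoment_zero]
  | halfLine => exact halfMoment_zero _
  | line => exact lineMoment_zero _

lemma natDegree_affinePoly_le (a b : ℝ) : (affinePoly a b).natDegree ≤ 1 := by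
  unfold affinePoly; compute_degree

lemma natDegree_affinePoly_pow_le (a b : ℝ) (n : ℕ) : (affinePoly a b ^ n).natDegree ≤ n := by
  simpa using natDegree_pow_le_of_le n (natDegree_affinePoly_le a b)

lemma coeff_affinePoly_pow (a b : ℝ) (n : ℕ) : (affinePoly a b ^ n).coeff n = (b - a) ^ n := by
  have := coeff_pow_of_natDegree_le (m := n) (natDegree_affinePoly_le a b)
  rw [mul_one] at this
  rw [this]; simp [affinePoly]

lemma lineSlope_eq_prod (y : ℕ → ℝ) (N : ℕ) :
    lineSlope y N = ∏ l ∈ Finset.range N, if Even l then 1 else y l := by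
  induction N with
  | zero => simp [lineSlope]
  | succ N ih =>
    rw [Finset.prod_range_succ, ← ih]
    unfold lineSlope
    split_ifs with h
    · rw [show (N + 1) / 2 = N / 2 by have := Nat.two_mul_div_two_of_even h; omega, mul_one]
    · have := Nat.two_mul_div_two_add_one_of_odd (Nat.not_even_iff_odd.1 h)
      rw [show (N + 1) / 2 = N / 2 + 1 by omega, Finset.prod_range_succ, this]

/-- The moment of order `i + 1` is affine in the coordinate number `i`. -/
lemma SupportInterval.mom_step (E : SupportInterval) {y y' : ℕ → ℝ} {i : ℕ}
    (h : ∀ l < i, y l = y' l) :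
    E.mom y (i + 1) - E.mom y' (i + 1) = E.slope y i * (y i - y' i) := by
  cases E with
  | compact a b =>
    simp only [SupportInterval.mom, SupportInterval.slope, SupportInterval.scale,
      SupportInterval.factor]
    rw [seqFunctional_sub_of_natDegree_le (halfMoment_congr (zetaParam_congr h))
      (natDegree_affinePoly_pow_le a b _), coeff_affinePoly_pow, unitMoment_step h, mul_assoc]
  | halfLine =>
    simpa [SupportInterval.mom, SupportInterval.slope, SupportInterval.scale,
      SupportInterval.factor] using halfMoment_step h
  | line =>
    simp only [SupportInterval.mom, SupportInterval.slope, SupportInterval.scale,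
      SupportInterval.factor]
    rw [lineMoment_step h, lineSlope_eq_prod, one_pow, one_mul]

lemma SupportInterval.mom_congr (E : SupportInterval) {y y' : ℕ → ℝ} {i : ℕ}
    (h : ∀ l < i, y l = y' l) : ∀ n ≤ i, E.mom y n = E.mom y' n := by
  intro n hn
  rcases n with _ | n
  · rw [E.mom_zero, E.mom_zero]
  · have := E.mom_step (i := n) (fun l hl => h l (by omega))
    rw [h n (by omega), sub_self, mul_zero] at this
    linarith

lemma contDiff_motzkin {F : Type*} [NormedAddCommGroup F] [NormedSpace ℝ F] {α β : F → ℕ → ℝ}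
    (hα : ∀ i, ContDiff ℝ 2 fun x => α x i) (hβ : ∀ i, ContDiff ℝ 2 fun x => β x i) :
    ∀ n i, ContDiff ℝ 2 fun x => motzkin (α x) (β x) n i
  | 0, 0 => by simpa [motzkin] using contDiff_const
  | 0, i + 1 => by simpa [motzkin] using contDiff_const
  | n + 1, 0 => by
    simp only [motzkin]
    exact ((hα 0).mul (contDiff_motzkin hα hβ n 0)).add ((hβ 0).mul (contDiff_motzkin hα hβ n 1))
  | n + 1, i + 1 => by
    simp only [motzkin]
    exact ((contDiff_motzkin hα hβ n i).add ((hα _).mul (contDiff_motzkin hα hβ n _))).add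
      ((hβ _).mul (contDiff_motzkin hα hβ n _))

lemma contDiff_lineMoment {F : Type*} [NormedAddCommGroup F] [NormedSpace ℝ F] {y : F → ℕ → ℝ}
    (hy : ∀ i, ContDiff ℝ 2 fun x => y x i) (n : ℕ) : ContDiff ℝ 2 fun x => lineMoment (y x) n :=
  contDiff_motzkin (fun i => hy (2 * i)) (fun i => hy (2 * i + 1)) n 0

lemma contDiff_halfMoment {F : Type*} [NormedAddCommGroup F] [NormedSpace ℝ F] {y : F → ℕ → ℝ}
    (hy : ∀ i, ContDiff ℝ 2 fun x => y x i) (n : ℕ) : ContDiff ℝ 2 fun x => halfMoment (y x) n :=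
  contDiff_lineMoment (fun i => by
    unfold halfParam; split_ifs
    · exact contDiff_const
    · exact hy _) _

lemma SupportInterval.contDiff_mom (E : SupportInterval) {F : Type*} [NormedAddCommGroup F]
    [NormedSpace ℝ F] {y : F → ℕ → ℝ} (hy : ∀ i, ContDiff ℝ 2 fun x => y x i) (n : ℕ) :
    ContDiff ℝ 2 fun x => E.mom (y x) n := by
  cases E with
  | compact a b =>
    simp only [SupportInterval.mom]
    simp_rw [fun x => seqFunctional_eq_sum_range (halfMoment (zetaParam (y x)))
      (affinePoly a b ^ n) (Nat.lt_succ_self _)]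
    refine ContDiff.sum fun j _ => contDiff_const.mul (contDiff_halfMoment (fun i => ?_) j)
    unfold zetaParam
    split_ifs
    · exact contDiff_const.mul (hy i)
    · exact (contDiff_const.sub (hy _)).mul (hy i)
  | halfLine => exact contDiff_halfMoment hy n
  | line => exact contDiff_lineMoment hy n

lemma seqFunctional_comp (m : ℕ → ℝ) (r q : ℝ[X]) :
    seqFunctional (fun n => seqFunctional m (r ^ n)) q = seqFunctional m (q.comp r) := by
  induction q using Polynomial.induction_on' with
  | add p q hp hq => rw [add_comp, map_add, map_add, hp, hq]
  | monomial n c => rw [seqFunctional_monomial, monomial_comp, ← smul_eq_C_mul, map_smul, smul_eq_mul]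

lemma integrable_eval_of_moments {μ : Measure ℝ} (hμ : ∀ j : ℕ, Integrable (fun x : ℝ => x ^ j) μ)
    (p : ℝ[X]) : Integrable (fun x => p.eval x) μ := by
  simp_rw [Polynomial.eval_eq_sum_range]
  exact integrable_finsetSum _ fun i _ => (hμ i).const_mul _

/-- Polynomial images of moment measures. -/
lemma momentMeasures_map {S T : Set ℝ} {μ : Measure ℝ} (hμ : μ ∈ momentMeasures S) (r : ℝ[X])
    (h : MapsTo (fun x => r.eval x) S T) (hT : MeasurableSet T) :
    μ.map (fun x => r.eval x) ∈ momentMeasures T ∧ ∀ n : ℕ,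
      ∫ x, x ^ n ∂(μ.map fun x => r.eval x) =
        seqFunctional (fun n => ∫ x, x ^ n ∂μ) (r ^ n) := by
  obtain ⟨hp, h0, hint⟩ := hμ
  have hm : Measurable fun x : ℝ => r.eval x := r.continuous.measurable
  refine ⟨⟨Measure.isProbabilityMeasure_map hm.aemeasurable, ?_, fun j => ?_⟩, fun n => ?_⟩
  · rw [Measure.map_apply hm hT.compl]
    exact measure_mono_null (fun x hx hS => hx (h hS)) h0
  · rw [integrable_map_measure (by fun_prop) hm.aemeasurable]
    simpa [Function.comp_def] using integrable_eval_of_moments hint (r ^ j)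
  · rw [integral_map hm.aemeasurable (by fun_prop), seqFunctional_integral hint]
    simp

lemma SupportInterval.Proper.exists_measure (hE : E.Proper) {y : ℕ → ℝ}
    (hy : ∀ l, y l ∈ closure (E.range l)) (N : ℕ) :
    ∃ μ ∈ momentMeasures E.carrier, ∀ n ≤ N, ∫ x, x ^ n ∂μ = E.mom y n := by
  cases E with
  | compact a b =>
    have hab := hE a b rfl
    have hy' : ∀ l, y l ∈ Icc (0 : ℝ) 1 := fun l => by
      have := hy l
      simp only [SupportInterval.range, alternating, SupportInterval.oddRange,
        SupportInterval.evenRange, ite_self, closure_Ioo (zero_ne_one' ℝ)] at this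
      exact this
    obtain ⟨μ, hμ, hm⟩ := exists_momentMeasure_unit hy' N
    obtain ⟨h1, h2⟩ := momentMeasures_map (T := Icc a b) hμ (affinePoly a b) (fun x hx => by
      simp only [affinePoly, eval_add, eval_C, eval_mul, eval_X]
      constructor <;> nlinarith [hx.1, hx.2]) measurableSet_Icc
    refine ⟨_, h1, fun n hn => ?_⟩
    rw [h2]
    exact seqFunctional_congr hm ((natDegree_affinePoly_pow_le a b n).trans hn)
  | halfLine =>
    refine exists_momentMeasure_halfLine (fun l => ?_) N
    have := hy l
    simp only [SupportInterval.range, alternating, SupportInterval.oddRange,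
      SupportInterval.evenRange, ite_self, closure_Ioi] at this
    exact this
  | line =>
    refine exists_momentMeasure_line (fun l => ?_) N
    have := hy (2 * l + 1)
    have he : ¬ Even (2 * l + 1) := by simp
    simp only [SupportInterval.range, alternating, SupportInterval.evenRange, he, if_false,
      closure_Ioi] at this
    exact this

/-- The solution of the equation for the coordinate number `i`. -/
lemma SupportInterval.Proper.mom_update (hE : E.Proper) {y : ℕ → ℝ} {i : ℕ}
    (hy : ∀ l < i, y l ∈ E.range l) (x : ℝ) :
    E.mom (Function.update y i (y i + (x - E.mom y (i + 1)) / E.slope y i)) (i + 1) = x := by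
  have h := E.mom_step (i := i) (y := y)
    (y' := Function.update y i (y i + (x - E.mom y (i + 1)) / E.slope y i))
    (fun l hl => by rw [Function.update_of_ne hl.ne])
  have := (hE.slope_pos hy).ne'
  rw [Function.update_self, sub_add_cancel_left, mul_neg, mul_div_cancel₀ _ this] at h
  linarith

/-- The next moment is affine in the free coordinate with slope `s > 0`, so one can solve for that
coordinate. The test on squares gives `t ≥ 0`, the endpoint polynomial `t ≤ 1`. -/
lemma unitMoment_bounds {μ : Measure ℝ} (hμ : μ ∈ momentMeasures (Icc 0 1)) {p : ℕ → ℝ} {i : ℕ}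
    (hp : ∀ l < i, p l ∈ Ioo (0 : ℝ) 1)
    (h : ∀ n ≤ i, ∫ x, x ^ n ∂μ = halfMoment (zetaParam p) n) :
    ∃ t ∈ Icc (0 : ℝ) 1,
      ∫ x, x ^ (i + 1) ∂μ = halfMoment (zetaParam (Function.update p i t)) (i + 1) := by
  have hμ' : μ ∈ momentMeasures (Ici 0) :=
    ⟨hμ.1, measure_mono_null (compl_subset_compl.2 Icc_subset_Ici_self) hμ.2.1, hμ.2.2⟩
  set s := ∏ l ∈ Finset.range i, p l * (1 - p l) with hs
  have hs0 : 0 < s := Finset.prod_pos fun l hl => by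
    have := hp l (Finset.mem_range.1 hl)
    exact mul_pos this.1 (sub_pos.2 this.2)
  have hu : ∀ t, ∀ l < i, p l = Function.update p i t l := fun t l hl => by
    rw [Function.update_of_ne hl.ne]
  have hstep : ∀ t, halfMoment (zetaParam p) (i + 1) -
      halfMoment (zetaParam (Function.update p i t)) (i + 1) = s * (p i - t) := fun t => by
    rw [unitMoment_step (hu t), Function.update_self]
  have h1 := halfMoment_lower_bound hμ' h
  have h2 := unitMoment_upper_bound hμ (p := Function.update p i 1) (i := i)
    (by rw [Function.update_self]) (fun n hn => by
      rw [h n hn]; exact halfMoment_congr (zetaParam_congr (hu 1)) n hn)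
  have h3 : (∏ l ∈ Finset.range i, zetaParam p l) * zetaParam p i = s * p i := by
    rw [hs, ← prod_zetaParam, zetaParam]; ring
  rw [h3] at h1
  set m := ∫ x, x ^ (i + 1) ∂μ
  refine ⟨p i + (m - halfMoment (zetaParam p) (i + 1)) / s, ⟨?_, ?_⟩, ?_⟩
  · have : p i + (m - halfMoment (zetaParam p) (i + 1)) / s =
      (m - halfMoment (zetaParam p) (i + 1) + s * p i) / s := by field_simp; ring
    rw [this]; positivity
  · have := hstep 1
    rw [← le_sub_iff_add_le', div_le_iff₀ hs0]
    linarith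
  · have := hstep (p i + (m - halfMoment (zetaParam p) (i + 1)) / s)
    rw [sub_add_cancel_left, mul_neg, mul_div_cancel₀ _ hs0.ne'] at this
    linarith

/-- The next moment of a measure on the interval is described by a coordinate in the closed
range. -/
lemma SupportInterval.Proper.mom_bound (hE : E.Proper) {μ : Measure ℝ}
    (hμ : μ ∈ momentMeasures E.carrier) {y : ℕ → ℝ} {i : ℕ} (hy : ∀ l < i, y l ∈ E.range l)
    (h : ∀ n ≤ i, ∫ x, x ^ n ∂μ = E.mom y n) :
    ∃ t ∈ closure (E.range i), ∫ x, x ^ (i + 1) ∂μ = E.mom (Function.update y i t) (i + 1) := by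
  have hs := hE.slope_pos hy
  have hup := hE.mom_update hy (∫ x, x ^ (i + 1) ∂μ)
  cases E with
  | compact a b =>
    have hab : 0 < b - a := sub_pos.2 (hE a b rfl)
    have hy' : ∀ l < i, y l ∈ Ioo (0 : ℝ) 1 := fun l hl => by
      have := hy l hl
      simpa [SupportInterval.range, alternating, SupportInterval.oddRange,
        SupportInterval.evenRange] using this
    -- The inverse of the affine map carries `μ` to `[0, 1]`, where the bounds are known; composing
    -- the two maps brings the moments back.
    set r' : ℝ[X] := C (1 / (b - a)) * (X - C a) with hr'
    have hcomp : r'.comp (affinePoly a b) = X := by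
      simp only [hr', affinePoly, mul_comp, sub_comp, C_comp, X_comp]
      rw [add_sub_cancel_left, ← mul_assoc, ← C_mul, one_div_mul_cancel hab.ne']
      simp
    have hcomp' : (affinePoly a b).comp r' = X := by
      simp only [hr', affinePoly, mul_comp, add_comp, C_comp, X_comp]
      rw [← mul_assoc, ← C_mul, mul_one_div_cancel hab.ne']
      simp
    have hr'd : r'.natDegree ≤ 1 := by rw [hr']; compute_degree
    obtain ⟨hν, hνm⟩ := momentMeasures_map (T := Icc (0 : ℝ) 1) hμ r' (fun x hx => by
      have hx : x ∈ Icc a b := hx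
      simp only [hr', eval_mul, eval_C, eval_sub, eval_X, mem_Icc]
      rw [one_div_mul_eq_div, div_le_one hab]
      exact ⟨div_nonneg (sub_nonneg.2 hx.1) hab.le, by linarith [hx.2]⟩) measurableSet_Icc
    obtain ⟨t, ht, htm⟩ := unitMoment_bounds hν hy' (fun n hn => by
      rw [hνm, seqFunctional_congr h ((by simpa using natDegree_pow_le_of_le n hr'd :
        (r' ^ n).natDegree ≤ n).trans hn)]
      refine (seqFunctional_comp _ _ _).trans ?_
      rw [pow_comp, hcomp, seqFunctional_X_pow])
    refine ⟨t, ?_, ?_⟩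
    · simp only [SupportInterval.range, alternating, SupportInterval.oddRange,
        SupportInterval.evenRange, ite_self, closure_Ioo (zero_ne_one' ℝ)]
      exact ht
    · simp only [SupportInterval.mom]
      have hall : ∀ n ≤ i + 1, ∫ x, x ^ n ∂(μ.map fun x => r'.eval x) =
          halfMoment (zetaParam (Function.update y i t)) n := by
        intro n hn
        rcases Nat.lt_or_ge n (i + 1) with hn' | hn'
        · rw [hνm, seqFunctional_congr h ((by simpa using natDegree_pow_le_of_le n hr'd :
            (r' ^ n).natDegree ≤ n).trans (by omega))]
          refine (seqFunctional_comp _ _ _).trans ?_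
          rw [pow_comp, hcomp, seqFunctional_X_pow]
          exact halfMoment_congr (zetaParam_congr fun l hl => by
            rw [Function.update_of_ne hl.ne]) n (by omega)
        · obtain rfl : n = i + 1 := by omega
          exact htm
      rw [← seqFunctional_congr hall (natDegree_affinePoly_pow_le a b _)]
      simp_rw [hνm]
      rw [seqFunctional_comp, pow_comp, hcomp', seqFunctional_X_pow]
  | halfLine =>
    refine ⟨_, ?_, hup.symm⟩
    have h1 := halfMoment_lower_bound hμ h
    simp only [SupportInterval.range, alternating, SupportInterval.oddRange,
      SupportInterval.evenRange, ite_self, closure_Ioi, mem_Ici]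
    simp only [SupportInterval.slope, SupportInterval.scale, SupportInterval.factor, one_pow,
      one_mul, SupportInterval.mom] at hs ⊢
    set s := ∏ l ∈ Finset.range i, y l
    set m := ∫ x, x ^ (i + 1) ∂μ
    have : y i + (m - halfMoment y (i + 1)) / s = (m - halfMoment y (i + 1) + s * y i) / s := by
      field_simp; ring
    rw [this]; positivity
  | line =>
    refine ⟨_, ?_, hup.symm⟩
    -- A coefficient `α` is unrestricted. For a coefficient `β` the pivot is a square, and its
    -- nonnegative integral is the slope times the coordinate.
    by_cases he : Even i
    · simp [SupportInterval.range, alternating, SupportInterval.oddRange, he]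
    · have h1 := seqFunctional_pivot h
      rw [seqFunctional_integral hμ.2.2] at h1
      simp only [SupportInterval.range, alternating, SupportInterval.evenRange, he, if_false,
        closure_Ioi, mem_Ici]
      simp only [SupportInterval.slope, SupportInterval.scale, SupportInterval.factor, one_pow,
        one_mul, SupportInterval.mom, ← lineSlope_eq_prod] at hs ⊢
      have h2 : 0 ≤ ∫ x, (linePivot y i).eval x ∂μ := integral_nonneg fun x => by
        simp only [linePivot, he, if_false, eval_pow, Pi.zero_apply]
        positivity
      rw [h1] at h2
      set s := lineSlope y i
      set m := ∫ x, x ^ (i + 1) ∂μ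
      have : y i + (m - lineMoment y (i + 1)) / s =
          (m - lineMoment y (i + 1) + s * y i) / s := by
        field_simp; ring
      rw [this]; positivity

end

section

variable {E : SupportInterval}

/-! ### The coordinates parametrize the interior of the moment space -/

/-- A finite vector as a sequence, extended by zero. -/
def extendZero {n : ℕ} (y : Fin n → ℝ) (l : ℕ) : ℝ := if h : l < n then y ⟨l, h⟩ else 0

lemma extendZero_of_lt {n : ℕ} (y : Fin n → ℝ) {l : ℕ} (h : l < n) :
    extendZero y l = y ⟨l, h⟩ := dif_pos h

@[simp] lemma extendZero_val {n : ℕ} (y : Fin n → ℝ) (i : Fin n) : extendZero y i = y i :=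
  extendZero_of_lt y i.2

lemma contDiff_extendZero {n : ℕ} (l : ℕ) :
    ContDiff ℝ 2 fun y : Fin n → ℝ => extendZero y l := by
  unfold extendZero
  split_ifs
  · exact contDiff_apply ℝ ℝ _
  · exact contDiff_const

/-- The map from coordinates to moments. -/
def SupportInterval.psi (E : SupportInterval) (n : ℕ) (y : Fin n → ℝ) (i : Fin n) : ℝ :=
  E.mom (extendZero y) (i + 1)

/-- The range of the coordinate vectors. -/
def SupportInterval.domain (E : SupportInterval) (n : ℕ) : Set (Fin n → ℝ) :=
  Set.univ.pi fun i => E.range i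

lemma SupportInterval.isOpen_domain (E : SupportInterval) (n : ℕ) : IsOpen (E.domain n) :=
  isOpen_set_pi finite_univ fun _ _ => E.isOpen_range _

lemma SupportInterval.extendZero_mem_range {n : ℕ} {y : Fin n → ℝ} (hy : y ∈ E.domain n) {l : ℕ}
    (hl : l < n) : extendZero y l ∈ E.range l := by
  rw [extendZero_of_lt y hl]; exact hy ⟨l, hl⟩ (mem_univ _)

lemma SupportInterval.contDiff_psi (E : SupportInterval) (n : ℕ) : ContDiff ℝ 2 (E.psi n) :=
  contDiff_pi.2 fun i => E.contDiff_mom contDiff_extendZero (i + 1)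

/-- Triangularity: once the lower coordinates agree, equal moments force the next coordinates to
agree, because the slope is positive. -/
lemma SupportInterval.Proper.injOn_psi (hE : E.Proper) (n : ℕ) :
    InjOn (E.psi n) (E.domain n) := by
  intro y hy y' hy' h
  have key : ∀ j ≤ n, ∀ l < j, extendZero y l = extendZero y' l := by
    intro j hj
    induction j with
    | zero => intro l hl; omega
    | succ j ih =>
      intro l hl
      rcases Nat.lt_or_ge l j with h' | h'
      · exact ih (by omega) l h'
      · obtain rfl : l = j := by omega
        have h1 := E.mom_step (ih (by omega))
        have h2 : E.mom (extendZero y) (l + 1) = E.mom (extendZero y') (l + 1) :=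
          congrFun h ⟨l, by omega⟩
        rw [h2, sub_self, eq_comm, mul_eq_zero] at h1
        rcases h1 with h1 | h1
        · exact absurd h1 (hE.slope_pos fun l' hl' =>
            SupportInterval.extendZero_mem_range hy (by omega)).ne'
        · linarith
  ext i
  simpa using key n le_rfl i i.2

lemma extendZero_add_smul_single {n : ℕ} (y : Fin n → ℝ) (j : Fin n) (t : ℝ) (l : ℕ) :
    extendZero (y + t • Pi.single j 1) l = extendZero y l + if l = j then t else 0 := by
  unfold extendZero
  by_cases h : l < n
  · by_cases hl : l = j
    · have : (⟨l, h⟩ : Fin n) = j := Fin.ext hl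
      simp only [hl, if_true]
      simp
    · have : (⟨l, h⟩ : Fin n) ≠ j := fun e => hl (congrArg Fin.val e)
      simp [h, hl, this]
  · have : l ≠ j := by have := j.2; omega
    simp [h, this]

/-- Along a line in direction `j ≥ i` the moment number `i` is affine, or even constant if `j > i`.
Only the entries on and above the diagonal are computed; this suffices for the determinant. -/
lemma SupportInterval.fderiv_psi_single (E : SupportInterval) {n : ℕ} (y : Fin n → ℝ)
    {i j : Fin n} (hij : i ≤ j) : fderiv ℝ (E.psi n) y (Pi.single j 1) i =
      if i = j then E.slope (extendZero y) i else 0 := by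
  have hd : HasFDerivAt (E.psi n) (fderiv ℝ (E.psi n) y) y :=
    ((E.contDiff_psi n).differentiable (by norm_num) y).hasFDerivAt
  have h1 := (hasFDerivAt_pi'.1 hd i).hasLineDerivAt (Pi.single j 1)
  have h2 : HasLineDerivAt ℝ (fun y => E.psi n y i) (if i = j then E.slope (extendZero y) i else 0)
      y (Pi.single j 1) := by
    unfold HasLineDerivAt
    have : (fun t : ℝ => E.psi n (y + t • Pi.single j 1) i) = fun t =>
        E.psi n y i + t * (if i = j then E.slope (extendZero y) i else 0) := by
      ext t
      have hlt : ∀ l < (i : ℕ), extendZero y l = extendZero (y + t • Pi.single j 1) l := by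
        intro l hl
        have : l ≠ j := by have : (i : ℕ) ≤ j := hij; omega
        rw [extendZero_add_smul_single, if_neg this, add_zero]
      have := E.mom_step hlt
      rw [extendZero_add_smul_single] at this
      simp only [Fin.ext_iff]
      unfold SupportInterval.psi
      split_ifs at this ⊢ <;> linarith
    rw [this]
    have := ((hasDerivAt_id (0 : ℝ)).mul_const
      (if i = j then E.slope (extendZero y) i else 0)).const_add (E.psi n y i)
    rwa [one_mul] at this
  exact h1.lineDeriv.symm.trans h2.lineDeriv

lemma SupportInterval.det_fderiv_psi (E : SupportInterval) {n : ℕ} (y : Fin n → ℝ) :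
    (fderiv ℝ (E.psi n) y).det = ∏ i : Fin n, E.slope (extendZero y) i := by
  unfold ContinuousLinearMap.det
  rw [← LinearMap.det_toMatrix', Matrix.det_of_isLowerTriangular]
  · refine Finset.prod_congr rfl fun i _ => ?_
    rw [LinearMap.toMatrix'_apply]
    have := E.fderiv_psi_single y (le_refl i)
    rw [if_pos rfl] at this
    exact this
  · intro i j hij
    rw [LinearMap.toMatrix'_apply]
    have hij : i < j := hij
    have := E.fderiv_psi_single y hij.le
    rw [if_neg hij.ne] at this
    exact this

lemma SupportInterval.Proper.det_fderiv_psi_pos (hE : E.Proper) {n : ℕ} {y : Fin n → ℝ}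
    (hy : y ∈ E.domain n) : 0 < (fderiv ℝ (E.psi n) y).det := by
  rw [E.det_fderiv_psi]
  exact Finset.prod_pos fun i _ => hE.slope_pos fun l hl =>
    SupportInterval.extendZero_mem_range hy (by have := i.2; omega)

/-- The inverse function theorem, applicable since the Jacobian determinant is a product of positive
slopes. It makes the image of the domain open. -/
lemma SupportInterval.Proper.map_nhds_psi (hE : E.Proper) {n : ℕ} {y : Fin n → ℝ}
    (hy : y ∈ E.domain n) : map (E.psi n) (𝓝 y) = 𝓝 (E.psi n y) := by
  have hs : HasStrictFDerivAt (E.psi n) (fderiv ℝ (E.psi n) y) y :=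
    (E.contDiff_psi n).contDiffAt.hasStrictFDerivAt (by norm_num)
  have hdet := (hE.det_fderiv_psi_pos hy).ne'
  set e := ContinuousLinearMap.toContinuousLinearEquivOfDetNeZero (fderiv ℝ (E.psi n) y) hdet
  have : HasStrictFDerivAt (E.psi n) (e : (Fin n → ℝ) →L[ℝ] (Fin n → ℝ)) y := hs
  exact this.map_nhds_eq_of_equiv

lemma SupportInterval.Proper.image_psi_subset (hE : E.Proper) (n : ℕ) :
    E.psi n '' E.domain n ⊆ momentSpace E.carrier n := by
  rintro _ ⟨y, hy, rfl⟩
  -- Coordinates from `n` on do not affect the first `n` moments; `1 / 2` lies in every range.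
  obtain ⟨μ, hμ, hm⟩ := hE.exists_measure (y := fun l => if l < n then extendZero y l else 1 / 2)
    (fun l => by
      split_ifs with h
      · exact subset_closure (SupportInterval.extendZero_mem_range hy h)
      · exact subset_closure (E.half_mem_range l)) n
  refine ⟨μ, hμ, fun i => ?_⟩
  rw [hm _ i.2]
  exact E.mom_congr (i := n) (fun l hl => by simp [hl]) _ i.2

lemma SupportInterval.mom_update_sub (E : SupportInterval) (y : ℕ → ℝ) (i : ℕ) (t t' : ℝ) :
    E.mom (Function.update y i t) (i + 1) - E.mom (Function.update y i t') (i + 1) =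
      E.slope y i * (t - t') := by
  rw [E.mom_step (y' := Function.update y i t') (fun l hl => by
    rw [Function.update_of_ne hl.ne, Function.update_of_ne hl.ne]), Function.update_self,
    Function.update_self, E.slope_congr (y' := y) fun l hl => by rw [Function.update_of_ne hl.ne]]

/-- Coordinates are found one after the other. Around an interior point the moment number `j` may
move in both directions with the others fixed. All three vectors have a coordinate in the closed
range, and these coordinates are `t` and `t ± δ / (2 slope)`; hence `t` is in the open range. -/
lemma SupportInterval.Proper.interior_subset (hE : E.Proper) (n : ℕ) :
    interior (momentSpace E.carrier n) ⊆ E.psi n '' E.domain n := by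
  intro m hm
  have key : ∀ j ≤ n, ∃ y : ℕ → ℝ, (∀ l, y l ∈ E.range l) ∧
      ∀ l (hl : l < n), l < j → E.mom y (l + 1) = m ⟨l, hl⟩ := by
    intro j hj
    induction j with
    | zero => exact ⟨fun _ => 1 / 2, fun l => E.half_mem_range l, fun l _ h => by omega⟩
    | succ j ih =>
      obtain ⟨y, hy, hym⟩ := ih (by omega)
      have hjn : j < n := by omega
      -- Membership of the modified vector is used only for its entries up to number `j`.
      have solve : ∀ x, Function.update m ⟨j, hjn⟩ x ∈ momentSpace E.carrier n →
          ∃ t ∈ closure (E.range j), x = E.mom (Function.update y j t) (j + 1) := by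
        rintro x ⟨μ, hμ, hmom⟩
        obtain ⟨t, ht, h⟩ := hE.mom_bound hμ (y := y) (i := j) (fun l _ => hy l) (fun l hl => by
          rcases l with _ | l
          · have := hμ.1
            simp [E.mom_zero]
          · have hne : (⟨l, by omega⟩ : Fin n) ≠ ⟨j, hjn⟩ := fun e => by
              have := congrArg Fin.val e; simp at this; omega
            have := hmom ⟨l, by omega⟩
            rw [Function.update_of_ne hne] at this
            rw [hym l (by omega) (by omega), this])
        have := hmom ⟨j, hjn⟩
        rw [Function.update_self] at this
        exact ⟨t, ht, this.trans h⟩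
      have hc : Tendsto (fun ε : ℝ => Function.update m ⟨j, hjn⟩ (m ⟨j, hjn⟩ + ε)) (𝓝 0) (𝓝 m) := by
        have : Continuous fun ε : ℝ => Function.update m ⟨j, hjn⟩ (m ⟨j, hjn⟩ + ε) :=
          continuous_const.update _ (continuous_const.add continuous_id)
        simpa using this.tendsto 0
      obtain ⟨δ, hδ, hball⟩ := Metric.mem_nhds_iff.1 (hc (mem_interior_iff_mem_nhds.1 hm))
      have hmem : ∀ ε, |ε| < δ → Function.update m ⟨j, hjn⟩ (m ⟨j, hjn⟩ + ε) ∈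
          momentSpace E.carrier n := fun ε hε => hball (by simpa using hε)
      obtain ⟨t, ht, h0⟩ := solve _ (hmem 0 (by simpa using hδ))
      obtain ⟨t1, ht1, h1⟩ := solve _ (hmem (δ / 2) (by rw [abs_of_pos] <;> linarith))
      obtain ⟨t2, ht2, h2⟩ := solve _ (hmem (-(δ / 2)) (by rw [abs_neg, abs_of_pos] <;> linarith))
      have hs := hE.slope_pos (y := y) (i := j) fun l _ => hy l
      have e1 := E.mom_update_sub y j t1 t
      have e2 := E.mom_update_sub y j t t2
      have f1 : t1 = t + δ / 2 / E.slope y j := by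
        rw [← h1, ← h0] at e1; field_simp; linarith
      have f2 : t2 = t - δ / 2 / E.slope y j := by
        rw [← h0, ← h2] at e2; field_simp; linarith
      have htr : t ∈ E.range j := E.mem_range_of_perturb (δ := δ / 2 / E.slope y j)
        (by positivity) (f2 ▸ ht2) (f1 ▸ ht1)
      refine ⟨Function.update y j t, fun l => ?_, fun l hl hlj => ?_⟩
      · rcases eq_or_ne l j with rfl | h
        · rwa [Function.update_self]
        · rw [Function.update_of_ne h]; exact hy l
      · rcases Nat.lt_or_ge l j with h | h
        · rw [← hym l hl h]
          exact E.mom_congr (i := j) (fun k hk => by rw [Function.update_of_ne hk.ne]) _ h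
        · obtain rfl : l = j := by omega
          rw [← h0, add_zero]
  obtain ⟨y, hy, hym⟩ := key n le_rfl
  refine ⟨fun i => y i, fun i _ => hy i, ?_⟩
  ext i
  rw [← hym i i.2 i.2]
  exact E.mom_congr (i := n) (fun l hl => by rw [extendZero_of_lt _ hl]) _ i.2

/-- The coordinates parametrize the interior of the moment space. -/
lemma SupportInterval.Proper.image_psi (hE : E.Proper) (n : ℕ) :
    E.psi n '' E.domain n = interior (momentSpace E.carrier n) := by
  refine Subset.antisymm (interior_maximal (hE.image_psi_subset n) ?_) (hE.interior_subset n)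
  rw [isOpen_iff_mem_nhds]
  rintro _ ⟨y, hy, rfl⟩
  rw [← hE.map_nhds_psi hy]
  exact image_mem_map ((E.isOpen_domain n).mem_nhds hy)

/-! ### The coordinate maps -/

/-- With the lower moments fixed, `mom_bound` gives one inclusion and `exists_measure` the other.
Both include boundary coordinates, so the extremal moments sit at the endpoints of the closed range.
-/
lemma SupportInterval.Proper.momentSection_psi (hE : E.Proper) {n : ℕ} {y : Fin n → ℝ}
    (hy : y ∈ E.domain n) (i : Fin n) : momentSection E.carrier (E.psi n y) i =
      (fun t => E.psi n y i + E.slope (extendZero y) i * (t - y i)) '' closure (E.range i) := by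
  have hval : ∀ t, E.mom (Function.update (extendZero y) i t) (i + 1) =
      E.psi n y i + E.slope (extendZero y) i * (t - y i) := fun t => by
    have := E.mom_update_sub (extendZero y) i t (y i)
    rw [← extendZero_val y i, Function.update_eq_self] at this
    rw [SupportInterval.psi, ← extendZero_val y i, ← this]
    simp
  have hyr : ∀ l < (i : ℕ), extendZero y l ∈ E.range l := fun l hl =>
    SupportInterval.extendZero_mem_range hy (hl.trans i.2)
  ext x
  constructor
  · rintro ⟨μ, hμ, hlow, rfl⟩
    obtain ⟨t, ht, h⟩ := hE.mom_bound hμ hyr (fun l hl => by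
      rcases l with _ | l
      · have := hμ.1
        simp [E.mom_zero]
      · exact hlow ⟨l, by have := i.2; omega⟩ (by rw [Fin.lt_def]; exact hl))
    exact ⟨t, ht, by rw [h, hval]⟩
  · rintro ⟨t, ht, rfl⟩
    -- The given coordinates below `i`, the boundary or interior value `t` at `i`, and an irrelevant
    -- value beyond.
    set Y : ℕ → ℝ := fun l => if l < i then extendZero y l else if l = i then t else 1 / 2 with hY
    obtain ⟨μ, hμ, hm⟩ := hE.exists_measure (y := Y) (fun l => by
        simp only [hY]
        split_ifs with h h'
        · exact subset_closure (hyr l h)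
        · exact h' ▸ ht
        · exact subset_closure (E.half_mem_range l)) (i + 1)
    refine ⟨μ, hμ, fun l hl => ?_, ?_⟩
    · have hl : (l : ℕ) < i := hl
      rw [hm _ (by omega)]
      exact E.mom_congr (i := i) (fun k hk => by simp [hY, hk]) _ (by omega)
    · rw [hm _ le_rfl]
      simp only
      rw [← hval]
      refine E.mom_congr (i := i + 1) (fun k hk => ?_) _ le_rfl
      rcases Nat.lt_or_ge k i with h | h
      · rw [Function.update_of_ne h.ne]; simp [hY, h]
      · obtain rfl : k = i := by omega
        rw [Function.update_self]; simp [hY]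

lemma isLeast_affine_image {c s t₀ u : ℝ} {T : Set ℝ} (hs : 0 < s) (h : IsLeast T u) :
    IsLeast ((fun t => c + s * (t - t₀)) '' T) (c + s * (u - t₀)) :=
  ⟨mem_image_of_mem _ h.1, by
    rintro _ ⟨t, ht, rfl⟩
    have := mul_le_mul_of_nonneg_left (sub_le_sub_right (h.2 ht) t₀) hs.le
    simpa using this⟩

lemma isGreatest_affine_image {c s t₀ u : ℝ} {T : Set ℝ} (hs : 0 < s) (h : IsGreatest T u) :
    IsGreatest ((fun t => c + s * (t - t₀)) '' T) (c + s * (u - t₀)) :=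
  ⟨mem_image_of_mem _ h.1, by
    rintro _ ⟨t, ht, rfl⟩
    have := mul_le_mul_of_nonneg_left (sub_le_sub_right (h.2 ht) t₀) hs.le
    simpa using this⟩

lemma compactCoord_psi {a b : ℝ} (hab : a < b) {n : ℕ} {y : Fin n → ℝ}
    (hy : y ∈ (SupportInterval.compact a b).domain n) :
    compactCoord a b ((SupportInterval.compact a b).psi n y) = y := by
  have hE : (SupportInterval.compact a b).Proper := by
    rintro a' b' h; cases h; exact hab
  ext i
  have hs := hE.slope_pos (y := extendZero y) (i := i) fun l hl =>
    SupportInterval.extendZero_mem_range hy (hl.trans i.2)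
  have hsec := hE.momentSection_psi hy i
  have hr : closure ((SupportInterval.compact a b).range i) = Icc 0 1 := by
    simp [SupportInterval.range, alternating, SupportInterval.oddRange,
      SupportInterval.evenRange, closure_Ioo (zero_ne_one' ℝ)]
  rw [hr] at hsec
  have h1 : lowerMoment (Icc a b) ((SupportInterval.compact a b).psi n y) i = _ :=
    (congrArg sInf hsec).trans
      (isLeast_affine_image hs (isLeast_Icc (zero_le_one' ℝ))).csInf_eq
  have h2 : upperMoment (Icc a b) ((SupportInterval.compact a b).psi n y) i = _ :=
    (congrArg sSup hsec).trans
      (isGreatest_affine_image hs (isGreatest_Icc (zero_le_one' ℝ))).csSup_eq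
  rw [compactCoord, h1, h2, div_eq_iff (by nlinarith)]
  ring

lemma halfLineCoord_psi {n : ℕ} {y : Fin n → ℝ} (hy : y ∈ SupportInterval.halfLine.domain n) :
    halfLineCoord (SupportInterval.halfLine.psi n y) = y := by
  have hE : SupportInterval.halfLine.Proper := by rintro a' b' h; cases h
  have key : ∀ i : Fin n, SupportInterval.halfLine.psi n y i -
      lowerMoment (Ici 0) (SupportInterval.halfLine.psi n y) i =
        (∏ l ∈ Finset.range i, extendZero y l) * y i := by
    intro i
    have hs := hE.slope_pos (y := extendZero y) (i := i) fun l hl =>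
      SupportInterval.extendZero_mem_range hy (hl.trans i.2)
    have hsec := hE.momentSection_psi hy i
    have hr : closure (SupportInterval.halfLine.range i) = Ici 0 := by
      simp [SupportInterval.range, alternating, SupportInterval.oddRange,
        SupportInterval.evenRange]
    rw [hr] at hsec
    have h1 : lowerMoment (Ici 0) (SupportInterval.halfLine.psi n y) i = _ :=
      (congrArg sInf hsec).trans (isLeast_affine_image hs isLeast_Ici).csInf_eq
    rw [h1]
    simp [SupportInterval.slope, SupportInterval.scale, SupportInterval.factor]
  have hpos : ∀ l < n, 0 < extendZero y l := fun l hl => by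
    have := SupportInterval.extendZero_mem_range hy hl
    simpa [SupportInterval.range, alternating, SupportInterval.oddRange,
        SupportInterval.evenRange] using this
  ext ⟨i, hi⟩
  rcases i with _ | j
  · rw [halfLineCoord, key]; simp
  · rw [halfLineCoord, key, key, Finset.prod_range_succ,
      ← extendZero_of_lt y (Nat.lt_of_succ_lt hi)]
    have h1 := (Finset.prod_pos fun l hl => hpos l (by
      have := Finset.mem_range.1 hl; omega) : 0 < ∏ l ∈ Finset.range j, extendZero y l).ne'
    have h2 := (hpos j (by omega)).ne'
    simp only
    field_simp

/-- The functional of a finite moment vector agrees with the Jacobi functional only up to degree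
`n`. All squares entering the coordinates below `n` stay within this degree, and there the quotients
of `L (X P²)` and `L (P²)` return the parameters. -/
lemma lineCoord_psi {n : ℕ} {y : Fin n → ℝ} (hy : y ∈ SupportInterval.line.domain n) :
    lineCoord (SupportInterval.line.psi n y) = y := by
  set m := SupportInterval.line.psi n y with hm
  set Y := extendZero y with hY
  have hβ : ∀ l, 2 * l + 1 < n → 0 < Y (2 * l + 1) := fun l hl => by
    have := SupportInterval.extendZero_mem_range hy hl
    have he : ¬ Even (2 * l + 1) := by simp
    simpa [SupportInterval.range, alternating, he, SupportInterval.evenRange] using this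
  have hL : ∀ p : ℝ[X], p.natDegree ≤ n → momentFunctional m p = seqFunctional (lineMoment Y) p := by
    intro p hp
    rw [momentFunctional, ← seqFunctional_apply]
    refine seqFunctional_congr (fun j hj => ?_) hp
    rcases j with _ | j
    · simp [momentOfOrder, lineMoment_zero]
    · simp only [momentOfOrder, dif_pos (show j < n by omega)]
      rfl
  have hd : ∀ j, (linePoly Y j).natDegree = j := fun j => jacobiPoly_natDegree _ _ _
  have hmon : ∀ j, (linePoly Y j).Monic := fun j => jacobiPoly_monic _ _ _
  have hsq : ∀ j, 2 * j ≤ n → momentFunctional m (linePoly Y j ^ 2) =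
      ∏ l ∈ Finset.range j, Y (2 * l + 1) := fun j hj => by
    rw [hL _ (by rw [(hmon j).natDegree_pow, hd]; exact hj)]
    exact jacobiFunctional_poly_sq _ _ _
  have hX : ∀ j, 2 * j + 1 ≤ n → momentFunctional m (X * linePoly Y j ^ 2) =
      Y (2 * j) * ∏ l ∈ Finset.range j, Y (2 * l + 1) := fun j hj => by
    rw [hL _ (by
      rw [monic_X.natDegree_mul ((hmon j).pow 2), (hmon j).natDegree_pow, hd, natDegree_X]; omega)]
    exact jacobiFunctional_X_mul_poly_sq _ _ _
  have hpos : ∀ j, 2 * j ≤ n → 0 < ∏ l ∈ Finset.range j, Y (2 * l + 1) := fun j hj =>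
    Finset.prod_pos fun l hl => hβ l (by have := Finset.mem_range.1 hl; omega)
  have hα' : ∀ j, 2 * j + 1 ≤ n → momentFunctional m (X * linePoly Y j ^ 2) /
      momentFunctional m (linePoly Y j ^ 2) = Y (2 * j) := fun j hj => by
    rw [hsq j (by omega), hX j hj, mul_div_cancel_right₀ _ (hpos j (by omega)).ne']
  have hβ' : ∀ j, 2 * j + 2 ≤ n → momentFunctional m (linePoly Y (j + 1) ^ 2) /
      momentFunctional m (linePoly Y j ^ 2) = Y (2 * j + 1) := fun j hj => by
    rw [hsq j (by omega), hsq (j + 1) (by omega), Finset.prod_range_succ,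
      mul_div_cancel_left₀ _ (hpos j (by omega)).ne']
  -- Two consecutive indices are carried along because the recurrence has order two. The polynomial
  -- of index `j` uses `L (X P²)` at index `j - 1`, of degree `2 * j - 1`, whence the bound `2 * j ≤
  -- n + 1`.
  have hP : ∀ j, (2 * j ≤ n + 1 → monicOrthogonal (momentFunctional m) j = linePoly Y j) ∧
      (2 * (j + 1) ≤ n + 1 →
        monicOrthogonal (momentFunctional m) (j + 1) = linePoly Y (j + 1)) := by
    intro j
    induction j with
    | zero =>
      refine ⟨fun _ => by rw [monicOrthogonal, linePoly, jacobiPoly], fun h => ?_⟩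
      have := hα' 0 (by omega)
      simp only [linePoly, jacobiPoly, one_pow, mul_one] at this
      rw [monicOrthogonal, linePoly, jacobiPoly, this]
    | succ j ih =>
      refine ⟨ih.2, fun h => ?_⟩
      rw [monicOrthogonal, ih.1 (by omega), ih.2 (by omega), hα' (j + 1) (by omega),
        hβ' j (by omega)]
      rw [linePoly, linePoly, linePoly, jacobiPoly]
  ext i
  have hi := i.2
  unfold lineCoord
  split_ifs with he
  · have := Nat.two_mul_div_two_of_even he
    rw [recurrenceAlpha, (hP _).1 (by omega), hα' _ (by omega), this, hY, extendZero_val]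
  · have := Nat.two_mul_div_two_add_one_of_odd (Nat.not_even_iff_odd.1 he)
    rw [recurrenceBeta, (hP (i / 2)).1 (by omega), (hP (i / 2)).2 (by omega), hβ' _ (by omega), this, hY,
      extendZero_val]

lemma SupportInterval.Proper.coord_psi (hE : E.Proper) {n : ℕ} {y : Fin n → ℝ}
    (hy : y ∈ E.domain n) : E.coord (E.psi n y) = y := by
  cases E with
  | compact a b => exact compactCoord_psi (hE a b rfl) hy
  | halfLine => exact halfLineCoord_psi hy
  | line => exact lineCoord_psi hy

/-- On the interior, which is the image of `psi`, the coordinate map is injective, since `coord_psi`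
gives a left inverse of `psi`. The preimage chosen by `Function.invFunOn` is thus the value of
`psi`. -/
lemma SupportInterval.Proper.phi_eq_psi (hE : E.Proper) {n : ℕ} {y : Fin n → ℝ}
    (hy : y ∈ E.domain n) : E.phi n y = E.psi n y := by
  have hmem : ∃ m ∈ interior (momentSpace E.carrier n), E.coord m = y :=
    ⟨E.psi n y, by rw [← hE.image_psi]; exact mem_image_of_mem _ hy, hE.coord_psi hy⟩
  have h1 := Function.invFunOn_mem hmem
  have h2 := Function.invFunOn_eq hmem
  rw [← hE.image_psi] at h1
  obtain ⟨y', hy', h3⟩ := h1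
  have h3 : E.psi n y' = E.phi n y := h3.trans (by rw [hE.image_psi]; rfl)
  have h4 : E.coord (E.phi n y) = y := h2
  rw [← h3, hE.coord_psi hy'] at h4
  rw [← h3, h4]

lemma SupportInterval.Proper.phiJacobian_eq (hE : E.Proper) {n : ℕ} {y : Fin n → ℝ}
    (hy : y ∈ E.domain n) :
    E.phiJacobian n y = LinearMap.toMatrix' (fderiv ℝ (E.psi n) y).toLinearMap := by
  have : E.phi n =ᶠ[𝓝 y] E.psi n := by
    filter_upwards [(E.isOpen_domain n).mem_nhds hy] with z hz using hE.phi_eq_psi hz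
  rw [SupportInterval.phiJacobian, this.fderiv_eq]

end

section

/-! ### Moments of the limit measures -/

lemma motzkin_zero_diag_zero (β : ℕ → ℝ) (n : ℕ) :
    motzkin (fun _ => 0) β (n + 1) 0 = β 0 * motzkin (fun _ => 0) β n 1 := by
  rw [motzkin]; ring

lemma motzkin_zero_diag_succ (β : ℕ → ℝ) (n i : ℕ) : motzkin (fun _ => 0) β (n + 1) (i + 1) =
    motzkin (fun _ => 0) β n i + β (i + 1) * motzkin (fun _ => 0) β n (i + 2) := by
  rw [motzkin]; ring

/-- A path without level steps, seen at every second step on odd heights, is again a Motzkin path. A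
level step is down-up or up-down, with weight `β (2i) + β (2i+1)`; a down step is a double descent.
-/
lemma motzkin_two_step (β : ℕ → ℝ) : ∀ n i : ℕ, motzkin (fun _ => 0) β (2 * n + 1) (2 * i + 1) =
    motzkin (fun i => β (2 * i) + β (2 * i + 1)) (fun i => β (2 * i + 1) * β (2 * i + 2)) n i
  | 0, 0 => by simp [motzkin]
  | 0, i + 1 => by rw [motzkin_of_lt _ _ (by omega), motzkin_of_lt _ _ (by omega)]
  | n + 1, 0 => by
    conv_rhs => rw [motzkin]
    rw [← motzkin_two_step β n 0, ← motzkin_two_step β n 1,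
      show 2 * (n + 1) + 1 = (2 * n + 1 + 1) + 1 by ring, motzkin_zero_diag_succ _ _ (2 * 0),
      motzkin_zero_diag_succ _ _ (2 * 0 + 1), mul_zero, motzkin_zero_diag_zero]
    ring
  | n + 1, i + 1 => by
    conv_rhs => rw [motzkin]
    rw [← motzkin_two_step β n i, ← motzkin_two_step β n (i + 1), ← motzkin_two_step β n (i + 2),
      show 2 * (n + 1) + 1 = (2 * n + 1 + 1) + 1 by ring,
      show 2 * (i + 1) = 2 * i + 1 + 1 by ring, motzkin_zero_diag_succ _ _ (2 * i + 1 + 1),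
      motzkin_zero_diag_succ _ _ (2 * i + 1), motzkin_zero_diag_succ _ _ (2 * i + 1 + 1 + 1)]
    simp only [show 2 * (i + 2) + 1 = 2 * i + 1 + 1 + 1 + 2 by ring,
      show 2 * i + 1 + 1 + 1 = 2 * i + 1 + 2 by ring]
    ring

/-- The first step must go up to height `1` and the last one down from it, which costs `β 0`; in
between the path is observed at odd heights. The identity describes the measure `x μ(dx)`. -/
lemma halfMoment_succ (β : ℕ → ℝ) (n : ℕ) : halfMoment β (n + 1) = β 0 *
    motzkin (fun i => β (2 * i) + β (2 * i + 1)) (fun i => β (2 * i + 1) * β (2 * i + 2)) n 0 := by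
  rw [halfMoment, lineMoment_halfParam, ← motzkin_two_step,
    show 2 * (n + 1) = 2 * n + 1 + 1 by ring, motzkin]
  simp

lemma halfMoment_alternating (z₁ z₂ : ℝ) (n : ℕ) : halfMoment (alternating z₁ z₂) (n + 1) =
    z₁ * motzkin (fun _ => z₁ + z₂) (fun _ => z₁ * z₂) n 0 := by
  rw [halfMoment_succ]
  congr 2
  · simp [alternating]
  · ext i
    have : ¬ Even (2 * i + 1) := by simp
    have h2 : Even (2 * i + 2) := by simp [parity_simps]
    simp only [alternating, this, h2, if_true, if_false]; ring

/-- The effect of changing the first diagonal entry of a constant Jacobi matrix. -/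
lemma motzkin_perturb (α β δ : ℝ) (n i : ℕ) : motzkin (fun _ => α) (fun _ => β) n i =
    motzkin (fun i => if i = 0 then α + δ else α) (fun _ => β) n i -
      δ * motzkin (fun i => if i = 0 then α + δ else α) (fun _ => β) n (i + 1) := by
  induction n generalizing i with
  | zero => rcases i with _ | i <;> simp [motzkin]
  | succ n ih =>
    rcases i with _ | i
    · simp only [motzkin, ih 0, ih 1]; simp; ring
    · simp only [motzkin, ih i, ih (i + 1), ih (i + 2)]; simp; ring

lemma unitMoment_alternating_succ (p₁ p₂ : ℝ) (n : ℕ) :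
    halfMoment (zetaParam (alternating p₁ p₂)) (n + 1) = p₁ *
      motzkin (fun i => if i = 0 then p₁ * (1 - p₂) + p₂ * (1 - p₁) + p₁ * p₂ else
        p₁ * (1 - p₂) + p₂ * (1 - p₁)) (fun _ => p₁ * (1 - p₂) * (p₂ * (1 - p₁))) n 0 := by
  have hodd : ∀ i, zetaParam (alternating p₁ p₂) (2 * i + 1) = (1 - p₁) * p₂ := fun i => by
    simp [zetaParam, alternating]
  have heven : ∀ i, zetaParam (alternating p₁ p₂) (2 * i + 2) = (1 - p₂) * p₁ := fun i => by
    have h2 : Even (2 * i + 2) := by simp [parity_simps]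
    simp [zetaParam, alternating, h2]
  have hzero : zetaParam (alternating p₁ p₂) 0 = p₁ := by simp [zetaParam, alternating]
  rw [halfMoment_succ, hzero]
  congr 2
  · ext i
    rcases i with _ | i
    · rw [if_pos rfl, hodd, mul_zero, hzero]; ring
    · rw [if_neg (Nat.succ_ne_zero i), hodd, show 2 * (i + 1) = 2 * i + 2 by ring, heven]; ring
  · ext i
    rw [hodd, heven]; ring

/-- Removing the exceptional first diagonal entry uses `motzkin_perturb` with `δ = p₁ p₂`. The
result is a single constant-weight count because, with `α` the unperturbed diagonal entry, `1 - α -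
δ` and the off-diagonal weight divided by `δ` are both `(1 - p₁) (1 - p₂)`. So `x (1 - x) μ(dx)` is
a multiple of a semicircle law. -/
lemma unitMoment_alternating_sub (p₁ p₂ : ℝ) (n : ℕ) :
    halfMoment (zetaParam (alternating p₁ p₂)) (n + 1) -
      halfMoment (zetaParam (alternating p₁ p₂)) (n + 2) = p₁ * (1 - p₁) * (1 - p₂) *
        motzkin (fun _ => p₁ * (1 - p₂) + p₂ * (1 - p₁))
          (fun _ => p₁ * (1 - p₂) * (p₂ * (1 - p₁))) n 0 := by
  rw [unitMoment_alternating_succ, unitMoment_alternating_succ, motzkin_perturb _ _ (p₁ * p₂),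
    motzkin]
  simp only [if_true, zero_add]
  ring

/-- The functions `sin ((i + 1) θ)` diagonalize multiplication by `cos θ`. -/
lemma integral_pow_mul_sin_mul_sin (α β : ℝ) (hβ : 0 ≤ β) (n i : ℕ) :
    ∫ θ in (0 : ℝ)..Real.pi, (α + 2 * √β * Real.cos θ) ^ n *
      (Real.sin ((i + 1) * θ) * Real.sin θ) =
        Real.pi / 2 * √β ^ i * motzkin (fun _ => α) (fun _ => β) n i := by
  induction n generalizing i with
  | zero =>
    have h : ∀ θ : ℝ, (α + 2 * √β * Real.cos θ) ^ 0 * (Real.sin ((i + 1) * θ) * Real.sin θ) =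
        (Real.cos (i * θ) - Real.cos ((i + 2 : ℕ) * θ)) / 2 := fun θ => by
      rw [show (i : ℝ) * θ = (i + 1) * θ - θ by ring,
        show ((i + 2 : ℕ) : ℝ) * θ = (i + 1) * θ + θ by push_cast; ring, Real.cos_sub,
        Real.cos_add]
      ring
    have hc : ∀ m : ℕ, m ≠ 0 → ∫ θ in (0 : ℝ)..Real.pi, Real.cos (m * θ) = 0 := fun m hm => by
      rw [intervalIntegral.integral_comp_mul_left _ (Nat.cast_ne_zero.2 hm), integral_cos,
        Real.sin_nat_mul_pi]
      simp
    have hi : ∀ m : ℕ, IntervalIntegrable (fun θ : ℝ => Real.cos (m * θ)) volume 0 Real.pi :=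
      fun m => Continuous.intervalIntegrable (by fun_prop) _ _
    simp_rw [h]
    rw [intervalIntegral.integral_div, intervalIntegral.integral_sub (hi _) (hi _),
      hc (i + 2) (by omega)]
    rcases i with _ | i
    · simp [motzkin]
    · rw [hc (i + 1) (by omega)]; simp [motzkin]
  | succ n ih =>
    have hcont : ∀ c : ℝ, IntervalIntegrable (fun θ : ℝ => (α + 2 * √β * Real.cos θ) ^ n *
        (Real.sin (c * θ) * Real.sin θ)) volume 0 Real.pi :=
      fun m => Continuous.intervalIntegrable (by fun_prop) _ _
    have h : ∀ θ : ℝ, (α + 2 * √β * Real.cos θ) ^ (n + 1) *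
        (Real.sin ((i + 1) * θ) * Real.sin θ) =
        α * ((α + 2 * √β * Real.cos θ) ^ n * (Real.sin ((i + 1) * θ) * Real.sin θ)) +
        √β * ((α + 2 * √β * Real.cos θ) ^ n * (Real.sin (((i + 1 : ℕ) + 1) * θ) * Real.sin θ)) +
        √β * ((α + 2 * √β * Real.cos θ) ^ n * (Real.sin (i * θ) * Real.sin θ)) := fun θ => by
      have e : Real.sin (((i + 1 : ℕ) + 1) * θ) + Real.sin (i * θ) =
          2 * Real.cos θ * Real.sin ((i + 1) * θ) := by
        rw [show (((i + 1 : ℕ) : ℝ) + 1) * θ = (i + 1) * θ + θ by push_cast; ring,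
          show (i : ℝ) * θ = (i + 1) * θ - θ by ring, Real.sin_add, Real.sin_sub]
        ring
      rw [pow_succ]
      linear_combination (-(√β * (α + 2 * √β * Real.cos θ) ^ n * Real.sin θ)) * e
    simp_rw [h]
    rw [intervalIntegral.integral_add (((hcont _).const_mul _).add ((hcont _).const_mul _))
      ((hcont _).const_mul _), intervalIntegral.integral_add ((hcont _).const_mul _)
      ((hcont _).const_mul _), intervalIntegral.integral_const_mul,
      intervalIntegral.integral_const_mul, intervalIntegral.integral_const_mul, ih, ih]
    have hs := Real.mul_self_sqrt hβ
    rcases i with _ | i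
    · simp only [motzkin, CharP.cast_eq_zero, zero_mul, Real.sin_zero, mul_zero,
        intervalIntegral.integral_zero]
      linear_combination (Real.pi / 2 * motzkin (fun _ => α) (fun _ => β) n 1) * hs
    · have := ih i
      push_cast at this ⊢
      rw [this]
      simp only [motzkin]
      linear_combination (Real.pi / 2 * √β ^ (i + 1) *
        motzkin (fun _ => α) (fun _ => β) n (i + 2)) * hs

lemma integral_pow_mul_sin_sq (α β : ℝ) (hβ : 0 ≤ β) (n : ℕ) :
    ∫ θ in Icc 0 Real.pi, (α + 2 * √β * Real.cos θ) ^ n * Real.sin θ ^ 2 =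
      Real.pi / 2 * motzkin (fun _ => α) (fun _ => β) n 0 := by
  have h := integral_pow_mul_sin_mul_sin α β hβ n 0
  rw [integral_Icc_eq_integral_Ioc, ← intervalIntegral.integral_of_le Real.pi_pos.le]
  simpa [sq] using h

/-- A bounded sequence with `a (k + 2) + a k = (r + r⁻¹) a (k + 1)` decays like `r ^ k`. -/
lemma eq_mul_of_bounded_recurrence {a : ℕ → ℝ} {r B : ℝ} (hr : 0 < r) (hr1 : r < 1)
    (ha : ∀ k, |a k| ≤ B) (h : ∀ k, a (k + 2) + a k = (r + r⁻¹) * a (k + 1)) :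
    a 1 = r * a 0 := by
  -- The combination `a (k + 1) - r * a k` isolates the solution growing like `r⁻¹ ^ k`, which
  -- boundedness rules out.
  have hd : ∀ k, a 1 - r * a 0 = r ^ k * (a (k + 1) - r * a k) := by
    intro k
    induction k with
    | zero => simp
    | succ k ih =>
      rw [ih]
      have : a (k + 2) = (r + r⁻¹) * a (k + 1) - a k := by linarith [h k]
      rw [this, pow_succ]
      field_simp
      ring
  have hb : ∀ k, |a 1 - r * a 0| ≤ r ^ k * (2 * B) := fun k => by
    rw [hd k, abs_mul, abs_of_pos (pow_pos hr k)]
    refine mul_le_mul_of_nonneg_left ?_ (pow_pos hr k).le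
    have hB : 0 ≤ B := (abs_nonneg _).trans (ha 0)
    calc |a (k + 1) - r * a k| ≤ |a (k + 1)| + |r * a k| := abs_sub _ _
      _ ≤ B + 1 * B := by
        rw [abs_mul, abs_of_pos hr]
        exact add_le_add (ha _) (mul_le_mul hr1.le (ha _) (abs_nonneg _) zero_le_one)
      _ = 2 * B := by ring
  have hlim : Tendsto (fun k : ℕ => r ^ k * (2 * B)) atTop (𝓝 (0 * (2 * B))) :=
    (tendsto_pow_atTop_nhds_zero_of_lt_one hr.le hr1).mul_const _
  rw [zero_mul] at hlim
  have := ge_of_tendsto' hlim hb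
  have h0 := abs_nonpos_iff.1 this
  linarith

lemma sin_sq_div_le {z θ : ℝ} (hz : 1 ≤ z) : |Real.sin θ ^ 2 / (z - Real.cos θ)| ≤ 2 := by
  have h1 := Real.cos_le_one θ
  have h2 := Real.neg_one_le_cos θ
  have h3 : 0 ≤ z - Real.cos θ := by linarith
  rw [abs_of_nonneg (div_nonneg (sq_nonneg _) h3)]
  refine div_le_of_le_mul₀ h3 (by norm_num) ?_
  have := Real.sin_sq_add_cos_sq θ
  nlinarith

lemma integrableOn_sin_sq_div {z : ℝ} (hz : 1 ≤ z) :
    IntegrableOn (fun θ => Real.sin θ ^ 2 / (z - Real.cos θ)) (Icc 0 Real.pi) := by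
  refine Measure.integrableOn_of_bounded (M := 2) (by simp) ?_ (ae_of_all _ fun θ => by
    rw [Real.norm_eq_abs]; exact sin_sq_div_le hz)
  exact (by fun_prop : Measurable fun θ => Real.sin θ ^ 2 / (z - Real.cos θ)).aestronglyMeasurable

/-- The integrals `a k` with `sin (k θ)` in place of one factor `sin θ` satisfy a recurrence with
characteristic roots `r` and `r⁻¹`, inhomogeneous only in its first instance. They are bounded, so
`a 2 = r * a 1`, and the first instance then yields `a 1 = π r`. -/
lemma integral_sin_sq_div_of_one_lt {r : ℝ} (hr : 0 < r) (hr1 : r < 1) :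
    ∫ θ in (0 : ℝ)..Real.pi, Real.sin θ ^ 2 / ((r + r⁻¹) / 2 - Real.cos θ) = Real.pi * r := by
  set z := (r + r⁻¹) / 2 with hz
  have hz1 : 1 < z := by
    have h1 : r * r⁻¹ = 1 := mul_inv_cancel₀ hr.ne'
    have h2 : 0 < r⁻¹ := inv_pos.2 hr
    nlinarith [mul_pos h2 (mul_pos (sub_pos.2 hr1) (sub_pos.2 hr1))]
  have hpos : ∀ θ, 0 < z - Real.cos θ := fun θ => by linarith [Real.cos_le_one θ]
  set a : ℕ → ℝ := fun k => ∫ θ in (0 : ℝ)..Real.pi,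
    Real.sin (k * θ) * Real.sin θ / (z - Real.cos θ) with ha
  have hint : ∀ c : ℝ, IntervalIntegrable (fun θ : ℝ =>
      Real.sin (c * θ) * Real.sin θ / (z - Real.cos θ)) volume 0 Real.pi := fun c =>
    Continuous.intervalIntegrable
      (by fun_prop (disch := exact fun θ => (hpos θ).ne')) _ _
  have hint' : ∀ c : ℝ, IntervalIntegrable (fun θ : ℝ =>
      Real.sin (c * θ) * Real.sin θ) volume 0 Real.pi := fun c =>
    Continuous.intervalIntegrable (by fun_prop) _ _
  have hrec : ∀ k : ℕ, a (k + 2) + a k = 2 * z * a (k + 1) -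
      2 * ∫ θ in (0 : ℝ)..Real.pi, Real.sin ((k + 1 : ℕ) * θ) * Real.sin θ := by
    intro k
    simp only [ha]
    rw [← intervalIntegral.integral_add (hint _) (hint _), ← intervalIntegral.integral_const_mul,
      ← intervalIntegral.integral_const_mul, ← intervalIntegral.integral_sub
        ((hint _).const_mul _) ((hint' _).const_mul _)]
    refine intervalIntegral.integral_congr fun θ _ => ?_
    have e : Real.sin ((k + 2 : ℕ) * θ) + Real.sin (k * θ) =
        2 * Real.cos θ * Real.sin ((k + 1 : ℕ) * θ) := by
      rw [show ((k + 2 : ℕ) : ℝ) * θ = (k + 1 : ℕ) * θ + θ by push_cast; ring,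
        show (k : ℝ) * θ = (k + 1 : ℕ) * θ - θ by push_cast; ring, Real.sin_add, Real.sin_sub]
      ring
    have := (hpos θ).ne'
    generalize Real.sin ((k + 2 : ℕ) * θ) = s₂ at e ⊢
    generalize Real.sin ((k + 1 : ℕ) * θ) = s₁ at e ⊢
    generalize Real.sin (k * θ) = s₀ at e ⊢
    field_simp
    linear_combination Real.sin θ * e
  have hbase : ∀ k : ℕ, ∫ θ in (0 : ℝ)..Real.pi, Real.sin ((k + 1 : ℕ) * θ) * Real.sin θ =
      if k = 0 then Real.pi / 2 else 0 := fun k => by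
    have := integral_pow_mul_sin_mul_sin 0 0 le_rfl 0 k
    simp only [pow_zero, one_mul] at this
    push_cast
    rw [this]
    rcases k with _ | k <;> simp [motzkin]
  have ha0 : a 0 = 0 := by simp [ha]
  have hbound : ∀ k, |a (k + 1)| ≤ Real.pi / (z - 1) := fun k => by
    have := intervalIntegral.norm_integral_le_of_norm_le_const (a := 0) (b := Real.pi)
      (C := 1 / (z - 1)) (f := fun θ => Real.sin ((k + 1 : ℕ) * θ) * Real.sin θ / (z - Real.cos θ))
      (fun θ _ => by
        rw [norm_div, norm_mul, Real.norm_eq_abs, Real.norm_eq_abs, Real.norm_eq_abs,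
          abs_of_pos (hpos θ)]
        refine div_le_div₀ zero_le_one ?_ (sub_pos.2 hz1) (by linarith [Real.cos_le_one θ])
        exact mul_le_one₀ (Real.abs_sin_le_one _) (abs_nonneg _) (Real.abs_sin_le_one _))
    rw [Real.norm_eq_abs, sub_zero, abs_of_pos Real.pi_pos] at this
    refine this.trans (le_of_eq (by ring))
  have h2z : 2 * z = r + r⁻¹ := by rw [hz]; ring
  have h21 : a 2 = r * a 1 := eq_mul_of_bounded_recurrence (a := fun k => a (k + 1)) hr hr1 hbound
    fun k => by
      have := hrec (k + 1)
      rw [hbase, if_neg (Nat.succ_ne_zero k), mul_zero, sub_zero, h2z] at this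
      exact this
  have h10 := hrec 0
  rw [hbase, if_pos rfl, ha0, h2z] at h10
  simp only [zero_add] at h10
  rw [h21] at h10
  have ha1 : a 1 = Real.pi * r := by
    field_simp at h10
    linarith
  rw [← ha1]
  simp [ha, sq]

/-- The choice `r = z - √(z² - 1)` gives `(r + r⁻¹) / 2 = z`. The value `z = 1`, which occurs when
an arc touches an endpoint of the interval, is integrated directly. -/
lemma integral_sin_sq_div {z : ℝ} (hz : 1 ≤ z) :
    ∫ θ in Icc 0 Real.pi, Real.sin θ ^ 2 / (z - Real.cos θ) = Real.pi * (z - √(z ^ 2 - 1)) := by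
  rw [integral_Icc_eq_integral_Ioo]
  rcases hz.eq_or_lt with rfl | hz
  · have : ∫ θ in Ioo 0 Real.pi, Real.sin θ ^ 2 / (1 - Real.cos θ) =
        ∫ θ in Ioo 0 Real.pi, (1 + Real.cos θ) := by
      refine setIntegral_congr_fun measurableSet_Ioo fun θ hθ => ?_
      have : Real.cos θ < 1 := by
        rw [← Real.cos_zero]
        exact Real.cos_lt_cos_of_nonneg_of_le_pi le_rfl hθ.2.le hθ.1
      have h1 : 1 - Real.cos θ ≠ 0 := by linarith
      rw [div_eq_iff h1, Real.sin_sq]; ring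
    rw [this, ← integral_Ioc_eq_integral_Ioo, ← intervalIntegral.integral_of_le Real.pi_pos.le,
      intervalIntegral.integral_add (by simp) (Continuous.intervalIntegrable (by fun_prop) _ _)]
    simp
  · have h1 : 0 < z ^ 2 - 1 := by nlinarith
    have hs := Real.sq_sqrt h1.le
    have hs0 := Real.sqrt_pos.2 h1
    set s := √(z ^ 2 - 1)
    have hsz : s < z := by nlinarith
    have hr : 0 < z - s := sub_pos.2 hsz
    have hr1 : z - s < 1 := by nlinarith
    have hinv : (z - s)⁻¹ = z + s := by
      refine inv_eq_of_mul_eq_one_right ?_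
      nlinarith
    have := integral_sin_sq_div_of_one_lt hr hr1
    rw [hinv, show (z - s + (z + s)) / 2 = z by ring] at this
    rw [← integral_Ioc_eq_integral_Ioo, ← intervalIntegral.integral_of_le Real.pi_pos.le, this]

lemma integral_sin_sq_div_add {z : ℝ} (hz : 1 ≤ z) :
    IntegrableOn (fun θ => Real.sin θ ^ 2 / (z + Real.cos θ)) (Icc 0 Real.pi) ∧
    ∫ θ in Icc 0 Real.pi, Real.sin θ ^ 2 / (z + Real.cos θ) = Real.pi * (z - √(z ^ 2 - 1)) := by
  have h := integrableOn_sin_sq_div hz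
  have hi := integral_sin_sq_div hz
  have e : ∀ θ, Real.sin θ ^ 2 / (z + Real.cos θ) =
      (fun θ => Real.sin θ ^ 2 / (z - Real.cos θ)) (Real.pi - θ) := fun θ => by
    simp [Real.sin_pi_sub, Real.cos_pi_sub]
  simp_rw [e]
  constructor
  · rw [integrableOn_Icc_iff_integrableOn_Ioc,
      ← intervalIntegrable_iff_integrableOn_Ioc_of_le Real.pi_pos.le] at h ⊢
    simpa using (h.comp_sub_left Real.pi).symm
  · rw [← hi, integral_Icc_eq_integral_Ioc, integral_Icc_eq_integral_Ioc,
      ← intervalIntegral.integral_of_le Real.pi_pos.le,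
      ← intervalIntegral.integral_of_le Real.pi_pos.le, intervalIntegral.integral_comp_sub_left
        (fun θ => Real.sin θ ^ 2 / (z - Real.cos θ))]
    simp

end

/-! ### Arc densities: moments of the semicircle, Marchenko-Pastur and free binomial distributions
-/

section

lemma measurable_arcDensity {c : ℝ → ℝ} (hc : Measurable c) (lm lp : ℝ) :
    Measurable (arcDensity lm lp c) := by
  refine Measurable.indicator ?_ measurableSet_Icc
  fun_prop

lemma image_arc (A : ℝ) {R : ℝ} (hR : 0 < R) :
    (fun θ => A + R * Real.cos θ) '' Icc 0 Real.pi = Icc (A - R) (A + R) := by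
  have : (fun θ => A + R * Real.cos θ) = (fun t => A + R * t) ∘ Real.cos := rfl
  rw [this, image_comp, Real.bijOn_cos.image_eq]
  ext x
  constructor
  · rintro ⟨t, ht, rfl⟩
    constructor <;> nlinarith [ht.1, ht.2]
  · intro hx
    refine ⟨(x - A) / R, ⟨?_, ?_⟩, ?_⟩
    · rw [le_div_iff₀ hR]; linarith [hx.1]
    · rw [div_le_iff₀ hR]; linarith [hx.2]
    · simp only
      rw [mul_div_cancel₀ _ hR.ne']; ring

/-- Integration against an arc density, in the angular variable. -/
lemma integral_arcDensity {A R : ℝ} (hR : 0 < R) {c : ℝ → ℝ} (hc : Measurable c)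
    (hc0 : ∀ x ∈ Icc (A - R) (A + R), 0 ≤ c x) (f : ℝ → ℝ) :
    (Integrable f (volume.withDensity (arcDensity (A - R) (A + R) c)) ↔
      IntegrableOn (fun θ => c (A + R * Real.cos θ) * (R * Real.sin θ) ^ 2 *
        f (A + R * Real.cos θ)) (Icc 0 Real.pi)) ∧
    ∫ x, f x ∂(volume.withDensity (arcDensity (A - R) (A + R) c)) =
      ∫ θ in Icc 0 Real.pi, c (A + R * Real.cos θ) * (R * Real.sin θ) ^ 2 *
        f (A + R * Real.cos θ) := by
  have hm := measurable_arcDensity hc (A - R) (A + R)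
  have hfin : ∀ᵐ x, arcDensity (A - R) (A + R) c x < ∞ := ae_of_all _ fun x => by
    unfold arcDensity indicator
    split_ifs <;> simp
  have hval : (fun x => (arcDensity (A - R) (A + R) c x).toReal • f x) =
      (Icc (A - R) (A + R)).indicator
        fun x => c x * √((x - (A - R)) * (A + R - x)) * f x := by
    ext x
    unfold arcDensity indicator
    split_ifs with h
    · rw [ENNReal.toReal_ofReal (mul_nonneg (hc0 x h) (Real.sqrt_nonneg _)), smul_eq_mul]
    · simp
  have hderiv : ∀ θ ∈ Icc 0 Real.pi, HasDerivWithinAt (fun θ => A + R * Real.cos θ)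
      (R * -Real.sin θ) (Icc 0 Real.pi) θ := fun θ _ =>
    (((Real.hasDerivAt_cos θ).const_mul R).const_add A).hasDerivWithinAt
  have hinj : InjOn (fun θ => A + R * Real.cos θ) (Icc 0 Real.pi) := fun x hx y hy h =>
    Real.injOn_cos hx hy (mul_left_cancel₀ hR.ne' (add_left_cancel h))
  have hcongr : ∀ θ ∈ Icc 0 Real.pi, |R * -Real.sin θ| • (c (A + R * Real.cos θ) *
      √((A + R * Real.cos θ - (A - R)) * (A + R - (A + R * Real.cos θ))) *
        f (A + R * Real.cos θ)) =
      c (A + R * Real.cos θ) * (R * Real.sin θ) ^ 2 * f (A + R * Real.cos θ) := fun θ hθ => by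
    -- Both the square root in the density and the Jacobian of the substitution equal `R sin θ`.
    have hs : 0 ≤ R * Real.sin θ := mul_nonneg hR.le (Real.sin_nonneg_of_mem_Icc hθ)
    have e : (A + R * Real.cos θ - (A - R)) * (A + R - (A + R * Real.cos θ)) =
        (R * Real.sin θ) ^ 2 := by
      rw [mul_pow, Real.sin_sq]; ring
    rw [e, Real.sqrt_sq hs, mul_neg, abs_neg, abs_of_nonneg hs, smul_eq_mul]; ring
  constructor
  · rw [integrable_withDensity_iff_integrable_smul' hm hfin, hval,
      integrable_indicator_iff measurableSet_Icc, ← image_arc A hR,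
      integrableOn_image_iff_integrableOn_abs_deriv_smul measurableSet_Icc hderiv hinj]
    exact integrableOn_congr_fun hcongr measurableSet_Icc
  · rw [integral_withDensity_eq_integral_toReal_smul hm hfin, hval,
      integral_indicator measurableSet_Icc, ← image_arc A hR,
      integral_image_eq_integral_abs_deriv_smul measurableSet_Icc hderiv hinj]
    exact setIntegral_congr_fun measurableSet_Icc hcongr

lemma integral_semicircle_pow (α : ℝ) {β : ℝ} (hβ : 0 < β) (n : ℕ) :
    ∫ x, x ^ n ∂(semicircle α β) = motzkin (fun _ => α) (fun _ => β) n 0 := by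
  have hR : 0 < 2 * √β := by positivity
  have hs := Real.sq_sqrt hβ.le
  rw [semicircle, (integral_arcDensity hR measurable_const
    (fun x _ => by positivity) (fun x => x ^ n)).2]
  have : ∀ θ : ℝ, 1 / (2 * Real.pi * β) * (2 * √β * Real.sin θ) ^ 2 *
      (α + 2 * √β * Real.cos θ) ^ n =
        2 / Real.pi * ((α + 2 * √β * Real.cos θ) ^ n * Real.sin θ ^ 2) := fun θ => by
    rw [mul_pow, mul_pow, hs]
    field_simp
  simp_rw [this]
  rw [integral_const_mul, integral_pow_mul_sin_sq α β hβ.le]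
  field_simp

/-- In a moment of positive order the atom at `0` is invisible and one power of `x` cancels the
denominator, leaving a semicircle integral. -/
lemma integral_marchenkoPastur_pow {z₁ z₂ : ℝ} (h₁ : 0 < z₁) (h₂ : 0 < z₂) (n : ℕ) :
    ∫ x, x ^ (n + 1) ∂(marchenkoPastur z₁ z₂) = halfMoment (alternating z₁ z₂) (n + 1) := by
  have hβ : 0 < z₁ * z₂ := mul_pos h₁ h₂
  have hR : 0 < 2 * √(z₁ * z₂) := by positivity
  have hs := Real.sq_sqrt hβ.le
  have hs1 := Real.sq_sqrt h₁.le
  have hs2 := Real.sq_sqrt h₂.le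
  have e1 : (√z₁ - √z₂) ^ 2 = z₁ + z₂ - 2 * √(z₁ * z₂) := by
    rw [Real.sqrt_mul h₁.le]; linear_combination hs1 + hs2
  have e2 : (√z₁ + √z₂) ^ 2 = z₁ + z₂ + 2 * √(z₁ * z₂) := by
    rw [Real.sqrt_mul h₁.le]; linear_combination hs1 + hs2
  have harc := integral_arcDensity (A := z₁ + z₂) hR
    (c := fun x => 1 / (2 * Real.pi * z₂ * x)) (by fun_prop)
    (fun x hx => by
      have : 0 ≤ x := (e1 ▸ sq_nonneg (√z₁ - √z₂)).trans hx.1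
      positivity) (fun x => x ^ (n + 1))
  have hcongr : ∀ θ ∈ Icc 0 Real.pi, 1 / (2 * Real.pi * z₂ * (z₁ + z₂ + 2 * √(z₁ * z₂) *
      Real.cos θ)) * (2 * √(z₁ * z₂) * Real.sin θ) ^ 2 *
        (z₁ + z₂ + 2 * √(z₁ * z₂) * Real.cos θ) ^ (n + 1) =
      2 / Real.pi * z₁ * ((z₁ + z₂ + 2 * √(z₁ * z₂) * Real.cos θ) ^ n * Real.sin θ ^ 2) := by
    intro θ hθ
    set u := z₁ + z₂ + 2 * √(z₁ * z₂) * Real.cos θ with hu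
    rw [mul_pow, mul_pow, hs]
    -- The denominator can vanish only where `cos θ = -1`; there `sin θ = 0`, and division by zero
    -- does no harm.
    rcases eq_or_ne u 0 with h0 | h0
    · have hsin : Real.sin θ = 0 := by
        have h1 : 2 * √(z₁ * z₂) ≤ z₁ + z₂ := by
          have := e1 ▸ sq_nonneg (√z₁ - √z₂); linarith
        have h2 : Real.cos θ = -1 := by
          refine le_antisymm ?_ (Real.neg_one_le_cos θ)
          by_contra hlt
          push Not at hlt
          nlinarith
        have h3 := Real.sin_sq_add_cos_sq θ
        rw [h2] at h3
        nlinarith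
      rw [hsin]; ring
    · field_simp
      ring
  rw [marchenkoPastur, e1, e2, integral_add_measure, integral_smul_measure, integral_dirac,
    harc.2, setIntegral_congr_fun measurableSet_Icc hcongr, integral_const_mul,
    integral_pow_mul_sin_sq _ _ hβ.le, halfMoment_alternating]
  · simp; field_simp
  · exact (integrable_dirac (by simp)).smul_measure ENNReal.ofReal_ne_top
  · rw [harc.1, integrableOn_congr_fun hcongr measurableSet_Icc]
    exact Continuous.integrableOn_Icc (by fun_prop)

/-! #### The free binomial distribution -/

section FreeBinomial

variable {p₁ p₂ : ℝ}

/-- The density of the free binomial distribution in the angular variable. -/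
def binomialKernel (p₁ p₂ θ : ℝ) : ℝ :=
  2 * (p₁ * (1 - p₂) * (p₂ * (1 - p₁))) / (Real.pi * p₂) * (Real.sin θ ^ 2 /
    ((p₁ * (1 - p₂) + p₂ * (1 - p₁) + 2 * √(p₁ * (1 - p₂) * (p₂ * (1 - p₁))) * Real.cos θ) *
    (1 - (p₁ * (1 - p₂) + p₂ * (1 - p₁) + 2 * √(p₁ * (1 - p₂) * (p₂ * (1 - p₁))) * Real.cos θ))))

/-- The position on the unit interval as a function of the angular variable. -/
def binomialAngle (p₁ p₂ θ : ℝ) : ℝ :=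
  p₁ * (1 - p₂) + p₂ * (1 - p₁) + 2 * √(p₁ * (1 - p₂) * (p₂ * (1 - p₁))) * Real.cos θ

lemma binomialKernel_eq (p₁ p₂ θ : ℝ) : binomialKernel p₁ p₂ θ =
    2 * (p₁ * (1 - p₂) * (p₂ * (1 - p₁))) / (Real.pi * p₂) * (Real.sin θ ^ 2 /
      (binomialAngle p₁ p₂ θ * (1 - binomialAngle p₁ p₂ θ))) := rfl

lemma binomial_product_pos (h₁ : p₁ ∈ Ioo (0 : ℝ) 1) (h₂ : p₂ ∈ Ioo (0 : ℝ) 1) :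
    0 < p₁ * (1 - p₂) * (p₂ * (1 - p₁)) :=
  mul_pos (mul_pos h₁.1 (sub_pos.2 h₂.2)) (mul_pos h₂.1 (sub_pos.2 h₁.2))

/-- Equivalent to the left end of the arc being nonnegative; squaring reduces it to the discriminant
`(p₁ - p₂)²`. -/
lemma binomial_left_ratio (h₁ : p₁ ∈ Ioo (0 : ℝ) 1) (h₂ : p₂ ∈ Ioo (0 : ℝ) 1) :
    1 ≤ (p₁ * (1 - p₂) + p₂ * (1 - p₁)) / (2 * √(p₁ * (1 - p₂) * (p₂ * (1 - p₁)))) := by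
  have hβ := binomial_product_pos h₁ h₂
  have hs := Real.sq_sqrt hβ.le
  have hR := Real.sqrt_pos.2 hβ
  have hα : 0 < p₁ * (1 - p₂) + p₂ * (1 - p₁) :=
    add_pos (mul_pos h₁.1 (sub_pos.2 h₂.2)) (mul_pos h₂.1 (sub_pos.2 h₁.2))
  rw [le_div_iff₀ (by positivity), one_mul]
  refine abs_le_of_sq_le_sq' ?_ hα.le |>.2
  rw [mul_pow, hs]
  nlinarith [sq_nonneg (p₁ - p₂)]

lemma binomial_right_ratio (h₁ : p₁ ∈ Ioo (0 : ℝ) 1) (h₂ : p₂ ∈ Ioo (0 : ℝ) 1) :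
    1 ≤ (1 - (p₁ * (1 - p₂) + p₂ * (1 - p₁))) / (2 * √(p₁ * (1 - p₂) * (p₂ * (1 - p₁)))) := by
  have hβ := binomial_product_pos h₁ h₂
  have hs := Real.sq_sqrt hβ.le
  have hR := Real.sqrt_pos.2 hβ
  have hα : 0 < 1 - (p₁ * (1 - p₂) + p₂ * (1 - p₁)) := by
    nlinarith [mul_pos h₁.1 h₂.1, mul_pos (sub_pos.2 h₁.2) (sub_pos.2 h₂.2)]
  rw [le_div_iff₀ (by positivity), one_mul]
  refine abs_le_of_sq_le_sq' ?_ hα.le |>.2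
  rw [mul_pow, hs]
  nlinarith [sq_nonneg (1 - p₁ - p₂)]

lemma binomialAngle_eq_left (h₁ : p₁ ∈ Ioo (0 : ℝ) 1) (h₂ : p₂ ∈ Ioo (0 : ℝ) 1) (θ : ℝ) :
    binomialAngle p₁ p₂ θ = 2 * √(p₁ * (1 - p₂) * (p₂ * (1 - p₁))) *
      ((p₁ * (1 - p₂) + p₂ * (1 - p₁)) / (2 * √(p₁ * (1 - p₂) * (p₂ * (1 - p₁)))) +
        Real.cos θ) := by
  have hR := Real.sqrt_pos.2 (binomial_product_pos h₁ h₂)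
  rw [mul_add, mul_div_cancel₀ _ (by positivity), binomialAngle]

lemma one_sub_binomialAngle_eq (h₁ : p₁ ∈ Ioo (0 : ℝ) 1) (h₂ : p₂ ∈ Ioo (0 : ℝ) 1) (θ : ℝ) :
    1 - binomialAngle p₁ p₂ θ = 2 * √(p₁ * (1 - p₂) * (p₂ * (1 - p₁))) *
      ((1 - (p₁ * (1 - p₂) + p₂ * (1 - p₁))) / (2 * √(p₁ * (1 - p₂) * (p₂ * (1 - p₁)))) -
        Real.cos θ) := by
  have hR := Real.sqrt_pos.2 (binomial_product_pos h₁ h₂)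
  rw [mul_sub, mul_div_cancel₀ _ (by positivity), binomialAngle]; ring

lemma sin_sq_eq_zero_of_add {z θ : ℝ} (hz : 1 ≤ z) (h : z + Real.cos θ = 0) :
    Real.sin θ ^ 2 = 0 := by
  have : Real.cos θ = -1 := by linarith [Real.neg_one_le_cos θ]
  rw [Real.sin_sq, this]; norm_num

lemma sin_sq_eq_zero_of_sub {z θ : ℝ} (hz : 1 ≤ z) (h : z - Real.cos θ = 0) :
    Real.sin θ ^ 2 = 0 := by
  have : Real.cos θ = 1 := by linarith [Real.cos_le_one θ]
  rw [Real.sin_sq, this]; norm_num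

/-- At an endpoint of the unit interval the numerator of the kernel vanishes too, so cancellations
remain valid with the convention `x / 0 = 0`. -/
lemma sin_sq_of_binomialAngle_eq_zero (h₁ : p₁ ∈ Ioo (0 : ℝ) 1) (h₂ : p₂ ∈ Ioo (0 : ℝ) 1) {θ : ℝ}
    (h : binomialAngle p₁ p₂ θ = 0) : Real.sin θ ^ 2 = 0 := by
  have hR := Real.sqrt_pos.2 (binomial_product_pos h₁ h₂)
  rw [binomialAngle_eq_left h₁ h₂, mul_eq_zero] at h
  exact sin_sq_eq_zero_of_add (binomial_left_ratio h₁ h₂) (h.resolve_left (by positivity))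

lemma sin_sq_of_binomialAngle_eq_one (h₁ : p₁ ∈ Ioo (0 : ℝ) 1) (h₂ : p₂ ∈ Ioo (0 : ℝ) 1) {θ : ℝ}
    (h : 1 - binomialAngle p₁ p₂ θ = 0) : Real.sin θ ^ 2 = 0 := by
  have hR := Real.sqrt_pos.2 (binomial_product_pos h₁ h₂)
  rw [one_sub_binomialAngle_eq h₁ h₂, mul_eq_zero] at h
  exact sin_sq_eq_zero_of_sub (binomial_right_ratio h₁ h₂) (h.resolve_left (by positivity))

lemma binomialAngle_mem (h₁ : p₁ ∈ Ioo (0 : ℝ) 1) (h₂ : p₂ ∈ Ioo (0 : ℝ) 1) (θ : ℝ) :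
    binomialAngle p₁ p₂ θ ∈ Icc (0 : ℝ) 1 := by
  have hR := Real.sqrt_pos.2 (binomial_product_pos h₁ h₂)
  constructor
  · rw [binomialAngle_eq_left h₁ h₂]
    exact mul_nonneg (by positivity)
      (by linarith [binomial_left_ratio h₁ h₂, Real.neg_one_le_cos θ])
  · rw [← sub_nonneg, one_sub_binomialAngle_eq h₁ h₂]
    exact mul_nonneg (by positivity)
      (by linarith [binomial_right_ratio h₁ h₂, Real.cos_le_one θ])

lemma continuous_binomialAngle : Continuous (binomialAngle p₁ p₂) := by
  unfold binomialAngle; fun_prop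

/-- The part of the kernel that is singular at the left endpoint. -/
lemma integral_binomial_left (h₁ : p₁ ∈ Ioo (0 : ℝ) 1) (h₂ : p₂ ∈ Ioo (0 : ℝ) 1) :
    IntegrableOn (fun θ => 2 * (p₁ * (1 - p₂) * (p₂ * (1 - p₁))) / (Real.pi * p₂) *
      (Real.sin θ ^ 2 / binomialAngle p₁ p₂ θ)) (Icc 0 Real.pi) ∧
    ∫ θ in Icc 0 Real.pi, 2 * (p₁ * (1 - p₂) * (p₂ * (1 - p₁))) / (Real.pi * p₂) *
      (Real.sin θ ^ 2 / binomialAngle p₁ p₂ θ) =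
        (p₁ * (1 - p₂) + p₂ * (1 - p₁) - |p₁ - p₂|) / (2 * p₂) := by
  have hβ := binomial_product_pos h₁ h₂
  have hs := Real.sq_sqrt hβ.le
  have hR := Real.sqrt_pos.2 hβ
  have hz := binomial_left_ratio h₁ h₂
  have hp := h₂.1
  set α := p₁ * (1 - p₂) + p₂ * (1 - p₁) with hα
  have hdisc : α ^ 2 - 4 * (p₁ * (1 - p₂) * (p₂ * (1 - p₁))) = (p₁ - p₂) ^ 2 := by
    rw [hα]; ring
  have e := binomialAngle_eq_left h₁ h₂
  rw [← hα] at e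
  set s := √(p₁ * (1 - p₂) * (p₂ * (1 - p₁)))
  set z := α / (2 * s) with hzdef
  -- The absolute value arises here; it is what the positive part in the mass of the atom
  -- compensates.
  have hsq : √(z ^ 2 - 1) = |p₁ - p₂| / (2 * s) := by
    rw [← abs_of_pos (show 0 < 2 * s by positivity), ← abs_div, ← Real.sqrt_sq_eq_abs, hzdef]
    congr 1
    rw [div_pow, div_pow, ← hdisc, ← hs]
    field_simp
    ring
  have hfun : ∀ θ, 2 * (p₁ * (1 - p₂) * (p₂ * (1 - p₁))) / (Real.pi * p₂) *
      (Real.sin θ ^ 2 / binomialAngle p₁ p₂ θ) =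
        s / (Real.pi * p₂) * (Real.sin θ ^ 2 / (z + Real.cos θ)) := fun θ => by
    rw [e, ← hs, div_mul_eq_div_div]
    field_simp
  obtain ⟨hi, hI⟩ := integral_sin_sq_div_add hz
  simp_rw [hfun]
  refine ⟨hi.const_mul _, ?_⟩
  rw [integral_const_mul, hI, hsq, hzdef]
  field_simp

/-- The part of the kernel that is singular at the right endpoint. -/
lemma integral_binomial_right (h₁ : p₁ ∈ Ioo (0 : ℝ) 1) (h₂ : p₂ ∈ Ioo (0 : ℝ) 1) :
    IntegrableOn (fun θ => 2 * (p₁ * (1 - p₂) * (p₂ * (1 - p₁))) / (Real.pi * p₂) *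
      (Real.sin θ ^ 2 / (1 - binomialAngle p₁ p₂ θ))) (Icc 0 Real.pi) ∧
    ∫ θ in Icc 0 Real.pi, 2 * (p₁ * (1 - p₂) * (p₂ * (1 - p₁))) / (Real.pi * p₂) *
      (Real.sin θ ^ 2 / (1 - binomialAngle p₁ p₂ θ)) =
        (1 - (p₁ * (1 - p₂) + p₂ * (1 - p₁)) - |1 - p₁ - p₂|) / (2 * p₂) := by
  have hβ := binomial_product_pos h₁ h₂
  have hs := Real.sq_sqrt hβ.le
  have hR := Real.sqrt_pos.2 hβ
  have hz := binomial_right_ratio h₁ h₂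
  have hp := h₂.1
  set α := 1 - (p₁ * (1 - p₂) + p₂ * (1 - p₁)) with hα
  have hdisc : α ^ 2 - 4 * (p₁ * (1 - p₂) * (p₂ * (1 - p₁))) = (1 - p₁ - p₂) ^ 2 := by
    rw [hα]; ring
  have e := one_sub_binomialAngle_eq h₁ h₂
  rw [← hα] at e
  set s := √(p₁ * (1 - p₂) * (p₂ * (1 - p₁)))
  set z := α / (2 * s) with hzdef
  have hsq : √(z ^ 2 - 1) = |1 - p₁ - p₂| / (2 * s) := by
    rw [← abs_of_pos (show 0 < 2 * s by positivity), ← abs_div, ← Real.sqrt_sq_eq_abs, hzdef]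
    congr 1
    rw [div_pow, div_pow, ← hdisc, ← hs]
    field_simp
    ring
  have hfun : ∀ θ, 2 * (p₁ * (1 - p₂) * (p₂ * (1 - p₁))) / (Real.pi * p₂) *
      (Real.sin θ ^ 2 / (1 - binomialAngle p₁ p₂ θ)) =
        s / (Real.pi * p₂) * (Real.sin θ ^ 2 / (z - Real.cos θ)) := fun θ => by
    rw [e, ← hs, div_mul_eq_div_div]
    field_simp
  simp_rw [hfun]
  refine ⟨(integrableOn_sin_sq_div hz).const_mul _, ?_⟩
  rw [integral_const_mul, integral_sin_sq_div hz, hsq, hzdef]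
  field_simp

lemma binomialKernel_mul_angle (h₁ : p₁ ∈ Ioo (0 : ℝ) 1) (h₂ : p₂ ∈ Ioo (0 : ℝ) 1) (θ : ℝ) :
    binomialKernel p₁ p₂ θ * binomialAngle p₁ p₂ θ =
      2 * (p₁ * (1 - p₂) * (p₂ * (1 - p₁))) / (Real.pi * p₂) *
        (Real.sin θ ^ 2 / (1 - binomialAngle p₁ p₂ θ)) := by
  rw [binomialKernel_eq]
  rcases eq_or_ne (binomialAngle p₁ p₂ θ) 0 with h | h
  · rw [sin_sq_of_binomialAngle_eq_zero h₁ h₂ h]; simp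
  · rw [div_mul_eq_div_div _ (binomialAngle p₁ p₂ θ), mul_assoc, div_right_comm, div_mul_cancel₀ _ h]

lemma binomialKernel_mul_one_sub (h₁ : p₁ ∈ Ioo (0 : ℝ) 1) (h₂ : p₂ ∈ Ioo (0 : ℝ) 1) (θ : ℝ) :
    binomialKernel p₁ p₂ θ * (1 - binomialAngle p₁ p₂ θ) =
      2 * (p₁ * (1 - p₂) * (p₂ * (1 - p₁))) / (Real.pi * p₂) *
        (Real.sin θ ^ 2 / binomialAngle p₁ p₂ θ) := by
  rw [binomialKernel_eq]
  rcases eq_or_ne (1 - binomialAngle p₁ p₂ θ) 0 with h | h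
  · rw [sin_sq_of_binomialAngle_eq_one h₁ h₂ h]; simp
  · rw [div_mul_eq_div_div _ (binomialAngle p₁ p₂ θ), mul_assoc, div_mul_cancel₀ _ h]

/-- Writing `1 = (1 - x) + x` separates the two possible endpoint singularities. -/
lemma integrableOn_binomialKernel (h₁ : p₁ ∈ Ioo (0 : ℝ) 1) (h₂ : p₂ ∈ Ioo (0 : ℝ) 1) :
    IntegrableOn (binomialKernel p₁ p₂) (Icc 0 Real.pi) := by
  have e : binomialKernel p₁ p₂ = fun θ =>
      binomialKernel p₁ p₂ θ * (1 - binomialAngle p₁ p₂ θ) +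
        binomialKernel p₁ p₂ θ * binomialAngle p₁ p₂ θ := by
    ext θ; ring
  rw [e]
  simp_rw [binomialKernel_mul_angle h₁ h₂, binomialKernel_mul_one_sub h₁ h₂]
  exact (integral_binomial_left h₁ h₂).1.add (integral_binomial_right h₁ h₂).1

/-- Integration against the free binomial distribution, in the angular variable. -/
lemma integral_freeBinomial (h₁ : p₁ ∈ Ioo (0 : ℝ) 1) (h₂ : p₂ ∈ Ioo (0 : ℝ) 1) {a b : ℝ}
    (hab : a < b) {f : ℝ → ℝ} (hf : Continuous f) :
    Integrable f (freeBinomial a b p₁ p₂) ∧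
    ∫ x, f x ∂(freeBinomial a b p₁ p₂) =
      (∫ θ in Icc 0 Real.pi, binomialKernel p₁ p₂ θ * f (a + (b - a) * binomialAngle p₁ p₂ θ)) +
        max (1 - p₁ / p₂) 0 * f a + max ((p₁ + p₂ - 1) / p₂) 0 * f b := by
  have hβ := binomial_product_pos h₁ h₂
  have hs := Real.sq_sqrt hβ.le
  have hab' : 0 < b - a := sub_pos.2 hab
  have q₁ : 0 < 1 - p₁ := sub_pos.2 h₁.2
  have q₂ : 0 < 1 - p₂ := sub_pos.2 h₂.2
  have hp₁ := h₁.1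
  have hp₂ := h₂.1
  have hR : 0 < (b - a) * (2 * √(p₁ * (1 - p₂) * (p₂ * (1 - p₁)))) := by positivity
  have hs1 := Real.sq_sqrt (show 0 ≤ p₁ * (1 - p₂) by positivity)
  have hs2 := Real.sq_sqrt (show 0 ≤ p₂ * (1 - p₁) by positivity)
  have hsm := Real.sqrt_mul (show 0 ≤ p₁ * (1 - p₂) by positivity) (p₂ * (1 - p₁))
  have e1 : a + (b - a) * (√(p₁ * (1 - p₂)) - √(p₂ * (1 - p₁))) ^ 2 =
      a + (b - a) * (p₁ * (1 - p₂) + p₂ * (1 - p₁)) -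
        (b - a) * (2 * √(p₁ * (1 - p₂) * (p₂ * (1 - p₁)))) := by
    rw [hsm]; linear_combination (b - a) * hs1 + (b - a) * hs2
  have e2 : a + (b - a) * (√(p₁ * (1 - p₂)) + √(p₂ * (1 - p₁))) ^ 2 =
      a + (b - a) * (p₁ * (1 - p₂) + p₂ * (1 - p₁)) +
        (b - a) * (2 * √(p₁ * (1 - p₂) * (p₂ * (1 - p₁)))) := by
    rw [hsm]; linear_combination (b - a) * hs1 + (b - a) * hs2
  have hang : ∀ θ, a + (b - a) * (p₁ * (1 - p₂) + p₂ * (1 - p₁)) +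
      (b - a) * (2 * √(p₁ * (1 - p₂) * (p₂ * (1 - p₁)))) * Real.cos θ =
        a + (b - a) * binomialAngle p₁ p₂ θ := fun θ => by rw [binomialAngle]; ring
  have harc := integral_arcDensity (A := a + (b - a) * (p₁ * (1 - p₂) + p₂ * (1 - p₁))) hR
    (c := fun x => 1 / (2 * Real.pi * p₂ * (x - a) * (b - x))) (by fun_prop)
    (fun x hx => by
      rw [← image_arc _ hR] at hx
      obtain ⟨θ, -, rfl⟩ := hx
      simp only [hang]
      have hm := binomialAngle_mem h₁ h₂ θ
      have n1 : 0 ≤ a + (b - a) * binomialAngle p₁ p₂ θ - a := by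
        have := mul_nonneg hab'.le hm.1; linarith
      have n2 : 0 ≤ b - (a + (b - a) * binomialAngle p₁ p₂ θ) := by
        have := mul_nonneg hab'.le (sub_nonneg.2 hm.2); linarith
      positivity) f
  have hcongr : ∀ θ ∈ Icc 0 Real.pi, 1 / (2 * Real.pi * p₂ *
      (a + (b - a) * binomialAngle p₁ p₂ θ - a) * (b - (a + (b - a) * binomialAngle p₁ p₂ θ))) *
      ((b - a) * (2 * √(p₁ * (1 - p₂) * (p₂ * (1 - p₁)))) * Real.sin θ) ^ 2 *
        f (a + (b - a) * binomialAngle p₁ p₂ θ) =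
      binomialKernel p₁ p₂ θ * f (a + (b - a) * binomialAngle p₁ p₂ θ) := by
    intro θ _
    rw [binomialKernel_eq, show a + (b - a) * binomialAngle p₁ p₂ θ - a =
      (b - a) * binomialAngle p₁ p₂ θ by ring, show b - (a + (b - a) * binomialAngle p₁ p₂ θ) =
      (b - a) * (1 - binomialAngle p₁ p₂ θ) by ring, mul_pow, mul_pow, mul_pow, hs]
    congr 1
    rcases eq_or_ne (binomialAngle p₁ p₂ θ) 0 with h | h
    · rw [sin_sq_of_binomialAngle_eq_zero h₁ h₂ h]; simp
    rcases eq_or_ne (1 - binomialAngle p₁ p₂ θ) 0 with h' | h'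
    · rw [sin_sq_of_binomialAngle_eq_one h₁ h₂ h']; simp
    field_simp
  have hint : IntegrableOn (fun θ => binomialKernel p₁ p₂ θ *
      f (a + (b - a) * binomialAngle p₁ p₂ θ)) (Icc 0 Real.pi) :=
    (integrableOn_binomialKernel h₁ h₂).mul_continuousOn
      (hf.comp (continuous_const.add (continuous_const.mul continuous_binomialAngle))).continuousOn
      isCompact_Icc
  simp only [hang] at harc
  have hac : Integrable f (volume.withDensity (arcDensity
      (a + (b - a) * (√(p₁ * (1 - p₂)) - √(p₂ * (1 - p₁))) ^ 2)
      (a + (b - a) * (√(p₁ * (1 - p₂)) + √(p₂ * (1 - p₁))) ^ 2)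
        fun x => 1 / (2 * Real.pi * p₂ * (x - a) * (b - x)))) := by
    rw [e1, e2, harc.1, integrableOn_congr_fun hcongr measurableSet_Icc]
    exact hint
  have hda : Integrable f (ENNReal.ofReal (1 - p₁ / p₂) • Measure.dirac a) :=
    (integrable_dirac (by simp)).smul_measure ENNReal.ofReal_ne_top
  have hdb : Integrable f (ENNReal.ofReal ((p₁ + p₂ - 1) / p₂) • Measure.dirac b) :=
    (integrable_dirac (by simp)).smul_measure ENNReal.ofReal_ne_top
  refine ⟨(hac.add_measure hda).add_measure hdb, ?_⟩
  rw [freeBinomial, integral_add_measure (hac.add_measure hda) hdb, integral_add_measure hac hda,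
    integral_smul_measure, integral_smul_measure, integral_dirac, integral_dirac, e1, e2, harc.2,
    setIntegral_congr_fun measurableSet_Icc hcongr, ENNReal.toReal_ofReal', ENNReal.toReal_ofReal',
    smul_eq_mul, smul_eq_mul]

/-- The mean and the mass are computed from the two one-sided integrals, where the absolute values
combine with the positive parts of the atoms. All further moments follow from the differences
`m_{n+1} - m_{n+2} = ∫ x^{n+1} (1 - x)`, in which both atoms vanish and the kernel becomes a
semicircle density. -/
lemma integral_freeBinomial_unit_pow (h₁ : p₁ ∈ Ioo (0 : ℝ) 1) (h₂ : p₂ ∈ Ioo (0 : ℝ) 1)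
    (n : ℕ) : ∫ x, x ^ n ∂(freeBinomial 0 1 p₁ p₂) =
      halfMoment (zetaParam (alternating p₁ p₂)) n := by
  have hp₂ := h₂.1
  have hβ := binomial_product_pos h₁ h₂
  have hI := fun n : ℕ => (integral_freeBinomial h₁ h₂ zero_lt_one (continuous_pow n))
  simp only [sub_zero, one_mul, zero_add, one_pow, mul_one] at hI
  have hm1 : ∫ x, x ^ 1 ∂(freeBinomial 0 1 p₁ p₂) = p₁ := by
    rw [(hI 1).2]
    simp_rw [pow_one, binomialKernel_mul_angle h₁ h₂]
    rw [(integral_binomial_right h₁ h₂).2, mul_zero, add_zero]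
    rcases le_total 0 (1 - p₁ - p₂) with h | h
    · rw [abs_of_nonneg h, max_eq_right (div_nonpos_of_nonpos_of_nonneg (by linarith) hp₂.le)]
      field_simp; ring
    · rw [abs_of_nonpos h, max_eq_left (div_nonneg (by linarith) hp₂.le)]
      field_simp; ring
  have hsub : ∀ n : ℕ, ∫ x, x ^ n * (1 - x) ∂(freeBinomial 0 1 p₁ p₂) =
      ∫ x, x ^ n ∂(freeBinomial 0 1 p₁ p₂) - ∫ x, x ^ (n + 1) ∂(freeBinomial 0 1 p₁ p₂) :=
    fun n => by
      rw [← integral_sub (hI n).1 (hI (n + 1)).1]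
      exact integral_congr_ae (ae_of_all _ fun x => by ring)
  have hm0 : ∫ x, x ^ 0 ∂(freeBinomial 0 1 p₁ p₂) = 1 := by
    have h := hsub 0
    rw [zero_add, hm1, (integral_freeBinomial h₁ h₂ zero_lt_one (by fun_prop)).2] at h
    simp only [sub_zero, one_mul, zero_add, pow_zero, mul_one, sub_self, mul_zero, add_zero,
      binomialKernel_mul_one_sub h₁ h₂] at h
    rw [(integral_binomial_left h₁ h₂).2] at h
    have h3 : (p₁ * (1 - p₂) + p₂ * (1 - p₁) - |p₁ - p₂|) / (2 * p₂) + max (1 - p₁ / p₂) 0 =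
        1 - p₁ := by
      rcases le_total p₁ p₂ with h | h
      · rw [abs_of_nonpos (sub_nonpos.2 h), max_eq_left (sub_nonneg.2 ((div_le_one hp₂).2 h))]
        field_simp; ring
      · rw [abs_of_nonneg (sub_nonneg.2 h), max_eq_right (sub_nonpos.2 ((one_le_div hp₂).2 h))]
        field_simp; ring
    simp only [pow_zero] at h ⊢
    linarith
  have hstep : ∀ n : ℕ, ∫ x, x ^ (n + 1) ∂(freeBinomial 0 1 p₁ p₂) -
      ∫ x, x ^ (n + 2) ∂(freeBinomial 0 1 p₁ p₂) = p₁ * (1 - p₁) * (1 - p₂) *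
        motzkin (fun _ => p₁ * (1 - p₂) + p₂ * (1 - p₁))
          (fun _ => p₁ * (1 - p₂) * (p₂ * (1 - p₁))) n 0 := fun n => by
    rw [← hsub (n + 1), (integral_freeBinomial h₁ h₂ zero_lt_one (by fun_prop)).2]
    have : ∀ θ, binomialKernel p₁ p₂ θ * ((0 + (1 - 0) * binomialAngle p₁ p₂ θ) ^ (n + 1) *
        (1 - (0 + (1 - 0) * binomialAngle p₁ p₂ θ))) =
        2 * (p₁ * (1 - p₂) * (p₂ * (1 - p₁))) / (Real.pi * p₂) * ((p₁ * (1 - p₂) + p₂ * (1 - p₁) +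
          2 * √(p₁ * (1 - p₂) * (p₂ * (1 - p₁))) * Real.cos θ) ^ n * Real.sin θ ^ 2) := fun θ => by
      rw [← binomialAngle, sub_zero, one_mul, zero_add]
      calc _ = binomialKernel p₁ p₂ θ * (1 - binomialAngle p₁ p₂ θ) *
            binomialAngle p₁ p₂ θ ^ (n + 1) := by ring
        _ = _ := by
          rw [binomialKernel_mul_one_sub h₁ h₂]
          rcases eq_or_ne (binomialAngle p₁ p₂ θ) 0 with h | h
          · rw [sin_sq_of_binomialAngle_eq_zero h₁ h₂ h]; simp
          · field_simp
            ring
    simp_rw [this]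
    rw [integral_const_mul, integral_pow_mul_sin_sq _ _ hβ.le]
    simp
    field_simp
  rcases n with _ | n
  · rw [hm0, halfMoment_zero]
  · induction n with
    | zero =>
      rw [zero_add, hm1, unitMoment_alternating_succ p₁ p₂ 0]
      simp [motzkin]
    | succ n ih =>
      have h1 := hstep n
      have h2 := unitMoment_alternating_sub p₁ p₂ n
      rw [ih] at h1
      linarith

lemma integral_freeBinomial_pow (h₁ : p₁ ∈ Ioo (0 : ℝ) 1) (h₂ : p₂ ∈ Ioo (0 : ℝ) 1) {a b : ℝ}
    (hab : a < b) (n : ℕ) : ∫ x, x ^ n ∂(freeBinomial a b p₁ p₂) =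
      (SupportInterval.compact a b).mom (alternating p₁ p₂) n := by
  have h := (integral_freeBinomial h₁ h₂ zero_lt_one (affinePoly a b ^ n).continuous)
  have e : (fun n => ∫ x, x ^ n ∂(freeBinomial 0 1 p₁ p₂)) =
      halfMoment (zetaParam (alternating p₁ p₂)) :=
    funext fun n => integral_freeBinomial_unit_pow h₁ h₂ n
  rw [SupportInterval.mom, ← e, seqFunctional_integral fun j =>
    (integral_freeBinomial h₁ h₂ zero_lt_one (continuous_pow j)).1, h.2,
    (integral_freeBinomial h₁ h₂ hab (continuous_pow n)).2]
  simp [affinePoly]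

end FreeBinomial

/-- The limiting moments have alternating coordinates. -/
lemma SupportInterval.Proper.limitMoments_eq {E : SupportInterval} (hE : E.Proper) {y₁ y₂ : ℝ}
    (h₁ : y₁ ∈ E.oddRange) (h₂ : y₂ ∈ E.evenRange) (k : ℕ) :
    E.limitMoments y₁ y₂ k = E.psi k fun i => alternating y₁ y₂ i := by
  ext i
  have : E.psi k (fun i => alternating y₁ y₂ i) i = E.mom (alternating y₁ y₂) (i + 1) :=
    E.mom_congr (i := k) (fun l hl => by rw [extendZero_of_lt _ hl]) _ i.2
  rw [this]
  cases E with
  | compact a b => exact integral_freeBinomial_pow h₁ h₂ (hE a b rfl) _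
  | halfLine => exact integral_marchenkoPastur_pow h₁ h₂ _
  | line =>
    refine (integral_semicircle_pow y₁ h₂ _).trans ?_
    simp [SupportInterval.mom, lineMoment, alternating]

end

section

/-! ### Product measures with densities -/

lemma lintegral_fin_prod {n : ℕ} {f : Fin n → ℝ → ℝ≥0∞} (hf : ∀ i, Measurable (f i)) :
    ∫⁻ y : Fin n → ℝ, ∏ i, f i (y i) = ∏ i, ∫⁻ t, f i t := by
  induction n with
  | zero => simp [volume_pi]
  | succ n ih =>
    have hm : Measurable fun y : Fin n → ℝ => ∏ i, f i.succ (y i) :=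
      Finset.measurable_prod _ fun i _ => (hf _).comp (measurable_pi_apply i)
    rw [← ((volume_preserving_piFinSuccAbove (fun _ => ℝ) 0).symm _).lintegral_comp_emb
      (MeasurableEquiv.measurableEmbedding _), Fin.prod_univ_succ,
      ← ih fun i => hf i.succ, Measure.volume_eq_prod,
      ← lintegral_prod_mul (hf 0).aemeasurable hm.aemeasurable]
    refine lintegral_congr fun z => ?_
    simp [MeasurableEquiv.piFinSuccAbove, Fin.prod_univ_succ, Fin.insertNthEquiv]

lemma pi_withDensity {n : ℕ} {f : Fin n → ℝ → ℝ≥0∞} (hf : ∀ i, Measurable (f i))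
    (hfin : ∀ i t, f i t ≠ ∞) : Measure.pi (fun i => volume.withDensity (f i)) =
      volume.withDensity fun y : Fin n → ℝ => ∏ i, f i (y i) := by
  have : ∀ i, SigmaFinite (volume.withDensity (f i)) := fun i =>
    SigmaFinite.withDensity_of_ne_top (ae_of_all _ (hfin i))
  refine Measure.pi_eq fun s hs => ?_
  rw [withDensity_apply _ (MeasurableSet.univ_pi hs), ← lintegral_indicator (MeasurableSet.univ_pi hs)]
  have h1 : ∀ y : Fin n → ℝ, (Set.univ.pi s).indicator (fun y => ∏ i, f i (y i)) y =
      ∏ i, (s i).indicator (f i) (y i) := fun y => by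
    by_cases hy : y ∈ Set.univ.pi s
    · rw [indicator_of_mem hy]
      exact Finset.prod_congr rfl fun i _ => by rw [indicator_of_mem (hy i (mem_univ i))]
    · rw [indicator_of_notMem hy]
      simp only [Set.mem_pi, mem_univ, true_implies, not_forall] at hy
      obtain ⟨i, hi⟩ := hy
      exact (Finset.prod_eq_zero (Finset.mem_univ i) (indicator_of_notMem hi _)).symm
  simp_rw [h1]
  rw [lintegral_fin_prod fun i => (hf i).indicator (hs i)]
  refine Finset.prod_congr rfl fun i _ => ?_
  rw [withDensity_apply _ (hs i), lintegral_indicator (hs i)]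

/-- The first coordinates under a product measure. -/
lemma pi_preimage_castAdd {k r : ℕ} (ρ : Fin (k + r) → Measure ℝ) [∀ i, SigmaFinite (ρ i)]
    (h0 : ∀ i, ρ i univ ≠ 0) (h1 : ∀ i, ρ i univ ≠ ∞) {A : Set (Fin k → ℝ)}
    (hA : MeasurableSet A) :
    Measure.pi ρ {y | (fun i => y (Fin.castAdd r i)) ∈ A} =
      (∏ j, ρ (Fin.natAdd k j) univ) * Measure.pi (fun i => ρ (Fin.castAdd r i)) A := by
  set c := ∏ j, ρ (Fin.natAdd k j) univ with hc
  have hc0 : c ≠ 0 := Finset.prod_ne_zero_iff.2 fun j _ => h0 _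
  have hc1 : c ≠ ∞ := ENNReal.prod_ne_top fun j _ => h1 _
  have hm : Measurable fun (y : Fin (k + r) → ℝ) (i : Fin k) => y (Fin.castAdd r i) := by
    fun_prop
  have key : Measure.pi (fun i => ρ (Fin.castAdd r i)) =
      c⁻¹ • (Measure.pi ρ).map fun y i => y (Fin.castAdd r i) := by
    refine Measure.pi_eq fun s hs => ?_
    rw [Measure.smul_apply, Measure.map_apply hm (MeasurableSet.univ_pi hs)]
    have : (fun (y : Fin (k + r) → ℝ) (i : Fin k) => y (Fin.castAdd r i)) ⁻¹' Set.univ.pi s =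
        Set.univ.pi (Fin.addCases (motive := fun _ => Set ℝ) s fun _ => univ) := by
      ext y
      simp only [mem_preimage, Set.mem_pi, mem_univ, true_implies]
      constructor
      · intro h i
        refine Fin.addCases (fun i => ?_) (fun j => ?_) i
        · simpa using h i
        · simp
      · intro h i
        simpa using h (Fin.castAdd r i)
    rw [this, Measure.pi_pi, Fin.prod_univ_add]
    simp only [Fin.addCases_left, Fin.addCases_right, ← hc, smul_eq_mul]
    rw [mul_comm (∏ i, _) c, ← mul_assoc, ENNReal.inv_mul_cancel hc0 hc1, one_mul]
  rw [key, Measure.smul_apply, Measure.map_apply hm hA, smul_eq_mul, ← mul_assoc,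
    ENNReal.mul_inv_cancel hc0 hc1, one_mul]
  rfl

/-! ### The law of the coordinates -/

variable {E : SupportInterval}

/-- The unnormalized density of the coordinate number `i` of a random moment vector of
dimension `n`. -/
def SupportInterval.coordDensity (E : SupportInterval) (V₁ V₂ : ℝ → ℝ) (n i : ℕ) : ℝ → ℝ≥0∞ :=
  (E.range i).indicator fun t =>
    ENNReal.ofReal (Real.exp (-(n : ℝ) * alternating V₁ V₂ i t) * E.factor i t ^ (n - 1 - i))

lemma SupportInterval.continuous_factor (E : SupportInterval) (i : ℕ) :
    Continuous (E.factor i) := by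
  unfold SupportInterval.factor
  cases E with
  | compact a b => simp only; fun_prop
  | halfLine => exact continuous_id
  | line =>
    simp only
    split_ifs
    · exact continuous_const
    · exact continuous_id

/-- The potentials are continuous on the open ranges. -/
def SupportInterval.ContinuousPotentials (E : SupportInterval) (V₁ V₂ : ℝ → ℝ) : Prop :=
  ∀ i, ContinuousOn (alternating V₁ V₂ i) (E.range i)

lemma measurable_indicator_of_continuousOn {X β : Type*} [TopologicalSpace X] [MeasurableSpace X]
    [OpensMeasurableSpace X] [TopologicalSpace β] [MeasurableSpace β] [BorelSpace β] [Zero β]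
    {s : Set X} {f : X → β} (hf : ContinuousOn f s) (hs : MeasurableSet s) :
    Measurable (s.indicator f) := by
  classical
  rw [← piecewise_eq_indicator]
  exact hf.measurable_piecewise continuousOn_const hs

lemma SupportInterval.ContinuousPotentials.measurable_coordDensity {V₁ V₂ : ℝ → ℝ}
    (hV : E.ContinuousPotentials V₁ V₂) (n i : ℕ) : Measurable (E.coordDensity V₁ V₂ n i) := by
  refine measurable_indicator_of_continuousOn ?_ (E.isOpen_range i).measurableSet
  refine ENNReal.continuous_ofReal.comp_continuousOn (ContinuousOn.mul ?_ ?_)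
  · exact Real.continuous_exp.comp_continuousOn (continuousOn_const.mul (hV i))
  · exact ((E.continuous_factor i).pow _).continuousOn

lemma SupportInterval.coordDensity_ne_top (E : SupportInterval) (V₁ V₂ : ℝ → ℝ) (n i : ℕ) (t : ℝ) :
    E.coordDensity V₁ V₂ n i t ≠ ∞ := by
  unfold SupportInterval.coordDensity indicator
  split_ifs <;> simp

/-- The unnormalized law of the coordinate number `i`. -/
def SupportInterval.coordMeasure (E : SupportInterval) (V₁ V₂ : ℝ → ℝ) (n i : ℕ) : Measure ℝ :=
  volume.withDensity (E.coordDensity V₁ V₂ n i)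

instance (V₁ V₂ : ℝ → ℝ) (n i : ℕ) : SigmaFinite (E.coordMeasure V₁ V₂ n i) :=
  SigmaFinite.withDensity_of_ne_top (ae_of_all _ (E.coordDensity_ne_top V₁ V₂ n i))

lemma prod_range_prod_range (f : ℕ → ℝ) (n : ℕ) :
    ∏ i ∈ Finset.range n, ∏ l ∈ Finset.range i, f l =
      ∏ l ∈ Finset.range n, f l ^ (n - 1 - l) := by
  induction n with
  | zero => simp
  | succ n ih =>
    rw [Finset.prod_range_succ, ih, ← Finset.prod_mul_distrib, Finset.prod_range_succ _ n]
    simp only [Nat.add_sub_cancel, Nat.sub_self, pow_zero, mul_one]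
    refine Finset.prod_congr rfl fun l hl => ?_
    rw [← pow_succ]
    congr 1
    have := Finset.mem_range.1 hl
    omega

/-- The constant part of the Jacobian determinant. -/
def SupportInterval.scaleFactor (E : SupportInterval) (n : ℕ) : ℝ :=
  ∏ i : Fin n, E.scale ^ ((i : ℕ) + 1)

lemma SupportInterval.Proper.scaleFactor_pos (hE : E.Proper) (n : ℕ) : 0 < E.scaleFactor n :=
  Finset.prod_pos fun _ _ => pow_pos hE.scale_pos _

/-- Coordinate `i` enters the slopes of the later coordinates `i + 1, …, n - 1`, which explains the
exponent `n - 1 - i`. -/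
lemma SupportInterval.det_fderiv_psi' (E : SupportInterval) {n : ℕ} (y : Fin n → ℝ) :
    (fderiv ℝ (E.psi n) y).det =
      E.scaleFactor n * ∏ i : Fin n, E.factor i (y i) ^ (n - 1 - (i : ℕ)) := by
  rw [E.det_fderiv_psi]
  simp only [SupportInterval.slope]
  rw [Finset.prod_mul_distrib, SupportInterval.scaleFactor,
    Fin.prod_univ_eq_prod_range (fun i => ∏ l ∈ Finset.range i, E.factor l (extendZero y l)),
    prod_range_prod_range,
    ← Fin.prod_univ_eq_prod_range (fun l => E.factor l (extendZero y l) ^ (n - 1 - l))]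
  simp

/-- Change of variables along `psi`. Both the weight and the Jacobian determinant factorize over the
coordinates, so the coordinates are independent. -/
lemma SupportInterval.Proper.weightMeasure_apply (hE : E.Proper) {V₁ V₂ : ℝ → ℝ}
    (hV : E.ContinuousPotentials V₁ V₂) (n : ℕ) {B : Set (Fin n → ℝ)} (hB : MeasurableSet B) :
    E.weightMeasure V₁ V₂ n B = ENNReal.ofReal (E.scaleFactor n) *
      Measure.pi (fun i : Fin n => E.coordMeasure V₁ V₂ n i) (E.psi n ⁻¹' B) := by
  have hcont : Continuous (E.psi n) := (E.contDiff_psi n).continuous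
  have hD : MeasurableSet (E.domain n) := (E.isOpen_domain n).measurableSet
  have hB' : MeasurableSet (E.psi n ⁻¹' B) := hcont.measurable hB
  have himg : E.psi n '' (E.psi n ⁻¹' B ∩ E.domain n) = B ∩ interior (momentSpace E.carrier n) := by
    rw [← hE.image_psi, image_preimage_inter]
  rw [SupportInterval.weightMeasure, withDensity_apply _ hB, Measure.restrict_restrict hB, ← himg,
    lintegral_image_eq_lintegral_abs_det_fderiv_mul volume (hB'.inter hD)
      (fun y _ => ((E.contDiff_psi n).differentiable (by norm_num) y).hasFDerivAt.hasFDerivWithinAt)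
      ((hE.injOn_psi n).mono inter_subset_right)]
  have hpi : Measure.pi (fun i : Fin n => E.coordMeasure V₁ V₂ n i) =
      volume.withDensity fun y : Fin n → ℝ => ∏ i : Fin n, E.coordDensity V₁ V₂ n i (y i) :=
    pi_withDensity (fun i => hV.measurable_coordDensity n i) fun i => E.coordDensity_ne_top _ _ _ _
  rw [hpi, withDensity_apply _ hB', ← lintegral_const_mul' _ _ ENNReal.ofReal_ne_top,
    ← lintegral_indicator (hB'.inter hD), ← lintegral_indicator hB']
  refine lintegral_congr fun y => ?_
  by_cases hyB : y ∈ E.psi n ⁻¹' B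
  · by_cases hyD : y ∈ E.domain n
    · rw [indicator_of_mem (Set.mem_inter hyB hyD), indicator_of_mem hyB, abs_of_pos (hE.det_fderiv_psi_pos hyD),
        E.det_fderiv_psi', SupportInterval.weight, hE.coord_psi hyD]
      have h1 : ∀ i : Fin n, E.coordDensity V₁ V₂ n i (y i) = ENNReal.ofReal
          (Real.exp (-(n : ℝ) * alternating V₁ V₂ i (y i)) *
            E.factor i (y i) ^ (n - 1 - (i : ℕ))) := fun i =>
        indicator_of_mem (hyD i (mem_univ i)) _
      have hf : ∀ i : Fin n, 0 ≤ E.factor i (y i) ^ (n - 1 - (i : ℕ)) := fun i =>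
        pow_nonneg (E.factor_pos (hyD i (mem_univ i))).le _
      simp_rw [h1]
      rw [← ENNReal.ofReal_prod_of_nonneg fun i _ => mul_nonneg (Real.exp_pos _).le (hf i),
        ← ENNReal.ofReal_mul (mul_nonneg (hE.scaleFactor_pos n).le
          (Finset.prod_nonneg fun i _ => hf i)), ← ENNReal.ofReal_mul (hE.scaleFactor_pos n).le,
        Finset.prod_mul_distrib, ← Real.exp_sum, ← Finset.mul_sum]
      congr 1
      ring
    · rw [indicator_of_notMem fun h => hyD h.2, indicator_of_mem hyB]
      have : ∃ i : Fin n, y i ∉ E.range i := by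
        by_contra! h
        exact hyD fun i _ => h i
      obtain ⟨i, hi⟩ := this
      rw [Finset.prod_eq_zero (Finset.mem_univ i) (indicator_of_notMem hi _), mul_zero]
  · rw [indicator_of_notMem fun h => hyB h.1, indicator_of_notMem hyB]

/-- The law of the first `k` moments in terms of the first `k` coordinates. -/
lemma SupportInterval.Proper.measure_firstEntries (hE : E.Proper) {V₁ V₂ : ℝ → ℝ}
    (hV : E.ContinuousPotentials V₁ V₂) {Ω : Type*} [MeasurableSpace Ω] {P : Measure Ω}
    [IsProbabilityMeasure P] {k n : ℕ} (hkn : k ≤ n) {M : Ω → Fin n → ℝ}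
    (hM : HasLaw M (E.momentLaw V₁ V₂ n) P) :
    Measure.pi (fun i : Fin k => E.coordMeasure V₁ V₂ n i) univ ≠ 0 ∧
    Measure.pi (fun i : Fin k => E.coordMeasure V₁ V₂ n i) univ ≠ ∞ ∧
    ∀ A : Set (Fin k → ℝ), MeasurableSet A → P {ω | firstEntries k (M ω) ∈ A} =
      Measure.pi (fun i : Fin k => E.coordMeasure V₁ V₂ n i) (E.psi k ⁻¹' A) /
        Measure.pi (fun i : Fin k => E.coordMeasure V₁ V₂ n i) univ := by
  obtain ⟨r, rfl⟩ := Nat.exists_eq_add_of_le hkn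
  set c := ENNReal.ofReal (E.scaleFactor (k + r)) with hc
  have hc0 : c ≠ 0 := by
    rw [hc, Ne, ENNReal.ofReal_eq_zero, not_le]; exact hE.scaleFactor_pos _
  have hc1 : c ≠ ∞ := ENNReal.ofReal_ne_top
  have hprob : E.momentLaw V₁ V₂ (k + r) univ = 1 := by
    rw [← hM.map_eq, Measure.map_apply_of_aemeasurable hM.aemeasurable MeasurableSet.univ]
    simp
  have huniv := hE.weightMeasure_apply hV (k + r) MeasurableSet.univ
  rw [preimage_univ, ← hc, Measure.pi_univ] at huniv
  -- The normalized measure has mass `1`; neither `Z = 0` nor `Z = ∞` is compatible with this, since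
  -- both would give mass `0`.
  have hZ0 : E.weightMeasure V₁ V₂ (k + r) univ ≠ 0 := fun h => by
    rw [SupportInterval.momentLaw, Measure.smul_apply, h] at hprob
    simp at hprob
  have hZ1 : E.weightMeasure V₁ V₂ (k + r) univ ≠ ∞ := fun h => by
    rw [SupportInterval.momentLaw, Measure.smul_apply, h] at hprob
    simp at hprob
  rw [huniv] at hZ0 hZ1
  have hp0 : ∏ i : Fin (k + r), E.coordMeasure V₁ V₂ (k + r) i univ ≠ 0 := right_ne_zero_of_mul hZ0
  have h0 : ∀ i : Fin (k + r), E.coordMeasure V₁ V₂ (k + r) i univ ≠ 0 := fun i =>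
    Finset.prod_ne_zero_iff.1 hp0 i (Finset.mem_univ i)
  have hp1 : ∏ i : Fin (k + r), E.coordMeasure V₁ V₂ (k + r) i univ ≠ ∞ := fun h =>
    hZ1 (by rw [h]; exact ENNReal.mul_top hc0)
  have h1 : ∀ i : Fin (k + r), E.coordMeasure V₁ V₂ (k + r) i univ ≠ ∞ := fun i h => by
    refine hp1 ?_
    rw [← Finset.mul_prod_erase _ _ (Finset.mem_univ i), h]
    exact ENNReal.top_mul (Finset.prod_ne_zero_iff.2 fun j _ => h0 j)
  refine ⟨?_, ?_, fun A hA => ?_⟩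
  · rw [Measure.pi_univ]
    exact Finset.prod_ne_zero_iff.2 fun i _ => h0 (Fin.castAdd r i)
  · rw [Measure.pi_univ]
    exact ENNReal.prod_ne_top fun i _ => h1 (Fin.castAdd r i)
  have hfe : ∀ m : Fin (k + r) → ℝ, firstEntries k m = fun i => m (Fin.castAdd r i) := fun m => by
    ext i
    have : (i : ℕ) < (k + r) := by omega
    rw [firstEntries, dif_pos this]
    rfl
  have hfm : Measurable fun m : Fin (k + r) → ℝ => firstEntries k m := by
    simp_rw [hfe]; fun_prop
  have hpm : Measurable (E.psi k) := (E.contDiff_psi k).continuous.measurable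
  have hpre : E.psi (k + r) ⁻¹' ((fun m => firstEntries k m) ⁻¹' A) =
      {y | (fun i => y (Fin.castAdd r i)) ∈ E.psi k ⁻¹' A} := by
    ext y
    simp only [mem_preimage, Set.mem_ofPred_eq, hfe]
    -- By triangularity the first `k` moments see only the first `k` coordinates. The remaining
    -- coordinates integrate out to a constant that cancels in the quotient.
    have : (fun i => E.psi (k + r) y (Fin.castAdd r i)) = E.psi k fun i => y (Fin.castAdd r i) := by
      ext i
      refine E.mom_congr (i := k) (fun l hl => ?_) _ i.2
      rw [extendZero_of_lt _ hl, extendZero_of_lt _ (by omega : l < (k + r))]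
      rfl
    rw [this]
  have hP : P {ω | firstEntries k (M ω) ∈ A} =
      E.momentLaw V₁ V₂ (k + r) ((fun m => firstEntries k m) ⁻¹' A) := by
    rw [← hM.map_eq, Measure.map_apply_of_aemeasurable hM.aemeasurable (hfm hA)]
    rfl
  have hmar := fun (S : Set (Fin k → ℝ)) (hS : MeasurableSet S) =>
    pi_preimage_castAdd (fun i : Fin (k + r) => E.coordMeasure V₁ V₂ (k + r) i) h0 h1 hS
  have hall := hmar univ MeasurableSet.univ
  simp only [mem_univ, Set.ofPred_true] at hall
  set d := ∏ j : Fin r, E.coordMeasure V₁ V₂ (k + r) (Fin.natAdd k j : Fin (k + r)) univ with hd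
  have hd0 : d ≠ 0 := Finset.prod_ne_zero_iff.2 fun j _ => h0 _
  have hd1 : d ≠ ∞ := ENNReal.prod_ne_top fun j _ => h1 _
  rw [← Measure.pi_univ] at huniv
  rw [hP, SupportInterval.momentLaw, Measure.smul_apply, hE.weightMeasure_apply hV (k + r) (hfm hA),
    hpre, ← hc, huniv, hmar _ (hpm hA), hall, smul_eq_mul, mul_comm, ← div_eq_mul_inv,
    ENNReal.mul_div_mul_left _ _ hc0 hc1, ENNReal.mul_div_mul_left _ _ hd0 hd1]
  rfl

end

section

/-! ### Laplace asymptotics on the moderate deviations scale -/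

/-- The quadratic form `½ ∑ wᵢ uᵢ²`. -/
def diagQuad {k : ℕ} (w u : Fin k → ℝ) : ℝ := 1 / 2 * ∑ i, w i * u i ^ 2

lemma continuous_diagQuad {k : ℕ} (w : Fin k → ℝ) : Continuous (diagQuad w) := by
  unfold diagQuad; fun_prop

lemma diagQuad_smul {k : ℕ} (w u : Fin k → ℝ) (c : ℝ) :
    diagQuad w (c • u) = c ^ 2 * diagQuad w u := by
  simp only [diagQuad, Pi.smul_apply, smul_eq_mul, mul_pow]
  simp only [Finset.mul_sum]
  refine Finset.sum_congr rfl fun i _ => ?_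
  ring

lemma diagQuad_zero {k : ℕ} (w : Fin k → ℝ) : diagQuad w 0 = 0 := by simp [diagQuad]

lemma diagQuad_nonneg {k : ℕ} {w : Fin k → ℝ} (hw : ∀ i, 0 < w i) (u : Fin k → ℝ) :
    0 ≤ diagQuad w u :=
  mul_nonneg (by norm_num) (Finset.sum_nonneg fun i _ => mul_nonneg (hw i).le (sq_nonneg _))

lemma exists_pos_forall_le {ι : Type*} [Finite ι] {f : ι → ℝ} (hf : ∀ i, 0 < f i) :
    ∃ c > 0, ∀ i, c ≤ f i := by
  rcases isEmpty_or_nonempty ι with h | h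
  · exact ⟨1, one_pos, fun i => h.elim i⟩
  · obtain ⟨j, hj⟩ := Finite.exists_min f
    exact ⟨f j, hf j, hj⟩

lemma exists_diagQuad_ge {k : ℕ} {w : Fin k → ℝ} (hw : ∀ i, 0 < w i) :
    ∃ c > 0, ∀ u, c * ‖u‖ ^ 2 ≤ diagQuad w u := by
  obtain ⟨c, hc, hcw⟩ := exists_pos_forall_le hw
  refine ⟨c / 2, by positivity, fun u => ?_⟩
  rcases isEmpty_or_nonempty (Fin k) with h | h
  · have : u = 0 := Subsingleton.elim _ _
    simp [this, diagQuad]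
  obtain ⟨j, hj⟩ := Finite.exists_max fun i => ‖u i‖
  have h1 : ‖u‖ ≤ ‖u j‖ := (pi_norm_le_iff_of_nonneg (norm_nonneg _)).2 hj
  have h2 : ‖u‖ ^ 2 ≤ u j ^ 2 := by
    calc ‖u‖ ^ 2 ≤ ‖u j‖ ^ 2 := by gcongr
      _ = u j ^ 2 := by simp
  have h3 : w j * u j ^ 2 ≤ ∑ i, w i * u i ^ 2 :=
    Finset.single_le_sum (f := fun i => w i * u i ^ 2)
      (fun i _ => mul_nonneg (hw i).le (sq_nonneg _)) (Finset.mem_univ j)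
  have h4 : c * ‖u‖ ^ 2 ≤ w j * u j ^ 2 := mul_le_mul (hcw j) h2 (by positivity) (hw j).le
  unfold diagQuad
  linarith

lemma diagQuad_sub_isLittleO {k : ℕ} (w : Fin k → ℝ) {α : Type*} {l : Filter α}
    {z v : α → Fin k → ℝ} (h : (fun x => z x - v x) =o[l] v) :
    (fun x => diagQuad w (z x) - diagQuad w (v x)) =o[l] fun x => ‖v x‖ ^ 2 := by
  have h1 : (fun x => z x + v x) =O[l] v := by
    have : (fun x => z x + v x) = fun x => (z x - v x) + (2 : ℝ) • v x := by
      ext x i; simp; ring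
    rw [this]
    exact h.isBigO.add ((Asymptotics.isBigO_refl v l).const_smul_left (2 : ℝ))
  have h2 : ∀ i, (fun x => w i * ((z x i - v x i) * (z x i + v x i))) =o[l] fun x => ‖v x‖ ^ 2 := by
    intro i
    refine Asymptotics.IsLittleO.const_mul_left ?_ _
    simp_rw [pow_two]
    refine Asymptotics.IsLittleO.mul_isBigO ?_ ?_
    · exact (Asymptotics.isLittleO_pi.1 h i).norm_right
    · exact (Asymptotics.isBigO_pi.1 h1 i).norm_right
  have h3 := (Asymptotics.IsLittleO.sum fun i (_ : i ∈ Finset.univ) => h2 i).const_mul_left (1 / 2)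
  refine h3.congr_left fun x => ?_
  simp only [diagQuad, Finset.sum_apply]
  rw [← mul_sub, ← Finset.sum_sub_distrib]
  congr 1
  exact Finset.sum_congr rfl fun i _ => by ring

/-- The assumptions on a phase `F` and an amplitude `g` on `D`, under which `exp (-n F) g`
concentrates at `y₀` on the Gaussian scale given by `w`. -/
structure QuadraticMinimum {k : ℕ} (D : Set (Fin k → ℝ)) (F g : (Fin k → ℝ) → ℝ)
    (w y₀ : Fin k → ℝ) : Prop where
  isOpen : IsOpen D
  mem : y₀ ∈ D
  weight_pos : ∀ i, 0 < w i
  expansion : (fun y => F y - diagQuad w (y - y₀)) =o[𝓝 y₀] fun y => ‖y - y₀‖ ^ 2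
  separated : ∀ δ > 0, ∃ η > 0, ∀ y ∈ D, δ ≤ ‖y - y₀‖ → η ≤ F y
  amplitude_continuousAt : ContinuousAt g y₀
  amplitude_pos : 0 < g y₀
  integrable : ∃ N : ℕ, ∫⁻ y in D, ENNReal.ofReal (Real.exp (-(N : ℝ) * F y) * g y) ≠ ∞

/-- The measure with density `exp (-n F) g` on `D`. -/
def laplaceMeasure {k : ℕ} (D : Set (Fin k → ℝ)) (F g : (Fin k → ℝ) → ℝ) (n : ℕ) :
    Measure (Fin k → ℝ) :=
  (volume.restrict D).withDensity fun y => ENNReal.ofReal (Real.exp (-(n : ℝ) * F y) * g y)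

variable {k : ℕ} {D : Set (Fin k → ℝ)} {F g : (Fin k → ℝ) → ℝ} {w y₀ : Fin k → ℝ}

lemma laplaceMeasure_apply (hD : IsOpen D) (n : ℕ) (S : Set (Fin k → ℝ)) :
    laplaceMeasure D F g n S =
      ∫⁻ y in S ∩ D, ENNReal.ofReal (Real.exp (-(n : ℝ) * F y) * g y) := by
  rw [laplaceMeasure, withDensity_apply', Measure.restrict_restrict' hD.measurableSet]

/-- The set of points whose rescaled image under `φ` lies in `S`. -/
def rescaledPreimage (φ : (Fin k → ℝ) → Fin k → ℝ) (y₀ : Fin k → ℝ) (c : ℝ)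
    (S : Set (Fin k → ℝ)) : Set (Fin k → ℝ) :=
  {y | c • (φ y - φ y₀) ∈ S}

lemma QuadraticMinimum.tendsto_phase (h : QuadraticMinimum D F g w y₀) {α : Type*} {l : Filter α}
    {c : α → ℝ} {d : α → Fin k → ℝ} {v : Fin k → ℝ} (hd : Tendsto d l (𝓝 0))
    (hcd : Tendsto (fun x => c x • d x) l (𝓝 v)) :
    Tendsto (fun x => c x ^ 2 * F (y₀ + d x)) l (𝓝 (diagQuad w v)) := by
  have h1 : Tendsto (fun x => y₀ + d x) l (𝓝 y₀) := by simpa using hd.const_add y₀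
  have h2 := h.expansion.comp_tendsto h1
  simp only [Function.comp_def, add_sub_cancel_left] at h2
  have h3 : (fun x => c x ^ 2 * (F (y₀ + d x) - diagQuad w (d x))) =o[l] fun x => ‖c x • d x‖ ^ 2 := by
    refine ((Asymptotics.isBigO_refl (fun x => c x ^ 2) l).mul_isLittleO h2).congr_right fun x => ?_
    rw [norm_smul, mul_pow, Real.norm_eq_abs, sq_abs]
  have h4 : Tendsto (fun x => c x ^ 2 * (F (y₀ + d x) - diagQuad w (d x))) l (𝓝 0) := by
    have := h3.trans_isBigO ((hcd.norm.pow 2).isBigO_one ℝ)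
    exact (Asymptotics.isLittleO_one_iff ℝ).1 this
  have h5 := h4.add ((continuous_diagQuad w).continuousAt.tendsto.comp hcd)
  rw [zero_add] at h5
  refine h5.congr fun x => ?_
  simp only [Function.comp_def, diagQuad_smul]
  ring

/-- The lower bound for the mass of an open set. -/
lemma QuadraticMinimum.eventually_le_laplaceMeasure (h : QuadraticMinimum D F g w y₀)
    {φ : (Fin k → ℝ) → Fin k → ℝ} {L : (Fin k → ℝ) ≃L[ℝ] (Fin k → ℝ)}
    (hφ : HasFDerivAt φ (L : (Fin k → ℝ) →L[ℝ] (Fin k → ℝ)) y₀)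
    {a : ℕ → ℝ} (ha : Tendsto a atTop atTop)
    (hb : Tendsto (fun n : ℕ => (n : ℝ) / a n ^ 2) atTop atTop)
    {O : Set (Fin k → ℝ)} (hO : IsOpen O) {x : Fin k → ℝ} (hx : x ∈ O) {s : ℝ}
    (hs : diagQuad w (L.symm x) < s) :
    ∀ᶠ n : ℕ in atTop, ENNReal.ofReal ((a n)⁻¹ ^ k * Real.exp (-((n : ℝ) / a n ^ 2 * s))) ≤
      laplaceMeasure D F g n (rescaledPreimage φ y₀ (a n) O) := by
  set u := L.symm x with hu
  obtain ⟨s', hs', hs's⟩ := exists_between hs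
  -- The product filter makes the asymptotics uniform over displacements `v / a n` with `v` near
  -- `u`, so they hold on a whole ball of radius `r / a n`.
  set l : Filter (ℕ × (Fin k → ℝ)) := atTop ×ˢ 𝓝 u with hl
  have hafst : Tendsto (fun p : ℕ × (Fin k → ℝ) => a p.1) l atTop := ha.comp tendsto_fst
  have ha0 : ∀ᶠ p in l, 0 < a p.1 := hafst.eventually_gt_atTop 0
  have hsnd : Tendsto (fun p : ℕ × (Fin k → ℝ) => p.2) l (𝓝 u) := tendsto_snd
  have hd : Tendsto (fun p : ℕ × (Fin k → ℝ) => (a p.1)⁻¹ • p.2) l (𝓝 0) := by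
    simpa using hafst.inv_tendsto_atTop.smul hsnd
  have hcd : Tendsto (fun p : ℕ × (Fin k → ℝ) => a p.1 • (a p.1)⁻¹ • p.2) l (𝓝 u) := by
    refine hsnd.congr' ?_
    filter_upwards [ha0] with p hp
    rw [smul_inv_smul₀ hp.ne']
  have hy : Tendsto (fun p : ℕ × (Fin k → ℝ) => y₀ + (a p.1)⁻¹ • p.2) l (𝓝 y₀) := by
    simpa using hd.const_add y₀
  have e1 := hy.eventually (h.isOpen.mem_nhds h.mem)
  have e2 : ∀ᶠ p in l, a p.1 • (φ (y₀ + (a p.1)⁻¹ • p.2) - φ y₀) ∈ O := by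
    have := hφ.hasFDerivWithinAt.lim (s := univ) (c := fun p : ℕ × (Fin k → ℝ) => a p.1)
      (d := fun p => (a p.1)⁻¹ • p.2) hd (by simp) hcd
    refine this.eventually (hO.mem_nhds ?_)
    simpa [hu] using hx
  have e3 := (h.tendsto_phase hd hcd).eventually (gt_mem_nhds hs')
  have e4 := (h.amplitude_continuousAt.tendsto.comp hy).eventually
    (lt_mem_nhds (half_lt_self h.amplitude_pos))
  obtain ⟨pa, hpa, pb, hpb, hab⟩ := eventually_prod_iff.1 (((e1.and e2).and (e3.and e4)).and ha0)
  obtain ⟨r, hr, hrb⟩ := Metric.eventually_nhds_iff_ball.1 hpb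
  -- The gap between `s'` and `s` absorbs the constants of volume and amplitude.
  have e5 : ∀ᶠ n : ℕ in atTop, 1 ≤ (2 * r) ^ k * (g y₀ / 2) *
      Real.exp ((n : ℝ) / a n ^ 2 * (s - s')) := by
    have : Tendsto (fun n : ℕ => (2 * r) ^ k * (g y₀ / 2) *
        Real.exp ((n : ℝ) / a n ^ 2 * (s - s'))) atTop atTop :=
      (Real.tendsto_exp_atTop.comp (hb.atTop_mul_const (sub_pos.2 hs's))).const_mul_atTop
        (mul_pos (by positivity) (half_pos h.amplitude_pos))
    exact this.eventually_ge_atTop 1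
  filter_upwards [hpa, e5, ha.eventually_gt_atTop 0] with n hn hn5 hn0
  set B := Metric.ball (y₀ + (a n)⁻¹ • u) (r / a n) with hB
  have hBu : ∀ y ∈ B, ∃ v ∈ Metric.ball u r, y = y₀ + (a n)⁻¹ • v := fun y hy => by
    refine ⟨a n • (y - y₀), ?_, by rw [inv_smul_smul₀ hn0.ne']; simp⟩
    rw [mem_ball_iff_norm] at hy ⊢
    have : a n • (y - y₀) - u = a n • (y - (y₀ + (a n)⁻¹ • u)) := by
      rw [← sub_sub, smul_sub _ (y - y₀), smul_inv_smul₀ hn0.ne']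
    rw [this, norm_smul, Real.norm_of_nonneg hn0.le]
    rwa [lt_div_iff₀' hn0] at hy
  have hP : ∀ y ∈ B, (y ∈ D ∧ y ∈ rescaledPreimage φ y₀ (a n) O) ∧
      a n ^ 2 * F y < s' ∧ g y₀ / 2 < g y := fun y hy => by
    obtain ⟨v, hv, rfl⟩ := hBu y hy
    exact (hab hn (hrb v hv)).1
  calc ENNReal.ofReal ((a n)⁻¹ ^ k * Real.exp (-((n : ℝ) / a n ^ 2 * s)))
      ≤ ENNReal.ofReal (Real.exp (-((n : ℝ) / a n ^ 2 * s')) * (g y₀ / 2)) *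
        ENNReal.ofReal ((2 * (r / a n)) ^ k) := by
        rw [← ENNReal.ofReal_mul (mul_nonneg (Real.exp_pos _).le (half_pos h.amplitude_pos).le)]
        refine ENNReal.ofReal_le_ofReal ?_
        have h1 : Real.exp (-((n : ℝ) / a n ^ 2 * s')) =
            Real.exp (-((n : ℝ) / a n ^ 2 * s)) * Real.exp ((n : ℝ) / a n ^ 2 * (s - s')) := by
          rw [← Real.exp_add]; congr 1; ring
        have h2 : (2 * (r / a n)) ^ k = (2 * r) ^ k * (a n)⁻¹ ^ k := by
          rw [← mul_pow, div_eq_mul_inv, mul_assoc]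
        rw [h1, h2]
        have h3 : 0 ≤ (a n)⁻¹ ^ k * Real.exp (-((n : ℝ) / a n ^ 2 * s)) := by positivity
        nlinarith [mul_le_mul_of_nonneg_left hn5 h3]
    _ = ∫⁻ y in B, ENNReal.ofReal (Real.exp (-((n : ℝ) / a n ^ 2 * s')) * (g y₀ / 2)) := by
        rw [setLIntegral_const, hB, Real.volume_pi_ball _ (by positivity), Fintype.card_fin]
    _ ≤ ∫⁻ y in B, ENNReal.ofReal (Real.exp (-(n : ℝ) * F y) * g y) := by
        refine setLIntegral_mono' Metric.isOpen_ball.measurableSet fun y hy => ?_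
        obtain ⟨-, h1, h2⟩ := hP y hy
        refine ENNReal.ofReal_le_ofReal (mul_le_mul ?_ h2.le (half_pos h.amplitude_pos).le
          (Real.exp_pos _).le)
        refine Real.exp_le_exp.2 ?_
        have h3 : (n : ℝ) * F y ≤ n / a n ^ 2 * s' := by
          rw [div_mul_eq_mul_div, le_div_iff₀ (by positivity)]
          have := mul_le_mul_of_nonneg_left h1.le (Nat.cast_nonneg (α := ℝ) n)
          linarith
        linarith
    _ ≤ _ := by
        rw [laplaceMeasure_apply h.isOpen]
        exact lintegral_mono_set fun y hy => ⟨(hP y hy).1.2, (hP y hy).1.1⟩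

end

/-! ### The upper Laplace bound -/

section

variable {k : ℕ} {D : Set (Fin k → ℝ)} {F g : (Fin k → ℝ) → ℝ} {w y₀ : Fin k → ℝ}

/-- The first bound leaves a Gaussian to integrate, the second compares the phase with the rate
function at the linearized point, at the cost of a factor `1 + σ`. Both errors are `o(‖y - y₀‖²)`,
hence small against the positive definite form. -/
lemma QuadraticMinimum.eventually_near (h : QuadraticMinimum D F g w y₀)
    {φ : (Fin k → ℝ) → Fin k → ℝ} {L : (Fin k → ℝ) ≃L[ℝ] (Fin k → ℝ)}
    (hφ : HasFDerivAt φ (L : (Fin k → ℝ) →L[ℝ] (Fin k → ℝ)) y₀) {σ : ℝ} (hσ : 0 < σ) :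
    ∀ᶠ y in 𝓝 y₀, diagQuad w (y - y₀) / 2 ≤ F y ∧
      diagQuad w (L.symm (φ y - φ y₀)) ≤ (1 + σ) * F y ∧ g y ≤ 2 * g y₀ := by
  obtain ⟨c, hc, hcq⟩ := exists_diagQuad_ge h.weight_pos
  -- Error `c / 2` costs half of the quadratic form. Error `c σ / 4` is incurred twice, and `c ‖y -
  -- y₀‖² ≤ 2 F` turns it into `σ F`.
  have hε : 0 < min (c / 2) (c * σ / 4) := by positivity
  have h1 : (fun y => diagQuad w (L.symm (φ y - φ y₀)) - diagQuad w (y - y₀)) =o[𝓝 y₀]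
      fun y => ‖y - y₀‖ ^ 2 := by
    refine diagQuad_sub_isLittleO w ?_
    have h2 := (L.symm : (Fin k → ℝ) →L[ℝ] (Fin k → ℝ)).isBigO_comp
      (fun y => φ y - φ y₀ - L (y - y₀)) (𝓝 y₀)
    refine (h2.trans_isLittleO hφ.isLittleO).congr_left fun y => ?_
    simp [map_sub]
  filter_upwards [h.expansion.bound hε, h1.bound hε,
    h.amplitude_continuousAt.tendsto.eventually (gt_mem_nhds (by linarith [h.amplitude_pos] :
      g y₀ < 2 * g y₀))] with y e1 e2 e3
  rw [Real.norm_eq_abs, Real.norm_of_nonneg (by positivity)] at e1 e2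
  have hq := hcq (y - y₀)
  set t := ‖y - y₀‖ ^ 2 with ht
  have ht0 : 0 ≤ t := by positivity
  have a1 : min (c / 2) (c * σ / 4) * t ≤ c / 2 * t :=
    mul_le_mul_of_nonneg_right (min_le_left _ _) ht0
  have a2 : min (c / 2) (c * σ / 4) * t ≤ c * σ / 4 * t :=
    mul_le_mul_of_nonneg_right (min_le_right _ _) ht0
  have b1 := (abs_le.1 e1).1
  have b2 := (abs_le.1 e2).2
  have hF : diagQuad w (y - y₀) / 2 ≤ F y := by linarith
  refine ⟨hF, ?_, e3.le⟩
  have : σ * (c * t) ≤ σ * (2 * F y) := mul_le_mul_of_nonneg_left (by linarith) hσ.le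
  linarith

lemma lintegral_exp_neg_diagQuad (hw : ∀ i, 0 < w i) {τ : ℝ} (hτ : 0 < τ) :
    ∃ C > 0, ∀ n : ℕ, 1 ≤ n → ∫⁻ y : Fin k → ℝ,
      ENNReal.ofReal (Real.exp (-(n * τ * diagQuad w (y - y₀)))) =
        ENNReal.ofReal (C * (√(n : ℝ))⁻¹ ^ k) := by
  refine ⟨∏ i, √(Real.pi / (τ * w i / 2)), Finset.prod_pos fun i _ => ?_, fun n hn => ?_⟩
  · have := hw i
    positivity
  have hn0 : (0 : ℝ) < n := by exact_mod_cast hn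
  rw [lintegral_sub_right_eq_self (μ := (volume : Measure (Fin k → ℝ)))
    (fun y => ENNReal.ofReal (Real.exp (-(n * τ * diagQuad w y)))) y₀]
  have h1 : ∀ y : Fin k → ℝ, ENNReal.ofReal (Real.exp (-(n * τ * diagQuad w y))) =
      ∏ i, ENNReal.ofReal (Real.exp (-(n * (τ * w i / 2)) * y i ^ 2)) := fun y => by
    rw [← ENNReal.ofReal_prod_of_nonneg fun i _ => (Real.exp_pos _).le, ← Real.exp_sum]
    congr 2
    rw [diagQuad, Finset.mul_sum, Finset.mul_sum, ← Finset.sum_neg_distrib]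
    exact Finset.sum_congr rfl fun i _ => by ring
  simp_rw [h1]
  rw [lintegral_fin_prod (f := fun i t => ENNReal.ofReal (Real.exp (-(n * (τ * w i / 2)) * t ^ 2)))
    fun i => by fun_prop]
  have h2 : ∀ i, ∫⁻ t : ℝ, ENNReal.ofReal (Real.exp (-(n * (τ * w i / 2)) * t ^ 2)) =
      ENNReal.ofReal (√(Real.pi / (τ * w i / 2)) * (√(n : ℝ))⁻¹) := fun i => by
    have hpos : 0 < n * (τ * w i / 2) := by have := hw i; positivity
    rw [← ofReal_integral_eq_lintegral_ofReal (integrable_exp_neg_mul_sq hpos)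
      (ae_of_all _ fun t => (Real.exp_pos _).le), integral_gaussian, ← Real.sqrt_inv,
      ← Real.sqrt_mul (by have := hw i; positivity)]
    congr 2
    field_simp
  simp_rw [h2]
  rw [← ENNReal.ofReal_prod_of_nonneg fun i _ => by positivity, Finset.prod_mul_distrib]
  simp

/-- Exponentially small quantities are negligible on the moderate deviations scale. -/
lemma eventually_exp_neg_le {a : ℕ → ℝ} (ha : Tendsto a atTop atTop)
    (hb : Tendsto (fun n : ℕ => (n : ℝ) / a n ^ 2) atTop atTop) {η : ℝ} (hη : 0 < η) (K s : ℝ)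
    (k : ℕ) : ∀ᶠ n : ℕ in atTop, K * Real.exp (-(n * η)) ≤
      (a n)⁻¹ ^ k * Real.exp (-((n : ℝ) / a n ^ 2 * s)) := by
  have h1 : Tendsto (fun n : ℕ => (n : ℝ) * (η / 2)) atTop atTop :=
    tendsto_natCast_atTop_atTop.atTop_mul_const (half_pos hη)
  have h2 := ((Real.tendsto_pow_mul_exp_neg_atTop_nhds_zero k).comp h1).const_mul
    (|K| * (2 / η) ^ k)
  rw [mul_zero] at h2
  filter_upwards [h2.eventually (ge_mem_nhds one_pos), hb.eventually_ge_atTop 1,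
    ha.eventually_ge_atTop 1, ha.eventually_ge_atTop (2 / η * |s|),
    eventually_ge_atTop 1] with n e1 e2 e3 e4 e5
  have hn : (1 : ℝ) ≤ n := by exact_mod_cast e5
  have ha0 : 0 < a n := by linarith
  rw [le_div_iff₀ (by positivity), one_mul] at e2
  have han : a n ≤ n := by nlinarith
  -- Half of the exponent pays for `exp (-(n / a n²) s)`, the other half for the power `a n ^ k ≤ n
  -- ^ k`.
  have hs : (n : ℝ) / a n ^ 2 * s ≤ n * (η / 2) := by
    rw [div_mul_eq_mul_div, div_le_iff₀ (by positivity), mul_assoc]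
    refine mul_le_mul_of_nonneg_left ?_ (by linarith)
    have : |s| ≤ η / 2 * a n := by
      have := mul_le_mul_of_nonneg_left e4 (half_pos hη).le
      rw [← mul_assoc] at this
      field_simp at this ⊢
      linarith
    have h3 : η / 2 * a n ≤ η / 2 * a n ^ 2 :=
      mul_le_mul_of_nonneg_left (by nlinarith) (half_pos hη).le
    linarith [le_abs_self s]
  simp only [Function.comp_apply] at e1
  have h3 : |K| * (n : ℝ) ^ k * Real.exp (-(n * (η / 2))) ≤ 1 := by
    refine le_trans (le_of_eq ?_) e1
    rw [mul_pow, div_pow, div_pow]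
    field_simp
  have h4 : Real.exp (-(n * η)) = Real.exp (-(n * (η / 2))) * Real.exp (-(n * (η / 2))) := by
    rw [← Real.exp_add]; congr 1; ring
  have h5 : Real.exp (-(n * (η / 2))) ≤ Real.exp (-((n : ℝ) / a n ^ 2 * s)) :=
    Real.exp_le_exp.2 (by linarith)
  rw [inv_pow, inv_mul_eq_div, le_div_iff₀ (by positivity)]
  calc K * Real.exp (-(n * η)) * a n ^ k
      ≤ |K| * Real.exp (-(n * η)) * n ^ k := by
        gcongr
        exact le_abs_self K
    _ = (|K| * (n : ℝ) ^ k * Real.exp (-(n * (η / 2)))) * Real.exp (-(n * (η / 2))) := by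
        rw [h4]; ring
    _ ≤ 1 * Real.exp (-(n * (η / 2))) := by gcongr
    _ ≤ _ := by rw [one_mul]; exact h5

/-- The upper bound for the mass of a set. -/
lemma QuadraticMinimum.eventually_laplaceMeasure_le (h : QuadraticMinimum D F g w y₀)
    {φ : (Fin k → ℝ) → Fin k → ℝ} {L : (Fin k → ℝ) ≃L[ℝ] (Fin k → ℝ)}
    (hφ : HasFDerivAt φ (L : (Fin k → ℝ) →L[ℝ] (Fin k → ℝ)) y₀)
    {a : ℕ → ℝ} (ha : Tendsto a atTop atTop)
    (hb : Tendsto (fun n : ℕ => (n : ℝ) / a n ^ 2) atTop atTop)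
    {U : Set (Fin k → ℝ)} {s s' : ℝ} (hU : ∀ x ∈ U, s ≤ diagQuad w (L.symm x))
    (hs' : s' < s) :
    ∀ᶠ n : ℕ in atTop, laplaceMeasure D F g n (rescaledPreimage φ y₀ (a n) U) ≤
      ENNReal.ofReal ((a n)⁻¹ ^ k * Real.exp (-((n : ℝ) / a n ^ 2 * s'))) := by
  -- Near `y₀` the phase is split as `(1 - σ) F + σ F`: the first part yields the decay rate, the
  -- second keeps a Gaussian of width `n ^ (-1/2)`. The loss is made smaller than `s - s'`.
  obtain ⟨σ, hσ, hσ1, hσs⟩ : ∃ σ > 0, σ < 1 ∧ s' < (1 - σ) * (s / (1 + σ)) := by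
    have hc : ContinuousAt (fun σ : ℝ => (1 - σ) * (s / (1 + σ))) 0 := by
      refine ContinuousAt.mul (by fun_prop) (ContinuousAt.div (by fun_prop) (by fun_prop) (by simp))
    have h1 := hc.tendsto.eventually (lt_mem_nhds (by simpa using hs'))
    obtain ⟨σ, h2, h3, h4⟩ := ((h1.filter_mono nhdsWithin_le_nhds).and
      (Ioo_mem_nhdsGT (zero_lt_one (α := ℝ)))).exists
    exact ⟨σ, h3, h4, h2⟩
  set s₁ := (1 - σ) * (s / (1 + σ)) with hs₁
  obtain ⟨δ, hδ, hnear⟩ := Metric.eventually_nhds_iff_ball.1 (h.eventually_near hφ hσ)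
  obtain ⟨η, hη, hfar⟩ := h.separated δ hδ
  obtain ⟨C, hC, hCn⟩ := lintegral_exp_neg_diagQuad (y₀ := y₀) h.weight_pos (half_pos hσ)
  obtain ⟨N, hN⟩ := h.integrable
  set K := ∫⁻ y in D, ENNReal.ofReal (Real.exp (-(N : ℝ) * F y) * g y) with hK
  have hg0 := h.amplitude_pos
  have e1 : ∀ᶠ n : ℕ in atTop, 2 * (2 * g y₀ * C) ≤ Real.exp ((n : ℝ) / a n ^ 2 * (s₁ - s')) :=
    (Real.tendsto_exp_atTop.comp (hb.atTop_mul_const (sub_pos.2 hσs))).eventually_ge_atTop _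
  filter_upwards [e1, eventually_exp_neg_le ha hb hη (2 * (Real.exp (N * η) * K.toReal)) s' k,
    hb.eventually_ge_atTop 1, ha.eventually_ge_atTop 1, eventually_ge_atTop (max N 1)]
    with n f1 f2 f3 f4 f5
  have hn1 : 1 ≤ n := le_of_max_le_right f5
  have hnN : (N : ℝ) ≤ n := by exact_mod_cast le_of_max_le_left f5
  have hn0 : (0 : ℝ) < n := by exact_mod_cast hn1
  have ha0 : 0 < a n := by linarith
  set b := (n : ℝ) / a n ^ 2 with hbdef
  have hansq : a n ≤ √(n : ℝ) := by
    refine Real.le_sqrt_of_sq_le ?_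
    rwa [hbdef, le_div_iff₀ (by positivity), one_mul] at f3
  set S := rescaledPreimage φ y₀ (a n) U with hS
  set f := fun y => ENNReal.ofReal (Real.exp (-(n : ℝ) * F y) * g y) with hf
  rw [laplaceMeasure_apply h.isOpen]
  -- Near part: Gaussian integral, with `n ^ (-k/2) ≤ a n ^ (-k)`. Far part: `F ≥ η`, so `exp (-(n -
  -- N) η)` can be taken out of the integral, which is finite at the exponent `N`.
  have hsplit : S ∩ D ⊆ (S ∩ D ∩ Metric.ball y₀ δ) ∪ (D ∩ (Metric.ball y₀ δ)ᶜ) := fun y hy => by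
    by_cases hyb : y ∈ Metric.ball y₀ δ
    · exact Or.inl ⟨hy, hyb⟩
    · exact Or.inr ⟨hy.2, hyb⟩
  have hnearI : ∫⁻ y in S ∩ D ∩ Metric.ball y₀ δ, f y ≤
      ENNReal.ofReal ((a n)⁻¹ ^ k * Real.exp (-(b * s')) / 2) := by
    calc ∫⁻ y in S ∩ D ∩ Metric.ball y₀ δ, f y
        ≤ ∫⁻ y in S ∩ D ∩ Metric.ball y₀ δ, ENNReal.ofReal (2 * g y₀ * Real.exp (-(b * s₁))) *
          ENNReal.ofReal (Real.exp (-(n * (σ / 2) * diagQuad w (y - y₀)))) := by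
          have hmeas : Measurable fun y => ENNReal.ofReal (2 * g y₀ * Real.exp (-(b * s₁))) *
              ENNReal.ofReal (Real.exp (-(n * (σ / 2) * diagQuad w (y - y₀)))) := by
            have : Continuous fun y : Fin k → ℝ => diagQuad w (y - y₀) :=
              (continuous_diagQuad w).comp (continuous_id.sub continuous_const)
            have := this.measurable
            fun_prop
          refine setLIntegral_mono hmeas fun y hy => ?_
          obtain ⟨h1, h2, h3⟩ := hnear y hy.2
          rw [← ENNReal.ofReal_mul (by positivity)]
          refine ENNReal.ofReal_le_ofReal ?_
          have h4 : s ≤ a n ^ 2 * diagQuad w (L.symm (φ y - φ y₀)) := by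
            rw [← diagQuad_smul, ← map_smul]
            exact hU _ hy.1.1
          have h5 : s ≤ a n ^ 2 * ((1 + σ) * F y) :=
            h4.trans (mul_le_mul_of_nonneg_left h2 (by positivity))
          have h6 : b * (s / (1 + σ)) ≤ n * F y := by
            rw [hbdef, div_mul_div_comm, div_le_iff₀ (by positivity)]
            nlinarith [mul_le_mul_of_nonneg_left h5 hn0.le]
          have h7 : b * s₁ ≤ (1 - σ) * (n * F y) := by
            rw [hs₁, mul_left_comm]
            exact mul_le_mul_of_nonneg_left h6 (by linarith)
          have h8 : n * (σ / 2) * diagQuad w (y - y₀) ≤ σ * (n * F y) := by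
            have := mul_le_mul_of_nonneg_left h1 (mul_pos hσ hn0).le
            linarith
          calc Real.exp (-(n : ℝ) * F y) * g y
              ≤ Real.exp (-(b * s₁) + -(n * (σ / 2) * diagQuad w (y - y₀))) * (2 * g y₀) := by
                refine (mul_le_mul_of_nonneg_left h3 (Real.exp_pos _).le).trans ?_
                gcongr
                linarith
            _ = _ := by rw [Real.exp_add]; ring
      _ ≤ ∫⁻ y, ENNReal.ofReal (2 * g y₀ * Real.exp (-(b * s₁))) *
          ENNReal.ofReal (Real.exp (-(n * (σ / 2) * diagQuad w (y - y₀)))) :=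
          setLIntegral_le_lintegral _ _
      _ = ENNReal.ofReal (2 * g y₀ * Real.exp (-(b * s₁)) * (C * (√(n : ℝ))⁻¹ ^ k)) := by
          rw [lintegral_const_mul' _ _ ENNReal.ofReal_ne_top, hCn n hn1,
            ← ENNReal.ofReal_mul (by positivity)]
      _ ≤ _ := by
          refine ENNReal.ofReal_le_ofReal ?_
          have h1 : Real.exp (-(b * s')) = Real.exp (-(b * s₁)) * Real.exp (b * (s₁ - s')) := by
            rw [← Real.exp_add]; congr 1; ring
          have h2 : (√(n : ℝ))⁻¹ ^ k ≤ (a n)⁻¹ ^ k := by gcongr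
          have h3 : 2 * g y₀ * C ≤ Real.exp (b * (s₁ - s')) / 2 := by linarith
          calc 2 * g y₀ * Real.exp (-(b * s₁)) * (C * (√(n : ℝ))⁻¹ ^ k)
              = (2 * g y₀ * C) * (Real.exp (-(b * s₁)) * (√(n : ℝ))⁻¹ ^ k) := by ring
            _ ≤ (Real.exp (b * (s₁ - s')) / 2) * (Real.exp (-(b * s₁)) * (a n)⁻¹ ^ k) := by
                gcongr
            _ = _ := by rw [h1]; ring
  have hfarI : ∫⁻ y in D ∩ (Metric.ball y₀ δ)ᶜ, f y ≤
      ENNReal.ofReal ((a n)⁻¹ ^ k * Real.exp (-(b * s')) / 2) := by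
    calc ∫⁻ y in D ∩ (Metric.ball y₀ δ)ᶜ, f y
        ≤ ∫⁻ y in D ∩ (Metric.ball y₀ δ)ᶜ, ENNReal.ofReal (Real.exp (-((n - N) * η))) *
          ENNReal.ofReal (Real.exp (-(N : ℝ) * F y) * g y) := by
          refine setLIntegral_mono' (h.isOpen.measurableSet.inter
            Metric.isOpen_ball.measurableSet.compl) fun y hy => ?_
          rw [← ENNReal.ofReal_mul (Real.exp_pos _).le]
          have h1 : η ≤ F y := hfar y hy.1 (by simpa [dist_eq_norm] using hy.2)
          have h2 : Real.exp (-(n : ℝ) * F y) =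
              Real.exp (-((n - N) * F y)) * Real.exp (-(N : ℝ) * F y) := by
            rw [← Real.exp_add]; congr 1; ring
          have h3 : Real.exp (-((n - N) * F y)) ≤ Real.exp (-((n - N) * η)) :=
            Real.exp_le_exp.2 (neg_le_neg (mul_le_mul_of_nonneg_left h1 (sub_nonneg.2 hnN)))
          rcases le_total 0 (g y) with hgy | hgy
          · refine ENNReal.ofReal_le_ofReal ?_
            rw [h2, mul_assoc]
            exact mul_le_mul_of_nonneg_right h3 (mul_nonneg (Real.exp_pos _).le hgy)
          · rw [hf]
            simp only
            rw [ENNReal.ofReal_of_nonpos (mul_nonpos_of_nonneg_of_nonpos (Real.exp_pos _).le hgy)]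
            exact zero_le
      _ = ENNReal.ofReal (Real.exp (-((n - N) * η))) * ∫⁻ y in D ∩ (Metric.ball y₀ δ)ᶜ,
          ENNReal.ofReal (Real.exp (-(N : ℝ) * F y) * g y) :=
          lintegral_const_mul' _ _ ENNReal.ofReal_ne_top
      _ ≤ ENNReal.ofReal (Real.exp (-((n - N) * η))) * ENNReal.ofReal K.toReal := by
          rw [ENNReal.ofReal_toReal hN]
          gcongr
          exact lintegral_mono_set inter_subset_left
      _ ≤ _ := by
          rw [← ENNReal.ofReal_mul (Real.exp_pos _).le]
          refine ENNReal.ofReal_le_ofReal ?_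
          have : Real.exp (-((n - N) * η)) = Real.exp (N * η) * Real.exp (-(n * η)) := by
            rw [← Real.exp_add]; congr 1; ring
          rw [this]
          linarith
  calc ∫⁻ y in S ∩ D, f y
      ≤ ∫⁻ y in (S ∩ D ∩ Metric.ball y₀ δ) ∪ (D ∩ (Metric.ball y₀ δ)ᶜ), f y :=
        lintegral_mono_set hsplit
    _ ≤ (∫⁻ y in S ∩ D ∩ Metric.ball y₀ δ, f y) + ∫⁻ y in D ∩ (Metric.ball y₀ δ)ᶜ, f y :=
        lintegral_union_le _ _ _
    _ ≤ _ := by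
        refine (add_le_add hnearI hfarI).trans_eq ?_
        rw [← ENNReal.ofReal_add (by positivity) (by positivity), add_halves]

end

/-! ### From exponential bounds to the large deviations principle -/

section

lemma le_inv_mul_log_of_le {b s : ℝ} (hb : 0 < b) {p : ℝ≥0∞}
    (hp : ENNReal.ofReal (Real.exp (-(b * s))) ≤ p) :
    ((-s : ℝ) : EReal) ≤ ((1 / b : ℝ) : EReal) * ENNReal.log p := by
  have h1 : ((-(b * s) : ℝ) : EReal) ≤ ENNReal.log p := by
    have := ENNReal.log_monotone hp
    rwa [ENNReal.log_ofReal_of_pos (Real.exp_pos _), Real.log_exp] at this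
  calc ((-s : ℝ) : EReal) = ((1 / b : ℝ) : EReal) * ((-(b * s) : ℝ) : EReal) := by
        rw [← EReal.coe_mul]; congr 1; field_simp
    _ ≤ _ := mul_le_mul_of_nonneg_left h1 (by exact_mod_cast (one_div_pos.2 hb).le)

lemma inv_mul_log_le_of_le {b s : ℝ} (hb : 0 < b) {p : ℝ≥0∞}
    (hp : p ≤ ENNReal.ofReal (Real.exp (-(b * s)))) :
    ((1 / b : ℝ) : EReal) * ENNReal.log p ≤ ((-s : ℝ) : EReal) := by
  have h1 : ENNReal.log p ≤ ((-(b * s) : ℝ) : EReal) := by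
    have := ENNReal.log_monotone hp
    rwa [ENNReal.log_ofReal_of_pos (Real.exp_pos _), Real.log_exp] at this
  calc _ ≤ ((1 / b : ℝ) : EReal) * ((-(b * s) : ℝ) : EReal) :=
        mul_le_mul_of_nonneg_left h1 (by exact_mod_cast (one_div_pos.2 hb).le)
    _ = _ := by rw [← EReal.coe_mul]; congr 1; field_simp

lemma coe_ofReal_of_nonneg {q : ℝ} (hq : 0 ≤ q) : ((ENNReal.ofReal q : ℝ≥0∞) : EReal) = q := by
  rw [EReal.coe_ennreal_ofReal, max_eq_left hq]

/-- The large deviations principle from exponential bounds for the probabilities. -/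
lemma SatisfiesLDP.of_eventually_bounds {Ω 𝒳 : Type*} [MeasurableSpace Ω] [TopologicalSpace 𝒳]
    {P : Measure Ω} {X : ℕ → Ω → 𝒳} {b : ℕ → ℝ} {J : 𝒳 → ℝ} (hb : Tendsto b atTop atTop)
    (hJ0 : ∀ x, 0 ≤ J x) (hJ : Continuous J) (hlev : ∀ K, 0 ≤ K → IsCompact {x | J x ≤ K})
    (hlow : ∀ O : Set 𝒳, IsOpen O → ∀ x ∈ O, ∀ s, J x < s →
      ∀ᶠ n in atTop, ENNReal.ofReal (Real.exp (-(b n * s))) ≤ P {ω | X n ω ∈ O})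
    (hup : ∀ U : Set 𝒳, IsClosed U → ∀ s, (∀ x ∈ U, s ≤ J x) → ∀ s' < s,
      ∀ᶠ n in atTop, P {ω | X n ω ∈ U} ≤ ENNReal.ofReal (Real.exp (-(b n * s')))) :
    SatisfiesLDP P X b fun x => ENNReal.ofReal (J x) := by
  refine ⟨hb, (ENNReal.continuous_ofReal.comp hJ).lowerSemicontinuous, fun K hK => ?_,
    fun O hO => ?_, fun U hU => ?_⟩
  · simpa [ENNReal.ofReal_le_ofReal_iff hK] using hlev K hK
  · rw [EReal.neg_le]
    refine le_iInf₂ fun x hx => ?_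
    rw [EReal.neg_le, coe_ofReal_of_nonneg (hJ0 x), ← EReal.coe_neg]
    refine le_of_forall_lt fun c hc => ?_
    obtain ⟨t, ht, ht'⟩ := EReal.lt_iff_exists_real_btwn.1 hc
    have hs : J x < -t := by
      have : t < -J x := by exact_mod_cast ht'
      linarith
    refine ht.trans_le (le_liminf_of_le (by isBoundedDefault) ?_)
    filter_upwards [hlow O hO x hx _ hs, hb.eventually_gt_atTop 0] with n h1 h2
    simpa using le_inv_mul_log_of_le h2 h1
  · rw [EReal.le_neg]
    refine le_of_forall_lt fun c hc => ?_
    obtain ⟨t, ht, ht'⟩ := EReal.lt_iff_exists_real_btwn.1 hc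
    obtain ⟨s, hts, hs⟩ := EReal.lt_iff_exists_real_btwn.1 ht'
    have hsU : ∀ x ∈ U, s ≤ J x := fun x hx => by
      have h1 := hs.le.trans (iInf₂_le x hx)
      rw [coe_ofReal_of_nonneg (hJ0 x)] at h1
      exact_mod_cast h1
    refine ht.trans_le ?_
    rw [EReal.le_neg]
    refine limsup_le_of_le (by isBoundedDefault) ?_
    filter_upwards [hup U hU s hsU t (by exact_mod_cast hts), hb.eventually_gt_atTop 0] with n h1 h2
    simpa using inv_mul_log_le_of_le h2 h1

variable {k : ℕ} {D : Set (Fin k → ℝ)} {F g : (Fin k → ℝ) → ℝ} {w y₀ : Fin k → ℝ}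

lemma isCompact_diagQuad_le (hw : ∀ i, 0 < w i) (L : (Fin k → ℝ) ≃L[ℝ] (Fin k → ℝ)) (K : ℝ) :
    IsCompact {x | diagQuad w (L.symm x) ≤ K} := by
  have h1 : IsCompact {u | diagQuad w u ≤ K} := by
    obtain ⟨c, hc, hcq⟩ := exists_diagQuad_ge hw
    refine Metric.isCompact_of_isClosed_isBounded
      (isClosed_le (continuous_diagQuad w) continuous_const) ?_
    refine (Metric.isBounded_closedBall (x := (0 : Fin k → ℝ)) (r := √(K / c))).subset fun u hu => ?_
    rw [mem_closedBall_zero_iff]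
    refine Real.le_sqrt_of_sq_le ?_
    rw [le_div_iff₀ hc]
    have : diagQuad w u ≤ K := hu
    linarith [hcq u]
  exact L.symm.toHomeomorph.isCompact_preimage.2 h1

/-- The moderate deviations principle for the image under `φ` of the normalized measures
`exp (-n F) g`. -/
lemma QuadraticMinimum.satisfiesLDP (h : QuadraticMinimum D F g w y₀)
    {φ : (Fin k → ℝ) → Fin k → ℝ} {L : (Fin k → ℝ) ≃L[ℝ] (Fin k → ℝ)}
    (hφ : HasFDerivAt φ (L : (Fin k → ℝ) →L[ℝ] (Fin k → ℝ)) y₀)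
    {a : ℕ → ℝ} (ha : Tendsto a atTop atTop)
    (hb : Tendsto (fun n : ℕ => (n : ℝ) / a n ^ 2) atTop atTop)
    {Ω : Type*} [MeasurableSpace Ω] {P : Measure Ω} {X : ℕ → Ω → Fin k → ℝ}
    (hX : ∀ᶠ n in atTop, ∀ S, MeasurableSet S → P {ω | X n ω ∈ S} =
      laplaceMeasure D F g n (rescaledPreimage φ y₀ (a n) S) / laplaceMeasure D F g n univ) :
    SatisfiesLDP P X (fun n => (n : ℝ) / a n ^ 2)
      fun x => ENNReal.ofReal (diagQuad w (L.symm x)) := by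
  have hu : ∀ n, rescaledPreimage φ y₀ (a n) univ = univ := fun n => by
    simp [rescaledPreimage]
  -- The total mass is a special case of both bounds: rate `0`, attained at the point `0`.
  have hmassU : ∀ η > 0, ∀ᶠ n : ℕ in atTop, laplaceMeasure D F g n univ ≤
      ENNReal.ofReal ((a n)⁻¹ ^ k * Real.exp (-((n : ℝ) / a n ^ 2 * -η))) := fun η hη => by
    have := h.eventually_laplaceMeasure_le hφ ha hb (U := univ) (s := 0) (s' := -η)
      (fun x _ => diagQuad_nonneg h.weight_pos _) (by linarith)
    simpa only [hu] using this
  have hmassL : ∀ η > 0, ∀ᶠ n : ℕ in atTop,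
      ENNReal.ofReal ((a n)⁻¹ ^ k * Real.exp (-((n : ℝ) / a n ^ 2 * η))) ≤
      laplaceMeasure D F g n univ := fun η hη => by
    have := h.eventually_le_laplaceMeasure hφ ha hb isOpen_univ (x := 0) (mem_univ _) (s := η)
      (by simpa [diagQuad_zero] using hη)
    simpa only [hu] using this
  -- The common factor `a n ^ (-k)` cancels between numerator and normalization.
  have hratio : ∀ (n : ℕ) (s t : ℝ), 0 < a n →
      ENNReal.ofReal (Real.exp (-((n : ℝ) / a n ^ 2 * (s - t)))) =
      ENNReal.ofReal ((a n)⁻¹ ^ k * Real.exp (-((n : ℝ) / a n ^ 2 * s))) /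
        ENNReal.ofReal ((a n)⁻¹ ^ k * Real.exp (-((n : ℝ) / a n ^ 2 * t))) := by
    intro n s t hn
    rw [← ENNReal.ofReal_div_of_pos (by positivity),
      mul_div_mul_left _ _ (by positivity : (a n)⁻¹ ^ k ≠ 0), ← Real.exp_sub]
    congr 2
    ring
  refine SatisfiesLDP.of_eventually_bounds hb (fun x => diagQuad_nonneg h.weight_pos _)
    ((continuous_diagQuad w).comp L.symm.continuous)
    (fun K _ => isCompact_diagQuad_le h.weight_pos L K) ?_ ?_
  · intro O hO x hx s hs
    obtain ⟨s', hs', hs's⟩ := exists_between hs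
    filter_upwards [h.eventually_le_laplaceMeasure hφ ha hb hO hx hs',
      hmassU (s - s') (sub_pos.2 hs's), hX, ha.eventually_gt_atTop 0] with n h1 h2 h3 h4
    rw [h3 O hO.measurableSet]
    have := hratio n s' (-(s - s')) h4
    rw [show s' - -(s - s') = s by ring] at this
    rw [this]
    exact ENNReal.div_le_div h1 h2
  · intro U hU s hs s' hs's
    obtain ⟨s'', h1, h2⟩ := exists_between hs's
    filter_upwards [h.eventually_laplaceMeasure_le hφ ha hb hs h2,
      hmassL (s'' - s') (sub_pos.2 h1), hX, ha.eventually_gt_atTop 0] with n h1 h2 h3 h4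
    rw [h3 U hU.measurableSet]
    have := hratio n s'' (s'' - s') h4
    rw [show s'' - (s'' - s') = s' by ring] at this
    rw [this]
    exact ENNReal.div_le_div h1 h2

end

section

/-! ### Potentials with a nondegenerate minimum -/

/-- Second order expansion at an interior minimum. -/
lemma IsUniqueMinimizer.expansion {W : ℝ → ℝ} {D : Set ℝ} {y : ℝ} (h : IsUniqueMinimizer W D y)
    (hD : IsOpen D) (hconv : Convex ℝ D) (hW : ContDiffOn ℝ 2 W D) :
    (fun t => W t - W y - 1 / 2 * (iteratedDeriv 2 W y * (t - y) ^ 2)) =o[𝓝 y]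
      fun t => (t - y) ^ 2 := by
  have hmin : IsLocalMin W y := by
    filter_upwards [hD.mem_nhds h.1] with t ht
    rcases eq_or_ne t y with rfl | hne
    · exact le_rfl
    · exact (h.2 t ht hne).le
  have h1 := taylor_isLittleO hconv h.1 (n := 2) (by exact_mod_cast hW)
  rw [hD.nhdsWithin_eq h.1] at h1
  refine h1.congr_left fun t => ?_
  have h2 : iteratedDerivWithin 2 W D y = iteratedDeriv 2 W y :=
    iteratedDerivWithin_of_isOpen hD h.1
  have h3 : iteratedDerivWithin 1 W D y = 0 := by
    rw [iteratedDerivWithin_of_isOpen hD h.1, iteratedDeriv_one, hmin.deriv_eq_zero]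
  rw [taylorWithinEval_succ, taylorWithinEval_succ, taylor_within_zero_eval]
  simp only [zero_add, one_add_one_eq_two, h2, h3, smul_eq_mul]
  norm_num
  ring

/-- A negative second derivative would, by the expansion, put points of lower value arbitrarily
close to the minimizer. -/
lemma IsUniqueMinimizer.iteratedDeriv_pos {W : ℝ → ℝ} {D : Set ℝ} {y : ℝ}
    (h : IsUniqueMinimizer W D y) (hD : IsOpen D) (hconv : Convex ℝ D) (hW : ContDiffOn ℝ 2 W D)
    (hne : iteratedDeriv 2 W y ≠ 0) : 0 < iteratedDeriv 2 W y := by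
  refine lt_of_le_of_ne (le_of_not_gt fun hneg => ?_) hne.symm
  have h1 := (h.expansion hD hconv hW).bound (show 0 < -iteratedDeriv 2 W y / 4 by linarith)
  obtain ⟨t, ⟨ht, htD⟩, hty⟩ := (((h1.and (hD.mem_nhds h.1)).filter_mono
    (nhdsWithin_le_nhds (s := {y}ᶜ))).and self_mem_nhdsWithin).exists
  have h2 := h.2 t htD hty
  rw [Real.norm_eq_abs, Real.norm_of_nonneg (sq_nonneg _)] at ht
  have h3 := (abs_le.1 ht).2
  have h4 : 0 < (t - y) ^ 2 := by
    have : t - y ≠ 0 := sub_ne_zero.2 hty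
    positivity
  nlinarith

/-- A function is coercive on `D` if it is large outside compact subsets. -/
def CoerciveOn (W : ℝ → ℝ) (D : Set ℝ) : Prop :=
  ∀ R : ℝ, ∃ C ⊆ D, IsCompact C ∧ ∀ t ∈ D, t ∉ C → R ≤ W t

/-- Outside a compact set coercivity gives a gap of `1`; on the compact part away from `y` the
minimum is attained at a point other than `y`, so it is strictly larger. -/
lemma IsUniqueMinimizer.separated {W : ℝ → ℝ} {D : Set ℝ} {y : ℝ} (h : IsUniqueMinimizer W D y)
    (hW : ContinuousOn W D) (hc : CoerciveOn W D) {δ : ℝ} (hδ : 0 < δ) :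
    ∃ η > 0, ∀ t ∈ D, δ ≤ |t - y| → W y + η ≤ W t := by
  obtain ⟨C, hCD, hC, hR⟩ := hc (W y + 1)
  set C' := C ∩ {t | δ ≤ |t - y|} with hC'
  have hcomp : IsCompact C' := hC.inter_right (isClosed_le continuous_const (by fun_prop))
  rcases C'.eq_empty_or_nonempty with he | hne
  · refine ⟨1, one_pos, fun t ht htδ => hR t ht fun htC => ?_⟩
    exact he.subset (show t ∈ C' from ⟨htC, htδ⟩)
  · obtain ⟨s, hs, hmin⟩ := hcomp.exists_isMinOn hne (hW.mono (inter_subset_left.trans hCD))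
    have hsy : s ≠ y := by
      rintro rfl
      have := hs.2
      simp only [Set.mem_ofPred_eq, sub_self, abs_zero] at this
      linarith
    have hpos := h.2 s (hCD hs.1) hsy
    refine ⟨min 1 (W s - W y), lt_min one_pos (sub_pos.2 hpos), fun t ht htδ => ?_⟩
    by_cases htC : t ∈ C
    · have h1 : W s ≤ W t := hmin ⟨htC, htδ⟩
      linarith [min_le_right 1 (W s - W y)]
    · linarith [min_le_left 1 (W s - W y), hR t ht htC]

lemma coerciveOn_sub_log_mul {V : ℝ → ℝ} (hV : ContinuousOn V (Icc 0 1)) :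
    CoerciveOn (fun t => V t - Real.log (t * (1 - t))) (Ioo 0 1) := by
  intro R
  obtain ⟨m, hm⟩ := isCompact_Icc.bddBelow_image hV
  set ε := Real.exp (m - R) with hε
  have hε0 : 0 < ε := Real.exp_pos _
  refine ⟨Icc ε (1 - ε), fun t ht => ⟨by linarith [ht.1], by linarith [ht.2]⟩, isCompact_Icc,
    fun t ht htC => ?_⟩
  have h1 : m ≤ V t := hm ⟨t, ⟨ht.1.le, ht.2.le⟩, rfl⟩
  have h2 : t * (1 - t) ≤ ε := by
    by_cases h : ε ≤ t
    · have : 1 - ε < t := by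
        by_contra! h'
        exact htC ⟨h, h'⟩
      nlinarith [ht.1, ht.2]
    · nlinarith [ht.1, ht.2]
  have h3 := Real.log_le_log (mul_pos ht.1 (sub_pos.2 ht.2)) h2
  rw [hε, Real.log_exp] at h3
  simp only
  linarith

/-- At infinity `V ≥ 2 log` leaves at least one `log` after the subtraction; at `0` the potential is
bounded by continuity on the closed half line and `-log` diverges. -/
lemma coerciveOn_sub_log {V : ℝ → ℝ} (hV : ContinuousOn V (Ici 0)) {r : ℝ}
    (hgr : ∀ z, r ≤ z → 2 ≤ V z / Real.log z) :
    CoerciveOn (fun t => V t - Real.log t) (Ioi 0) := by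
  intro R
  obtain ⟨m, hm⟩ := (isCompact_Icc (a := (0 : ℝ)) (b := 1)).bddBelow_image
    (hV.mono Icc_subset_Ici_self)
  set ε := min 1 (Real.exp (m - R)) with hε
  have hε0 : 0 < ε := lt_min one_pos (Real.exp_pos _)
  set T := max r (max 2 (Real.exp R)) with hT
  refine ⟨Icc ε T, fun t ht => hε0.trans_le ht.1, isCompact_Icc, fun t ht htC => ?_⟩
  simp only
  by_cases h : ε ≤ t
  · have hTt : T < t := by
      by_contra! h'
      exact htC ⟨h, h'⟩
    have h1 : r ≤ t := (le_max_left _ _).trans hTt.le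
    have h2 : 2 ≤ t := (le_max_left _ _).trans ((le_max_right _ _).trans hTt.le)
    have h3 : Real.exp R ≤ t := (le_max_right _ _).trans ((le_max_right _ _).trans hTt.le)
    have hlog : 0 < Real.log t := Real.log_pos (by linarith)
    have h4 := hgr t h1
    rw [le_div_iff₀ hlog] at h4
    have h5 := Real.log_le_log (Real.exp_pos _) h3
    rw [Real.log_exp] at h5
    linarith
  · push Not at h
    have h1 : t ≤ 1 := h.le.trans (min_le_left _ _)
    have h2 : m ≤ V t := hm ⟨t, ⟨le_of_lt ht, h1⟩, rfl⟩
    have h3 := Real.log_le_log ht (h.le.trans (min_le_right _ _))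
    rw [Real.log_exp] at h3
    linarith

lemma coerciveOn_univ {V : ℝ → ℝ} {r : ℝ} (hgr : ∀ z, r ≤ |z| → 1 ≤ V z / Real.log |z|) :
    CoerciveOn V univ := by
  intro R
  set T := max r (max 2 (Real.exp R)) with hT
  refine ⟨Icc (-T) T, subset_univ _, isCompact_Icc, fun t _ htC => ?_⟩
  have hTt : T < |t| := by
    by_contra! h'
    exact htC (abs_le.1 h')
  have h2 : 2 ≤ |t| := (le_max_left _ _).trans ((le_max_right _ _).trans hTt.le)
  have h3 : Real.exp R ≤ |t| := (le_max_right _ _).trans ((le_max_right _ _).trans hTt.le)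
  have h4 := hgr t ((le_max_left _ _).trans hTt.le)
  rw [le_div_iff₀ (Real.log_pos (by linarith))] at h4
  have h5 := Real.log_le_log (Real.exp_pos _) h3
  rw [Real.log_exp] at h5
  linarith

/-! ### The effective potentials -/

variable {E : SupportInterval} {V₁ V₂ : ℝ → ℝ} {y₁ y₂ : ℝ}

/-- The effective potential of the coordinate number `i`. -/
def SupportInterval.effective (E : SupportInterval) (V₁ V₂ : ℝ → ℝ) (i : ℕ) : ℝ → ℝ :=
  alternating (E.W₁ V₁) (E.W₂ V₂) i

lemma SupportInterval.effective_eq (E : SupportInterval) (V₁ V₂ : ℝ → ℝ) (i : ℕ) (t : ℝ) :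
    E.effective V₁ V₂ i t = alternating V₁ V₂ i t - Real.log (E.factor i t) := by
  unfold SupportInterval.effective alternating SupportInterval.W₁ SupportInterval.W₂
    SupportInterval.factor
  cases E <;> split_ifs <;> simp

lemma SupportInterval.convex_range (E : SupportInterval) (i : ℕ) : Convex ℝ (E.range i) := by
  unfold SupportInterval.range alternating
  cases E <;> split_ifs
  · exact convex_Ioo 0 1
  · exact convex_Ioo 0 1
  · exact convex_Ioi 0
  · exact convex_Ioi 0
  · exact convex_univ
  · exact convex_Ioi 0

lemma SupportInterval.contDiff_factor (E : SupportInterval) (i : ℕ) :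
    ContDiff ℝ 2 (E.factor i) := by
  unfold SupportInterval.factor
  cases E with
  | compact a b => simp only; fun_prop
  | halfLine => exact contDiff_id
  | line =>
    simp only
    split_ifs
    · exact contDiff_const
    · exact contDiff_id

lemma SupportInterval.Admissible.proper (hE : E.Admissible V₁ V₂ y₁ y₂) : E.Proper :=
  hE.nondegenerate

lemma SupportInterval.Admissible.contDiffOn (hE : E.Admissible V₁ V₂ y₁ y₂) (i : ℕ) :
    ContDiffOn ℝ 2 (alternating V₁ V₂ i) (E.range i) := by
  unfold SupportInterval.range alternating
  split_ifs
  · exact hE.contDiffOn₁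
  · exact hE.contDiffOn₂

lemma SupportInterval.Admissible.continuousPotentials (hE : E.Admissible V₁ V₂ y₁ y₂) :
    E.ContinuousPotentials V₁ V₂ := fun i => (hE.contDiffOn i).continuousOn

lemma SupportInterval.Admissible.contDiffOn_effective (hE : E.Admissible V₁ V₂ y₁ y₂) (i : ℕ) :
    ContDiffOn ℝ 2 (E.effective V₁ V₂ i) (E.range i) := by
  refine ((hE.contDiffOn i).sub ((E.contDiff_factor i).contDiffOn.log fun t ht =>
    (E.factor_pos ht).ne')).congr fun t _ => E.effective_eq V₁ V₂ i t

lemma SupportInterval.Admissible.isUniqueMinimizer (hE : E.Admissible V₁ V₂ y₁ y₂) (i : ℕ) :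
    IsUniqueMinimizer (E.effective V₁ V₂ i) (E.range i) (alternating y₁ y₂ i) := by
  unfold SupportInterval.effective SupportInterval.range alternating
  split_ifs
  · exact hE.minimizer₁
  · exact hE.minimizer₂

lemma SupportInterval.Admissible.coerciveOn (hE : E.Admissible V₁ V₂ y₁ y₂) (i : ℕ) :
    CoerciveOn (E.effective V₁ V₂ i) (E.range i) := by
  have hc₁ := hE.continuousOn₁
  have hc₂ := hE.continuousOn₂
  have hgr := hE.growth
  unfold SupportInterval.effective SupportInterval.range alternating SupportInterval.W₁
    SupportInterval.W₂
  cases E with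
  | compact a b =>
    simp only [SupportInterval.oddRange, SupportInterval.evenRange,
      closure_Ioo (zero_ne_one (α := ℝ))] at hc₁ hc₂ ⊢
    split_ifs
    · exact coerciveOn_sub_log_mul hc₁
    · exact coerciveOn_sub_log_mul hc₂
  | halfLine =>
    simp only [SupportInterval.oddRange, SupportInterval.evenRange, closure_Ioi] at hc₁ hc₂ ⊢
    obtain ⟨ε, hε, r, hr⟩ := hgr
    split_ifs
    · exact coerciveOn_sub_log hc₁ fun z hz => by linarith [(hr z hz).1]
    · exact coerciveOn_sub_log hc₂ fun z hz => by linarith [(hr z hz).2]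
  | line =>
    simp only [SupportInterval.oddRange, SupportInterval.evenRange, closure_Ioi] at hc₂ ⊢
    obtain ⟨ε, hε, r, hr₁, hr₂⟩ := hgr
    split_ifs
    · exact coerciveOn_univ fun z hz => by linarith [hr₁ z hz]
    · exact coerciveOn_sub_log hc₂ fun z hz => by linarith [hr₂ z hz]

/-- The second derivatives of the effective potentials at their minimizers. -/
def SupportInterval.curvature (E : SupportInterval) (V₁ V₂ : ℝ → ℝ) (y₁ y₂ : ℝ) (i : ℕ) : ℝ :=
  alternating (iteratedDeriv 2 (E.W₁ V₁) y₁) (iteratedDeriv 2 (E.W₂ V₂) y₂) i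

lemma SupportInterval.curvature_eq (E : SupportInterval) (V₁ V₂ : ℝ → ℝ) (y₁ y₂ : ℝ) (i : ℕ) :
    E.curvature V₁ V₂ y₁ y₂ i =
      iteratedDeriv 2 (E.effective V₁ V₂ i) (alternating y₁ y₂ i) := by
  unfold SupportInterval.curvature SupportInterval.effective alternating
  split_ifs <;> rfl

lemma SupportInterval.Admissible.curvature_pos (hE : E.Admissible V₁ V₂ y₁ y₂) (i : ℕ) :
    0 < E.curvature V₁ V₂ y₁ y₂ i := by
  have hne : E.curvature V₁ V₂ y₁ y₂ i ≠ 0 := by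
    unfold SupportInterval.curvature alternating
    split_ifs
    · exact hE.deriv_ne₁
    · exact hE.deriv_ne₂
  rw [E.curvature_eq] at hne ⊢
  exact (hE.isUniqueMinimizer i).iteratedDeriv_pos (E.isOpen_range i) (E.convex_range i)
    (hE.contDiffOn_effective i) hne

/-! ### The law of the coordinates as a Laplace measure -/

/-- The excess `∑ᵢ (Wᵢ(yᵢ) - Wᵢ(yᵢ*))` of the effective potentials. -/
def SupportInterval.phase (E : SupportInterval) (V₁ V₂ : ℝ → ℝ) (y₁ y₂ : ℝ) (k : ℕ)
    (y : Fin k → ℝ) : ℝ :=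
  ∑ i : Fin k, (E.effective V₁ V₂ i (y i) - E.effective V₁ V₂ i (alternating y₁ y₂ i))

/-- The part of the density of the coordinates that does not depend on the dimension. -/
def SupportInterval.amplitude (E : SupportInterval) (k : ℕ) (y : Fin k → ℝ) : ℝ :=
  ∏ i : Fin k, (E.factor i (y i) ^ ((i : ℕ) + 1))⁻¹

/-- Since `factor ^ n = exp (n log factor)`, the Jacobian power `n - 1 - i` turns `V` into `W` and
leaves `factor ^ (-(i + 1))`, which is free of `n`. The constant `c` carries the minimal values of
the `W`. -/
lemma SupportInterval.Admissible.pi_coordMeasure (hE : E.Admissible V₁ V₂ y₁ y₂) {k n : ℕ}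
    (hkn : k ≤ n) :
    ∃ c : ℝ≥0∞, c ≠ 0 ∧ c ≠ ∞ ∧ ∀ S, Measure.pi (fun i : Fin k => E.coordMeasure V₁ V₂ n i) S =
      c * laplaceMeasure (E.domain k) (E.phase V₁ V₂ y₁ y₂ k) (E.amplitude k) n S := by
  refine ⟨ENNReal.ofReal (Real.exp (-(n : ℝ) * ∑ i : Fin k, E.effective V₁ V₂ i
    (alternating y₁ y₂ i))), by simp [Real.exp_pos], ENNReal.ofReal_ne_top, fun S => ?_⟩
  have hpi : Measure.pi (fun i : Fin k => E.coordMeasure V₁ V₂ n i) =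
      volume.withDensity fun y : Fin k → ℝ => ∏ i : Fin k, E.coordDensity V₁ V₂ n i (y i) :=
    pi_withDensity (fun i => hE.continuousPotentials.measurable_coordDensity n i)
      fun i => E.coordDensity_ne_top _ _ _ _
  have hD : MeasurableSet (E.domain k) := (E.isOpen_domain k).measurableSet
  rw [hpi, withDensity_apply', laplaceMeasure, withDensity_apply', Measure.restrict_restrict' hD,
    ← lintegral_const_mul' _ _ ENNReal.ofReal_ne_top, inter_comm, ← setLIntegral_indicator hD]
  refine lintegral_congr fun y => ?_
  by_cases hy : y ∈ E.domain k
  · rw [indicator_of_mem hy]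
    have hf : ∀ i : Fin k, 0 < E.factor i (y i) := fun i => E.factor_pos (hy i (mem_univ i))
    have h1 : ∀ i : Fin k, E.coordDensity V₁ V₂ n i (y i) = ENNReal.ofReal
        (Real.exp (-(n : ℝ) * E.effective V₁ V₂ i (y i)) *
          (E.factor i (y i) ^ ((i : ℕ) + 1))⁻¹) := fun i => by
      rw [SupportInterval.coordDensity, indicator_of_mem (hy i (mem_univ i)), E.effective_eq]
      congr 1
      have h2 : Real.exp (-(n : ℝ) * (alternating V₁ V₂ i (y i) - Real.log (E.factor i (y i)))) =
          Real.exp (-(n : ℝ) * alternating V₁ V₂ i (y i)) * E.factor i (y i) ^ n := by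
        rw [mul_sub, sub_eq_add_neg, Real.exp_add, neg_mul, neg_mul, neg_neg, Real.exp_nat_mul,
          Real.exp_log (hf i)]
      rw [h2, mul_assoc, ← pow_sub₀ _ (hf i).ne' (by omega), Nat.sub_sub, add_comm 1]
    simp_rw [h1]
    rw [← ENNReal.ofReal_prod_of_nonneg fun i _ => mul_nonneg (Real.exp_pos _).le
        (inv_nonneg.2 (pow_nonneg (hf i).le _)), ← ENNReal.ofReal_mul (Real.exp_pos _).le,
      Finset.prod_mul_distrib, ← Real.exp_sum, ← mul_assoc, ← Real.exp_add,
      SupportInterval.phase, SupportInterval.amplitude, Finset.sum_sub_distrib, ← Finset.mul_sum]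
    congr 3
    ring
  · rw [indicator_of_notMem hy]
    have : ∃ i : Fin k, y i ∉ E.range i := by
      by_contra! h
      exact hy fun i _ => h i
    obtain ⟨i, hi⟩ := this
    exact Finset.prod_eq_zero (Finset.mem_univ i) (indicator_of_notMem hi _)

lemma SupportInterval.Admissible.alternating_mem (hE : E.Admissible V₁ V₂ y₁ y₂) (k : ℕ) :
    (fun i : Fin k => alternating y₁ y₂ (i : ℕ)) ∈ E.domain k :=
  fun i _ => (hE.isUniqueMinimizer i).1

lemma SupportInterval.Admissible.quadraticMinimum (hE : E.Admissible V₁ V₂ y₁ y₂) {k N : ℕ}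
    (hkN : k ≤ N) (hN : Measure.pi (fun i : Fin k => E.coordMeasure V₁ V₂ N i) univ ≠ ∞) :
    QuadraticMinimum (E.domain k) (E.phase V₁ V₂ y₁ y₂ k) (E.amplitude k)
      (fun i => E.curvature V₁ V₂ y₁ y₂ i) fun i => alternating y₁ y₂ i where
  isOpen := E.isOpen_domain k
  mem := hE.alternating_mem k
  weight_pos i := hE.curvature_pos i
  expansion := by
    have h1 : ∀ i ∈ (Finset.univ : Finset (Fin k)), (fun y : Fin k → ℝ =>
        E.effective V₁ V₂ i (y i) - E.effective V₁ V₂ i (alternating y₁ y₂ i) -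
          1 / 2 * (E.curvature V₁ V₂ y₁ y₂ i * (y i - alternating y₁ y₂ i) ^ 2))
        =o[𝓝 fun i : Fin k => alternating y₁ y₂ (i : ℕ)]
          fun y => ‖y - fun i : Fin k => alternating y₁ y₂ (i : ℕ)‖ ^ 2 := fun i _ => by
      have h2 := (hE.isUniqueMinimizer i).expansion (E.isOpen_range i) (E.convex_range i)
        (hE.contDiffOn_effective i)
      rw [← E.curvature_eq] at h2
      refine (h2.comp_tendsto ((continuous_apply i).tendsto
        fun i : Fin k => alternating y₁ y₂ (i : ℕ))).trans_isBigO ?_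
      refine Asymptotics.IsBigO.of_bound 1 (Eventually.of_forall fun y => ?_)
      rw [one_mul, norm_pow, Function.comp_apply, norm_pow, norm_norm]
      gcongr
      exact norm_le_pi_norm (y - fun i : Fin k => alternating y₁ y₂ (i : ℕ)) i
    refine (Asymptotics.IsLittleO.sum h1).congr_left fun y => ?_
    rw [Finset.sum_apply, Finset.sum_sub_distrib, ← Finset.mul_sum]
    rfl
  separated δ hδ := by
    choose η hη hsep using fun i : Fin k => (hE.isUniqueMinimizer i).separated
      (hE.contDiffOn_effective i).continuousOn (hE.coerciveOn i) hδ
    obtain ⟨c, hc, hcη⟩ := exists_pos_forall_le hη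
    refine ⟨c, hc, fun y hy hyδ => ?_⟩
    -- In the sup norm one coordinate is at distance at least `δ`; its excess alone is bounded
    -- below, and the others are nonnegative.
    obtain ⟨i, hi⟩ : ∃ i : Fin k, δ ≤ |y i - alternating y₁ y₂ i| := by
      by_contra! h
      exact absurd ((pi_norm_lt_iff hδ).2 h) (not_lt.2 hyδ)
    have hnn : ∀ j ∈ (Finset.univ : Finset (Fin k)),
        0 ≤ E.effective V₁ V₂ j (y j) - E.effective V₁ V₂ j (alternating y₁ y₂ j) := fun j _ => by
      rw [sub_nonneg]
      rcases eq_or_ne (y j) (alternating y₁ y₂ j) with h | h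
      · rw [h]
      · exact ((hE.isUniqueMinimizer j).2 _ (hy j (mem_univ j)) h).le
    refine le_trans ?_ (Finset.single_le_sum hnn (Finset.mem_univ i))
    linarith [hsep i _ (hy i (mem_univ i)) hi, hcη i]
  amplitude_continuousAt := by
    refine tendsto_finsetProd _ fun i _ => ?_
    have hf : E.factor i (alternating y₁ y₂ i) ^ ((i : ℕ) + 1) ≠ 0 :=
      pow_ne_zero _ (E.factor_pos (hE.isUniqueMinimizer i).1).ne'
    exact ((((E.continuous_factor i).comp (continuous_apply i)).pow _).tendsto _).inv₀ hf
  amplitude_pos := Finset.prod_pos fun i _ =>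
    inv_pos.2 (pow_pos (E.factor_pos (hE.isUniqueMinimizer i).1) _)
  integrable := by
    obtain ⟨c, hc0, -, hc⟩ := hE.pi_coordMeasure hkN
    refine ⟨N, fun h => hN ?_⟩
    rw [hc, laplaceMeasure_apply (E.isOpen_domain k), univ_inter, h, ENNReal.mul_top hc0]

/-! ### The rate function -/

/-- The inverse Jacobian matrix is the matrix of the inverse derivative. Positive curvatures make
the squares of their square roots equal to them, so the norm in the rate function is the diagonal
quadratic form. -/
lemma SupportInterval.Admissible.exists_fderiv_equiv (hE : E.Admissible V₁ V₂ y₁ y₂) (k : ℕ) :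
    ∃ L : (Fin k → ℝ) ≃L[ℝ] (Fin k → ℝ),
      HasFDerivAt (E.psi k) (L : (Fin k → ℝ) →L[ℝ] (Fin k → ℝ))
        (fun i => alternating y₁ y₂ i) ∧
      E.gaussianRate V₁ V₂ y₁ y₂ k = fun x => ENNReal.ofReal
        (diagQuad (fun i : Fin k => E.curvature V₁ V₂ y₁ y₂ i) (L.symm x)) := by
  have hmem := hE.alternating_mem k
  set y₀ : Fin k → ℝ := fun i => alternating y₁ y₂ i with hy₀
  set A := fderiv ℝ (E.psi k) y₀ with hA
  have hdet : A.det ≠ 0 := (hE.proper.det_fderiv_psi_pos hmem).ne'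
  refine ⟨A.toContinuousLinearEquivOfDetNeZero hdet,
    ((E.contDiff_psi k).differentiable (by norm_num) y₀).hasFDerivAt, ?_⟩
  have hJ : E.phiJacobian k y₀ = LinearMap.toMatrix' A.toLinearMap := hE.proper.phiJacobian_eq hmem
  have hJdet : IsUnit (E.phiJacobian k y₀).det := by
    rw [hJ, LinearMap.det_toMatrix']
    exact isUnit_iff_ne_zero.2 hdet
  ext x
  have hsymm : (A.toContinuousLinearEquivOfDetNeZero hdet).symm x =
      (E.phiJacobian k y₀)⁻¹.mulVec x := by
    rw [ContinuousLinearEquiv.symm_apply_eq]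
    have : A ((E.phiJacobian k y₀)⁻¹.mulVec x) = (E.phiJacobian k y₀).mulVec
        ((E.phiJacobian k y₀)⁻¹.mulVec x) := by
      rw [hJ, ← Matrix.toLin'_apply (LinearMap.toMatrix' A.toLinearMap), Matrix.toLin'_toMatrix']
      rfl
    rw [ContinuousLinearMap.toContinuousLinearEquivOfDetNeZero_apply, this, Matrix.mulVec_mulVec,
      Matrix.mul_nonsing_inv _ hJdet, Matrix.one_mulVec]
  rw [hsymm, SupportInterval.gaussianRate, EuclideanSpace.real_norm_sq_eq, diagQuad]
  congr 2
  refine Finset.sum_congr rfl fun i _ => ?_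
  rw [WithLp.ofLp_toLp, Matrix.mulVec_diagonal, mul_pow]
  exact congrArg (· * _) (Real.sq_sqrt (hE.curvature_pos i).le)

lemma tendsto_div_sq_atTop {a : ℕ → ℝ} (ha : Tendsto a atTop atTop)
    (ha' : a =o[atTop] fun n : ℕ => √(n : ℝ)) :
    Tendsto (fun n : ℕ => (n : ℝ) / a n ^ 2) atTop atTop := by
  have h1 := ha'.tendsto_div_nhds_zero.pow 2
  rw [zero_pow two_ne_zero] at h1
  have h2 : Tendsto (fun n : ℕ => (a n / √(n : ℝ)) ^ 2) atTop (𝓝[>] 0) := by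
    refine tendsto_nhdsWithin_iff.2 ⟨h1, ?_⟩
    filter_upwards [ha.eventually_gt_atTop 0, eventually_gt_atTop 0] with n h3 h4
    have : (0 : ℝ) < n := by exact_mod_cast h4
    exact pow_pos (div_pos h3 (Real.sqrt_pos.2 this)) 2
  refine h2.inv_tendsto_nhdsGT_zero.congr fun n => ?_
  rw [Pi.inv_apply, div_pow, Real.sq_sqrt (Nat.cast_nonneg n), inv_div]

end

end RandomMoments

end

/-! ### The moderate deviations principle for random moments -/

open RandomMoments

theorem theorem3p2 (E : SupportInterval) (V₁ V₂ : ℝ → ℝ) (y₁ y₂ : ℝ)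
    (hE : E.Admissible V₁ V₂ y₁ y₂)
    {Ω : Type*} [MeasurableSpace Ω] (P : Measure Ω) [IsProbabilityMeasure P]
    (M : (n : ℕ) → Ω → (Fin n → ℝ))
    (hM : ∀ n, 1 ≤ n → HasLaw (M n) (E.momentLaw V₁ V₂ n) P)
    (k : ℕ) (hk : 1 ≤ k)
    (a : ℕ → ℝ) (ha : Tendsto a atTop atTop)
    (ha' : a =o[atTop] fun n : ℕ => √(n : ℝ)) :
    SatisfiesLDP P
      (fun n ω => a n • (firstEntries k (M n ω) - E.limitMoments y₁ y₂ k))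
      (fun n => (n : ℝ) / a n ^ 2)
      (E.gaussianRate V₁ V₂ y₁ y₂ k) := by
  obtain ⟨L, hL, hrate⟩ := hE.exists_fderiv_equiv k
  have hlim := hE.proper.limitMoments_eq hE.minimizer₁.1 hE.minimizer₂.1 k
  -- Integrability at one exponent is read off from the law in dimension `k` itself, so `N = k`.
  have hmin := hE.quadraticMinimum le_rfl
    (hE.proper.measure_firstEntries hE.continuousPotentials le_rfl (hM k hk)).2.1
  rw [hrate, hlim]
  refine hmin.satisfiesLDP hL ha (tendsto_div_sq_atTop ha ha') ?_
  filter_upwards [eventually_ge_atTop k] with n hn S hS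
  obtain ⟨-, -, hlaw⟩ :=
    hE.proper.measure_firstEntries hE.continuousPotentials hn (hM n (hk.trans hn))
  obtain ⟨c, hc0, hc1, hc⟩ := hE.pi_coordMeasure hn
  have hA : MeasurableSet {m : Fin k → ℝ | a n • (m - E.psi k fun i => alternating y₁ y₂ i) ∈ S} :=
    hS.preimage (f := fun m : Fin k → ℝ => a n • (m - E.psi k fun i => alternating y₁ y₂ i))
      (by fun_prop)
  have h1 := hlaw _ hA
  rw [hc, hc, ENNReal.mul_div_mul_left _ _ hc0 hc1] at h1
  exact h1
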